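/- **Setting.** A centroaffine hypersurface is a smooth immersion $\psi:M^n\to\mathbb R^{n+1}$ of a smooth $n$-manifold such that for every $p\in M$ the position vector $\psi(p)$ is transversal to $d\psi(T_pM)$. For $\varepsilon\in\{1,-1\}$, the induced connection $\nabla$ and the centroaffine metric $h$ induced by $-\varepsilon\psi$ are defined by $$D_X\psi_*(Y)=\psi_*(\nabla_XY)+h(X,Y)(-\varepsilon\psi),$$ where $D$ is the flat connection of $\mathbb R^{n+1}$. The hypersurface is locally strongly convex if $h$ is positive definite for a suitable choice of $\varepsilon$. In that case, for this $\varepsilon$, let $\hat\nabla$ be the Levi-Civita connection of $h$ and $K(X,Y)=\nabla_XY-\hat\nabla_XY$. The Calabi product, with constant parameter $\lambda\neq0,-1$, of two centroaffine hypersurfaces $\psi_i:M_i\to\mathbb R^{n_i+1}$ ($i=1,2$) is the map $$\mathbb R\times M_1\times M_2\to\mathbb R^{n_1+n_2+2},\qquad (u,p,q)\mapsto(e^u\psi_1(p),\,e^{-\lambda u}\psi_2(q)).$$ **Theorem 3.1.** Let $\psi:M^n\to\mathbb R^{n+1}$ be a centroaffine hypersurface and $\varepsilon\in\{1,-1\}$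 such that the centroaffine metric $h$ induced by $-\varepsilon\psi$ is positive definite. Let $T$ be a smooth vector field with $h(T,T)=1$, let $\mathcal D_1$ be the distribution spanned by $T$, and let $\mathcal D_2,\mathcal D_3$ be smooth distributions of dimensions $n_1,n_2$ with $1+n_1+n_2=n$, such that $\mathcal D_1,\mathcal D_2,\mathcal D_3$ are mutually $h$-orthogonal. Suppose that there are real constants $\lambda_1,\lambda_2,\lambda_3$ with $$\lambda_1=\lambda_2+\lambda_3,\qquad \lambda_2\lambda_3=\varepsilon,\qquad \lambda_2\ne\lambda_3,$$ such that for all $V\in\mathcal D_2$ and $W\in\mathcal D_3$ $$K(T,T)=\lambda_1T,\quad K(T,V)=\lambda_2V,\quad K(T,W)=\lambda_3W,\quad K(V,W)=0.$$ Then $\psi$ is locally the Calabi product of two locally strongly convex centroaffine hypersurfaces of dimensions $n_1$ and $n_2$. That is, for every $p\in M$ there are a constant $\lambda\ne0,-1$, locally strongly convex centroaffine hypersurfaces $\psi_1:M_1^{n_1}\to\mathbb R^{n_1+1}$ and $\psi_2:M_2^{n_2}\to\mathbb R^{n_2+1}$, a diffeomorphism $\Phi$ from an open neighbourhood $U$ of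 $p$ onto an open subset of $\mathbb R\times M_1\times M_2$, and a linear isomorphism $A:\mathbb R^{n_1+1}\times\mathbb R^{n_2+1}\to\mathbb R^{n+1}$, such that for every $x\in U$, writing $\Phi(x)=(u,p_1,p_2)$, $$\psi(x)=A\big(e^{u}\psi_1(p_1),\,e^{-\lambda u}\psi_2(p_2)\big).$$ -/

import Mathlib

open scoped Manifold ContDiff Topology

noncomputable section

namespace Centroaffine

/-- The space `ℝ^k`. -/
abbrev Euc (k : ℕ) : Type := EuclideanSpace ℝ (Fin k)

/-- A (not necessarily continuous) tangent vector field on an `n`-manifold. -/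
abbrev VField (n : ℕ) (M : Type*) [TopologicalSpace M] [ChartedSpace (Euc n) M] : Type _ :=
  Π p : M, TangentSpace (𝓡 n) p

/-- The vector field `Y`, viewed as a map from `M` into its tangent bundle. -/
def VField.toBundle {n : ℕ} {M : Type*} [TopologicalSpace M] [ChartedSpace (Euc n) M]
    (Y : VField n M) (p : M) : TangentBundle (𝓡 n) M := ⟨p, Y p⟩

section Hypersurface

variable {n : ℕ} {M : Type*} [TopologicalSpace M] [ChartedSpace (Euc n) M]

/-- `Y` is differentiable at `p`. -/
def VField.DiffAt [IsManifold (𝓡 n) ∞ M] (Y : VField n M) (p : M) : Prop :=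
  MDifferentiableAt (𝓡 n) (𝓡 n).tangent Y.toBundle p

/-- `Y` is smooth on the set `U`. -/
def VField.SmoothOn [IsManifold (𝓡 n) ∞ M] (Y : VField n M) (U : Set M) : Prop :=
  ContMDiffOn (𝓡 n) (𝓡 n).tangent ∞ Y.toBundle U

/-- A centroaffine hypersurface `ψ : M^n → ℝ^(n+1)`: a smooth immersion such that at each point
the position vector `ψ p` is transversal to the tangent hyperplane `dψ_p (T_p M)`. -/
structure IsCentroaffine (ψ : M → Euc (n + 1)) : Prop where
  smooth : ContMDiff (𝓡 n) 𝓘(ℝ, Euc (n + 1)) ∞ ψ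
  immersion : ∀ p, Function.Injective (mvfderiv (𝓡 n) ψ p)
  transversal : ∀ p, ψ p ∉ Set.range (mvfderiv (𝓡 n) ψ p)

/-- The linear map `T_p M × ℝ → ℝ^(n+1)`, `(v, c) ↦ dψ_p v + c ψ(p)`. It is bijective for a
centroaffine hypersurface. -/
def splitting (ψ : M → Euc (n + 1)) (p : M) :
    (TangentSpace (𝓡 n) p × ℝ) →L[ℝ] Euc (n + 1) :=
  (mvfderiv (𝓡 n) ψ p).coprod (ContinuousLinearMap.toSpanSingleton ℝ (ψ p))

/-- The flat derivative `D_v ψ_*(Y)` at `p`, as a linear map in `v ∈ T_p M`. -/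
def flatDeriv (ψ : M → Euc (n + 1)) (Y : VField n M) (p : M) :
    TangentSpace (𝓡 n) p →L[ℝ] Euc (n + 1) :=
  mvfderiv (𝓡 n) (fun q ↦ mvfderiv (𝓡 n) ψ q (Y q)) p

/-- The centroaffine metric `h` induced by `-ε ψ`: `h(v, w)` is the coefficient of `-ε ψ` in
`D_v ψ_*(W)`, where `W` is any extension of `w` (see `gauss_formula`). -/
def metric (ε : ℝ) (ψ : M → Euc (n + 1)) [IsManifold (𝓡 n) ∞ M] (p : M)
    (v w : TangentSpace (𝓡 n) p) : ℝ :=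
  -ε * ((splitting ψ p).inverse (flatDeriv ψ (FiberBundle.extend (Euc n) w) p v)).2

/-- Positive definiteness of the centroaffine metric induced by `-ε ψ`. -/
def MetricPosDef (ε : ℝ) (ψ : M → Euc (n + 1)) [IsManifold (𝓡 n) ∞ M] : Prop :=
  ∀ (p : M) (v : TangentSpace (𝓡 n) p), v ≠ 0 → 0 < metric ε ψ p v v

/-- A locally strongly convex centroaffine hypersurface: for a suitable sign `ε`, the centroaffine
metric induced by `-ε ψ` is positive definite. -/
structure IsLocallyStronglyConvex (ψ : M → Euc (n + 1)) [IsManifold (𝓡 n) ∞ M] : Prop where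
  centroaffine : IsCentroaffine ψ
  definite : ∃ ε : ℝ, (ε = 1 ∨ ε = -1) ∧ MetricPosDef ε ψ

lemma IsCentroaffine.splitting_isInvertible {ψ : M → Euc (n + 1)} (hψ : IsCentroaffine ψ) (p : M) :
    (splitting ψ p).IsInvertible := by
  have hinj : Function.Injective (splitting ψ p) := by
    rw [injective_iff_map_eq_zero]
    rintro ⟨v, c⟩ hvc
    simp only [splitting, ContinuousLinearMap.coprod_apply,
      ContinuousLinearMap.toSpanSingleton_apply] at hvc
    have hc : c = 0 := by
      by_contra hc
      apply hψ.transversal p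
      refine ⟨-(c⁻¹ • v), ?_⟩
      rw [map_neg, map_smul, eq_neg_of_add_eq_zero_left hvc, smul_neg, neg_neg, smul_smul,
        inv_mul_cancel₀ hc, one_smul]
    subst hc
    have hv : v = 0 := by
      apply hψ.immersion p
      simpa using hvc
    simp [hv]
  have : FiniteDimensional ℝ (TangentSpace (𝓡 n) p) := inferInstanceAs (FiniteDimensional ℝ (Euc n))
  have : T2Space (TangentSpace (𝓡 n) p) := inferInstanceAs (T2Space (Euc n))
  have hdim : Module.finrank ℝ (TangentSpace (𝓡 n) p × ℝ) = Module.finrank ℝ (Euc (n + 1)) := by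
    have : Module.finrank ℝ (TangentSpace (𝓡 n) p) = n :=
      (finrank_euclideanSpace_fin (𝕜 := ℝ) (n := n))
    rw [Module.finrank_prod, this]
    simp
  exact ⟨(LinearEquiv.ofInjectiveOfFinrankEq (splitting ψ p).toLinearMap hinj
    hdim).toContinuousLinearEquiv, by ext x <;> rfl⟩

lemma IsCentroaffine.inverse_push {ψ : M → Euc (n + 1)} (hψ : IsCentroaffine ψ) {p : M}
    (v : TangentSpace (𝓡 n) p) :
    (splitting ψ p).inverse (mvfderiv (𝓡 n) ψ p v) = (v, 0) := by
  have h : splitting ψ p (v, 0) = mvfderiv (𝓡 n) ψ p v := by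
    simp [splitting]
  rw [← h, (hψ.splitting_isInvertible p).inverse_apply_self]

variable [IsManifold (𝓡 n) ∞ M]

lemma IsCentroaffine.mdifferentiableAt_push {ψ : M → Euc (n + 1)} (hψ : IsCentroaffine ψ)
    {Y : VField n M} {p : M} (hY : Y.DiffAt p) :
    MDifferentiableAt (𝓡 n) 𝓘(ℝ, Euc (n + 1)) (fun q ↦ mvfderiv (𝓡 n) ψ q (Y q)) p := by
  have h1 : MDifferentiableAt (𝓡 n).tangent 𝓘(ℝ, Euc (n + 1)).tangent
      (tangentMap (𝓡 n) 𝓘(ℝ, Euc (n + 1)) ψ) (Y.toBundle p) :=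
    (hψ.smooth.contMDiff_tangentMap (m := 1) (by norm_cast)).contMDiffAt.mdifferentiableAt
      one_ne_zero
  have h2 := (contMDiff_snd_tangentBundle_modelSpace (n := 1) (Euc (n + 1))
    𝓘(ℝ, Euc (n + 1))).contMDiffAt.mdifferentiableAt one_ne_zero
    (x := tangentMap (𝓡 n) 𝓘(ℝ, Euc (n + 1)) ψ (Y.toBundle p))
  exact h2.comp p (h1.comp p hY)

lemma IsCentroaffine.flatDeriv_add {ψ : M → Euc (n + 1)} (hψ : IsCentroaffine ψ)
    {Y Z : VField n M} {p : M} (hY : Y.DiffAt p) (hZ : Z.DiffAt p) :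
    flatDeriv ψ (Y + Z) p = flatDeriv ψ Y p + flatDeriv ψ Z p := by
  have h := mvfderiv_fun_add (hψ.mdifferentiableAt_push hY) (hψ.mdifferentiableAt_push hZ)
  simpa only [flatDeriv, Pi.add_apply, map_add] using h

lemma IsCentroaffine.flatDeriv_smul {ψ : M → Euc (n + 1)} (hψ : IsCentroaffine ψ)
    {f : M → ℝ} {Y : VField n M} {p : M} (hf : MDifferentiableAt (𝓡 n) 𝓘(ℝ, ℝ) f p)
    (hY : Y.DiffAt p) :
    flatDeriv ψ (f • Y) p = f p • flatDeriv ψ Y p +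
      (mvfderiv (𝓡 n) f p).smulRight (mvfderiv (𝓡 n) ψ p (Y p)) := by
  have h := mvfderiv_fun_smul hf (hψ.mdifferentiableAt_push hY)
  simpa only [flatDeriv, Pi.smul_apply', map_smul] using h

/-- The connection `∇` induced by the centroaffine normalization: `∇_X Y` is the tangential
component of `D_X ψ_*(Y)`. -/
def inducedConnection {ψ : M → Euc (n + 1)} (hψ : IsCentroaffine ψ) :
    CovariantDerivative (𝓡 n) (Euc n) (TangentSpace (𝓡 n) : M → Type _) where
  toFun Y p := ContinuousLinearMap.fst ℝ (TangentSpace (𝓡 n) p) ℝ ∘L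
    (splitting ψ p).inverse ∘L flatDeriv ψ Y p
  isCovariantDerivativeOnUniv :=
    { add := fun {Y Z p} hY hZ _ ↦ by
        ext v : 1
        simp [hψ.flatDeriv_add hY hZ]
      leibniz := fun {Y f p} hY hf _ ↦ by
        ext v : 1
        simp [hψ.flatDeriv_smul hf hY, hψ.inverse_push] }

/-- The formula of Gauss `D_X ψ_*(Y) = ψ_*(∇_X Y) + h(X, Y) (-ε ψ)`. -/
theorem gauss_formula {ψ : M → Euc (n + 1)} (hψ : IsCentroaffine ψ) {ε : ℝ}
    (hε : ε = 1 ∨ ε = -1) {Y : VField n M} {p : M} (hY : Y.DiffAt p)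
    (v : TangentSpace (𝓡 n) p) :
    flatDeriv ψ Y p v =
      mvfderiv (𝓡 n) ψ p (inducedConnection hψ Y p v) + metric ε ψ p v (Y p) • (-ε • ψ p) := by
  have htens : TensorialAt (𝓡 n) (Euc n)
      (fun Z : VField n M ↦ ((splitting ψ p).inverse (flatDeriv ψ Z p v)).2) p :=
    { smul := fun {f Z} hf hZ ↦ by
        simp [hψ.flatDeriv_smul hf hZ, hψ.inverse_push]
      add := fun {Z W} hZ hW ↦ by
        simp [hψ.flatDeriv_add hZ hW] }
  have hpt := htens.pointwise (FiberBundle.mdifferentiableAt_extend (𝓡 n) (Euc n) (Y p)) hY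
    (FiberBundle.extend_apply_self (Euc n) (Y p))
  have hεε : ε * ε = 1 := by rcases hε with rfl | rfl <;> norm_num
  have hself : flatDeriv ψ Y p v
      = splitting ψ p ((splitting ψ p).inverse (flatDeriv ψ Y p v)) :=
    ((hψ.splitting_isInvertible p).self_apply_inverse _).symm
  have hcoef : metric ε ψ p v (Y p) • (-ε • ψ p)
      = ((splitting ψ p).inverse (flatDeriv ψ Y p v)).2 • ψ p := by
    rw [← hpt, metric, smul_smul]
    congr 1
    linear_combination ((splitting ψ p).inverse
      (flatDeriv ψ (FiberBundle.extend (Euc n) (Y p)) p v)).2 * hεε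
  rw [hcoef]
  refine hself.trans ?_
  rw [splitting, ContinuousLinearMap.coprod_apply, ContinuousLinearMap.toSpanSingleton_apply]
  rfl

/-- `cov` is the Levi-Civita connection of `g`: it is torsion free and `g` is parallel. -/
structure IsLeviCivita (g : Π p : M, TangentSpace (𝓡 n) p → TangentSpace (𝓡 n) p → ℝ)
    (cov : CovariantDerivative (𝓡 n) (Euc n) (TangentSpace (𝓡 n) : M → Type _)) : Prop where
  torsion_free : ∀ (p : M) (X Y : VField n M), X.DiffAt p → Y.DiffAt p →
    cov Y p (X p) - cov X p (Y p) = VectorField.mlieBracket (𝓡 n) X Y p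
  compatible : ∀ (p : M) (Y Z : VField n M), Y.DiffAt p → Z.DiffAt p →
    ∀ v : TangentSpace (𝓡 n) p,
      mvfderiv (𝓡 n) (fun q ↦ g q (Y q) (Z q)) p v = g p (cov Y p v) (Z p) + g p (Y p) (cov Z p v)

/-- The difference tensor `K(v, w) = ∇_v w - ∇'_v w` of the induced connection `∇` and a second
connection `∇'` (see `differenceTensor_apply`). -/
def differenceTensor {ψ : M → Euc (n + 1)} (hψ : IsCentroaffine ψ)
    (cov' : CovariantDerivative (𝓡 n) (Euc n) (TangentSpace (𝓡 n) : M → Type _))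
    (p : M) (v w : TangentSpace (𝓡 n) p) : TangentSpace (𝓡 n) p :=
  (inducedConnection hψ).difference cov' p w v

theorem differenceTensor_apply {ψ : M → Euc (n + 1)} (hψ : IsCentroaffine ψ)
    (cov' : CovariantDerivative (𝓡 n) (Euc n) (TangentSpace (𝓡 n) : M → Type _))
    (X Y : VField n M) {p : M} (hY : Y.DiffAt p) :
    differenceTensor hψ cov' p (X p) (Y p) = inducedConnection hψ Y p (X p) - cov' Y p (X p) := by
  have h := IsCovariantDerivativeOn.difference_apply
    (inducedConnection hψ).isCovariantDerivativeOnUniv cov'.isCovariantDerivativeOnUniv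
    (Set.mem_univ p) hY
  exact congrArg (fun A : TangentSpace (𝓡 n) p →L[ℝ] TangentSpace (𝓡 n) p ↦ A (X p)) h

/-- A smooth distribution of dimension `k`: subspaces `D p ⊆ T_p M` of dimension `k`, locally
spanned by smooth vector fields. -/
structure IsDistribution (k : ℕ) (D : Π p : M, Submodule ℝ (TangentSpace (𝓡 n) p)) : Prop where
  finrank_eq : ∀ p, Module.finrank ℝ (D p) = k
  locally_spanned : ∀ p, ∃ U : Set M, IsOpen U ∧ p ∈ U ∧ ∃ X : Fin k → VField n M,
    (∀ i, (X i).SmoothOn U) ∧ ∀ q ∈ U, D q = Submodule.span ℝ (Set.range fun i ↦ X i q)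

end Hypersurface

/-- The (generalized) Calabi product `(u, p, q) ↦ (e^u ψ₁(p), e^(-l u) ψ₂(q))` with parameter `l`.
-/
def calabiProduct {n₁ n₂ : ℕ} {M₁ M₂ : Type*} (l : ℝ) (ψ₁ : M₁ → Euc (n₁ + 1))
    (ψ₂ : M₂ → Euc (n₂ + 1)) (x : ℝ × M₁ × M₂) : Euc (n₁ + 1) × Euc (n₂ + 1) :=
  (Real.exp x.1 • ψ₁ x.2.1, Real.exp (-l * x.1) • ψ₂ x.2.2)

/-- `ψ : M^n → ℝ^(n+1)` is locally the Calabi product of two locally strongly convex centroaffine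
hypersurfaces of dimensions `n₁` and `n₂`: near every point of `M` there are a constant
`l ≠ 0, -1`, two such hypersurfaces `ψ₁`, `ψ₂`, a diffeomorphism `Φ` onto an open subset of
`ℝ × M₁ × M₂`, and a linear isomorphism `A : ℝ^(n₁+1) × ℝ^(n₂+1) → ℝ^(n+1)` (that is, a
centroaffine transformation) which carries the Calabi product to `ψ`. -/
def IsLocallyCalabiProduct (n₁ n₂ : ℕ) {n : ℕ} {M : Type*} [TopologicalSpace M]
    [ChartedSpace (Euc n) M] (ψ : M → Euc (n + 1)) : Prop :=
  ∀ p : M, ∃ (l : ℝ) (_ : l ≠ 0) (_ : l ≠ -1)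
    (M₁ : Type) (_ : TopologicalSpace M₁) (_ : T2Space M₁) (_ : SecondCountableTopology M₁)
    (_ : ChartedSpace (Euc n₁) M₁) (_ : IsManifold (𝓡 n₁) ∞ M₁)
    (M₂ : Type) (_ : TopologicalSpace M₂) (_ : T2Space M₂) (_ : SecondCountableTopology M₂)
    (_ : ChartedSpace (Euc n₂) M₂) (_ : IsManifold (𝓡 n₂) ∞ M₂)
    (ψ₁ : M₁ → Euc (n₁ + 1)) (ψ₂ : M₂ → Euc (n₂ + 1))
    (Φ : PartialDiffeomorph (𝓡 n) (𝓘(ℝ, ℝ).prod ((𝓡 n₁).prod (𝓡 n₂))) M (ℝ × M₁ × M₂) ∞)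
    (A : (Euc (n₁ + 1) × Euc (n₂ + 1)) ≃L[ℝ] Euc (n + 1)),
    IsLocallyStronglyConvex ψ₁ ∧ IsLocallyStronglyConvex ψ₂ ∧ p ∈ Φ.source ∧
      ∀ x ∈ Φ.source, ψ x = A (calabiProduct l ψ₁ ψ₂ (Φ x))

end Centroaffine

end

/-!
In a chart `ψ` becomes an immersion `f` of an open convex set, and `P = K(T, ·)` has the
eigenvalue `a + b` on `T` and the eigenvalues `a`, `b` on the two distributions, where `ab = ε`
and `a ≠ b`. The integrability conditions of the Gauss formula force `T` and `P` to be parallel.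
Hence `ξ = df(T)` satisfies the same second order equation as `f`, and so `ξ = B f` for a constant
endomorphism `B`, whose eigenvalues are `a` and `b`. Splitting the ambient space as `ker (B - a) ⊕
ker (B - b)` splits `f` into `f₂` and `f₃` with `df₂(T) = a f₂` and `df₃(T) = b f₃`. As `T` is
parallel, its dual form is exact, say `dt`, and `e^{-at} f₂`, `e^{-bt} f₃` are the two factors:
each of them is constant along `T` and along the distribution of the other, so that together with
`u = at` they yield the product decomposition, with `λ = -b / a`. The convexity of the factors is
read off from the second derivative of the Calabi product.
-/

noncomputable section

set_option maxSynthPendingDepth 3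

namespace Centroaffine

section Calculus

variable {X A B C : Type*} [NormedAddCommGroup X] [NormedSpace ℝ X] [NormedAddCommGroup A]
  [NormedSpace ℝ A] [NormedAddCommGroup B] [NormedSpace ℝ B] [NormedAddCommGroup C]
  [NormedSpace ℝ C]

lemma fderiv_clm_apply_apply {c : X → A →L[ℝ] B} {a : X → A} {x : X}
    (hc : DifferentiableAt ℝ c x) (ha : DifferentiableAt ℝ a x) (u : X) :
    fderiv ℝ (fun y ↦ c y (a y)) x u = fderiv ℝ c x u (a x) + c x (fderiv ℝ a x u) := by
  rw [fderiv_clm_apply hc ha]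
  simp [add_comm]

lemma fderiv_clm_apply₂_apply {c : X → A →L[ℝ] B →L[ℝ] C} {a : X → A} {b : X → B} {x : X}
    (hc : DifferentiableAt ℝ c x) (ha : DifferentiableAt ℝ a x) (hb : DifferentiableAt ℝ b x)
    (u : X) :
    fderiv ℝ (fun y ↦ c y (a y) (b y)) x u =
      fderiv ℝ c x u (a x) (b x) + c x (fderiv ℝ a x u) (b x) + c x (a x) (fderiv ℝ b x u) := by
  rw [fderiv_clm_apply_apply (hc.clm_apply ha) hb, fderiv_clm_apply_apply hc ha, add_apply]

lemma fderiv_clm_apply_const {c : X → A →L[ℝ] B} {x : X} (hc : DifferentiableAt ℝ c x) (a : A)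
    (u : X) : fderiv ℝ (fun y ↦ c y a) x u = fderiv ℝ c x u a := by
  simp [fderiv_clm_apply_apply hc (differentiableAt_const a)]

lemma fderiv_clm_apply₂_const {c : X → A →L[ℝ] B →L[ℝ] C} {x : X} (hc : DifferentiableAt ℝ c x)
    (a : A) (b : B) (u : X) : fderiv ℝ (fun y ↦ c y a b) x u = fderiv ℝ c x u a b := by
  simp [fderiv_clm_apply₂_apply hc (differentiableAt_const a) (differentiableAt_const b)]

lemma fderiv_fderiv_symm {f : X → A} {x : X} (hf : ContDiffAt ℝ ∞ f x) (u v : X) :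
    fderiv ℝ (fderiv ℝ f) x u v = fderiv ℝ (fderiv ℝ f) x v u :=
  (hf.isSymmSndFDerivAt (by simpa using WithTop.coe_le_coe.2 (le_top : (2 : ℕ∞) ≤ ⊤))) u v

end Calculus

section Covariant

variable {E : Type*} [NormedAddCommGroup E] [NormedSpace ℝ E] {Γ K : E → E →L[ℝ] E →L[ℝ] E}
  {A : E → E →L[ℝ] E} {X : E → E} {x : E}

/-- The covariant differential `u ↦ ∇_u X` of a vector field `X`, for the connection
`∇_u X = D_u X + Γ(u, X)` on a vector space. -/
def covField (Γ : E → E →L[ℝ] E →L[ℝ] E) (X : E → E) (x : E) : E →L[ℝ] E :=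
  fderiv ℝ X x + (Γ x).flip (X x)

/-- The covariant derivative `∇_u A` of an endomorphism field `A`. -/
def covEnd (Γ : E → E →L[ℝ] E →L[ℝ] E) (A : E → E →L[ℝ] E) (x u : E) : E →L[ℝ] E :=
  fderiv ℝ A x u + Γ x u ∘L A x - A x ∘L Γ x u

/-- The covariant derivative `(∇_u K)(v, w)` of a field `K` of bilinear maps. -/
def covDiff (Γ K : E → E →L[ℝ] E →L[ℝ] E) (x u v w : E) : E :=
  fderiv ℝ K x u v w + Γ x u (K x v w) - K x (Γ x u v) w - K x v (Γ x u w)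

/-- The curvature `R(u, v) w` of the connection with connection form `Γ`. -/
def curv (Γ : E → E →L[ℝ] E →L[ℝ] E) (x u v w : E) : E :=
  fderiv ℝ Γ x u v w + Γ x u (Γ x v w) - fderiv ℝ Γ x v u w - Γ x v (Γ x u w)

lemma covField_apply (u : E) : covField Γ X x u = fderiv ℝ X x u + Γ x u (X x) := rfl

lemma covEnd_apply (u v : E) :
    covEnd Γ A x u v = fderiv ℝ A x u v + Γ x u (A x v) - A x (Γ x u v) := rfl

lemma covField_const (v u : E) : covField Γ (fun _ ↦ v) x u = Γ x u v := by
  simp [covField_apply]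

lemma covField_congr {Y : E → E} (hXY : X =ᶠ[𝓝 x] Y) : covField Γ X x = covField Γ Y x := by
  rw [covField, covField, hXY.fderiv_eq, hXY.eq_of_nhds]

lemma covField_add {Y : E → E} (hX : DifferentiableAt ℝ X x) (hY : DifferentiableAt ℝ Y x)
    (u : E) :
    covField Γ (fun y ↦ X y + Y y) x u = covField Γ X x u + covField Γ Y x u := by
  simp only [covField_apply, fderiv_fun_add hX hY, add_apply, map_add]
  abel

lemma covField_smul {g : E → ℝ} (hg : DifferentiableAt ℝ g x) (hX : DifferentiableAt ℝ X x)
    (u : E) :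
    covField Γ (fun y ↦ g y • X y) x u = fderiv ℝ g x u • X x + g x • covField Γ X x u := by
  simp only [covField_apply, fderiv_fun_smul hg hX, add_apply, smul_apply,
    ContinuousLinearMap.smulRight_apply, map_smul, smul_add]
  abel

lemma covField_clm_apply (hA : DifferentiableAt ℝ A x) (hX : DifferentiableAt ℝ X x) (u : E) :
    covField Γ (fun y ↦ A y (X y)) x u = covEnd Γ A x u (X x) + A x (covField Γ X x u) := by
  simp only [covField_apply, covEnd_apply, fderiv_clm_apply_apply hA hX, map_add]
  abel

lemma covEnd_clm_apply (hK : DifferentiableAt ℝ K x) (hX : DifferentiableAt ℝ X x) (u v : E) :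
    covEnd Γ (fun y ↦ K y (X y)) x u v = covDiff Γ K x u (X x) v + K x (covField Γ X x u) v := by
  simp only [covField_apply, covEnd_apply, covDiff, fderiv_clm_apply_apply hK hX, map_add,
    add_apply]
  abel

lemma contDiffAt_flip_apply (hΓ : ContDiffAt ℝ ∞ Γ x) (hX : ContDiffAt ℝ ∞ X x) :
    ContDiffAt ℝ ∞ (fun y ↦ (Γ y).flip (X y)) x :=
  ((ContinuousLinearMap.flipₗᵢ ℝ E E E).contDiff.contDiffAt.comp x hΓ).clm_apply hX

lemma contDiffAt_covField (hΓ : ContDiffAt ℝ ∞ Γ x) (hX : ContDiffAt ℝ ∞ X x) :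
    ContDiffAt ℝ ∞ (covField Γ X) x :=
  (hX.fderiv_right (by norm_cast)).add (contDiffAt_flip_apply hΓ hX)

lemma ricci_identity (hΓ : ContDiffAt ℝ ∞ Γ x) (hsymm : ∀ u v, Γ x u v = Γ x v u)
    (hX : ContDiffAt ℝ ∞ X x) (u v : E) :
    covEnd Γ (covField Γ X) x u v - covEnd Γ (covField Γ X) x v u = curv Γ x u v (X x) := by
  have hDX : DifferentiableAt ℝ (fderiv ℝ X) x :=
    (hX.fderiv_right (m := ∞) (by norm_cast)).differentiableAt (by simp)
  have hflip := (contDiffAt_flip_apply hΓ hX).differentiableAt (by simp)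
  have hC : ∀ u v, fderiv ℝ (covField Γ X) x u v =
      fderiv ℝ (fderiv ℝ X) x u v + fderiv ℝ Γ x u v (X x) + Γ x v (fderiv ℝ X x u) := by
    intro u v
    rw [show covField Γ X = fun y ↦ fderiv ℝ X y + (Γ y).flip (X y) from rfl,
      fderiv_fun_add hDX hflip, add_apply, add_apply, ← fderiv_clm_apply_const hflip]
    simp only [ContinuousLinearMap.flip_apply]
    rw [fderiv_clm_apply₂_apply (hΓ.differentiableAt (by simp)) (differentiableAt_const v)
      (hX.differentiableAt (by simp))]
    simp [add_assoc]
  simp only [covEnd_apply, hC, covField_apply, curv, hsymm v u, fderiv_fderiv_symm hX v u, map_add]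
  abel

lemma curv_antisymm (u v w : E) : curv Γ x u v w = -curv Γ x v u w := by
  simp only [curv]
  abel

lemma covField_conn_sub (hΓ : DifferentiableAt ℝ Γ x) (u v w : E) :
    covField Γ (fun y ↦ Γ y v w) x u - covField Γ (fun y ↦ Γ y u w) x v = curv Γ x u v w := by
  simp only [covField_apply, curv, fderiv_clm_apply₂_const hΓ]
  abel

end Covariant

lemma eq_zero_of_symm_of_skew {V : Type*} {N : V → V → V → ℝ}
    (hsymm : ∀ u v w, N u v w = N v u w) (hskew : ∀ u v w, N u v w = -N u w v) (u v w : V) :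
    N u v w = 0 := by
  linarith [hskew u v w, hsymm u w v, hskew w u v, hsymm w v u, hskew v w u, hsymm v u w]

/-- `Γ` is the connection form of the Levi-Civita connection of the Riemannian metric `h` on the
open subset `O` of a vector space. -/
structure IsLeviCivitaOn {E : Type*} [NormedAddCommGroup E] [NormedSpace ℝ E] (O : Set E)
    (Γ : E → E →L[ℝ] E →L[ℝ] E) (h : E → E →L[ℝ] E →L[ℝ] ℝ) : Prop where
  isOpen : IsOpen O
  smooth_conn : ContDiffOn ℝ ∞ Γ O
  smooth_metric : ContDiffOn ℝ ∞ h O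
  conn_symm : ∀ x ∈ O, ∀ u v, Γ x u v = Γ x v u
  metric_symm : ∀ x ∈ O, ∀ u v, h x u v = h x v u
  metric_pos : ∀ x ∈ O, ∀ v, v ≠ 0 → 0 < h x v v
  compatible : ∀ x ∈ O, ∀ u v w, fderiv ℝ h x u v w = h x (Γ x u v) w + h x v (Γ x u w)

namespace IsLeviCivitaOn

variable {E : Type*} [NormedAddCommGroup E] [NormedSpace ℝ E] {O : Set E}
  {Γ K : E → E →L[ℝ] E →L[ℝ] E} {h : E → E →L[ℝ] E →L[ℝ] ℝ} {A : E → E →L[ℝ] E} {X Y T : E → E}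
  {x : E} (H : IsLeviCivitaOn O Γ h)
include H

lemma mem_nhds (hx : x ∈ O) : O ∈ 𝓝 x := H.isOpen.mem_nhds hx

lemma contDiffAt_conn (hx : x ∈ O) : ContDiffAt ℝ ∞ Γ x :=
  H.smooth_conn.contDiffAt (H.mem_nhds hx)

lemma differentiableAt_conn (hx : x ∈ O) : DifferentiableAt ℝ Γ x :=
  (H.contDiffAt_conn hx).differentiableAt (by simp)

lemma contDiffAt_metric (hx : x ∈ O) : ContDiffAt ℝ ∞ h x :=
  H.smooth_metric.contDiffAt (H.mem_nhds hx)

lemma differentiableAt_metric (hx : x ∈ O) : DifferentiableAt ℝ h x :=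
  (H.contDiffAt_metric hx).differentiableAt (by simp)

lemma eq_zero_of_metric_self (hx : x ∈ O) {v : E} (hv : h x v v = 0) : v = 0 := by
  by_contra hne
  exact (H.metric_pos x hx v hne).ne' hv

lemma metric_ext (hx : x ∈ O) {v w : E} (hvw : ∀ z, h x v z = h x w z) : v = w := by
  refine sub_eq_zero.1 (H.eq_zero_of_metric_self hx ?_)
  rw [map_sub (h x) v w, sub_apply, hvw, sub_self]

lemma fderiv_metric_apply (hx : x ∈ O) (hX : DifferentiableAt ℝ X x) (hY : DifferentiableAt ℝ Y x)
    (u : E) : fderiv ℝ (fun y ↦ h y (X y) (Y y)) x u =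
      h x (covField Γ X x u) (Y x) + h x (X x) (covField Γ Y x u) := by
  rw [fderiv_clm_apply₂_apply (H.differentiableAt_metric hx) hX hY, H.compatible x hx]
  simp only [covField_apply, map_add, add_apply]
  ring

lemma covEnd_adjoint (hx : x ∈ O) (hA : DifferentiableAt ℝ A x) {σ : ℝ}
    (hadj : ∀ y ∈ O, ∀ v w, h y (A y v) w = σ * h y v (A y w)) (u v w : E) :
    h x (covEnd Γ A x u v) w = σ * h x v (covEnd Γ A x u w) := by
  have dv : ∀ v : E, DifferentiableAt ℝ (fun y ↦ A y v) x := fun v ↦ by fun_prop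
  have hD : fderiv ℝ (fun y ↦ h y (A y v) w) x u = fderiv ℝ (fun y ↦ σ * h y v (A y w)) x u := by
    rw [(Filter.eventuallyEq_of_mem (H.mem_nhds hx) fun y hy ↦ hadj y hy v w).fderiv_eq]
  have hh := H.differentiableAt_metric hx
  rw [fderiv_const_mul (by fun_prop), smul_apply, smul_eq_mul,
    H.fderiv_metric_apply hx (dv v) (by fun_prop), H.fderiv_metric_apply hx (by fun_prop) (dv w),
    covField_clm_apply hA (differentiableAt_const v),
    covField_clm_apply hA (differentiableAt_const w)] at hD
  simp only [map_add, add_apply, hadj x hx] at hD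
  linarith

lemma curv_skew (hx : x ∈ O) (u v w z : E) :
    h x (curv Γ x u v w) z = -h x w (curv Γ x u v z) := by
  have dΓ := H.differentiableAt_conn hx
  have dh := H.differentiableAt_metric hx
  have d : ∀ v w : E, DifferentiableAt ℝ (fun y ↦ Γ y v w) x := fun v w ↦ by fun_prop
  have hsmooth : ContDiffAt ℝ ∞ (fun y ↦ h y w z) x :=
    ((H.contDiffAt_metric hx).clm_apply contDiffAt_const).clm_apply contDiffAt_const
  have hD2 : ∀ u v : E, fderiv ℝ (fderiv ℝ fun y ↦ h y w z) x u v =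
      h x (covField Γ (fun y ↦ Γ y v w) x u) z + h x (Γ x v w) (Γ x u z) +
      (h x (Γ x u w) (Γ x v z) + h x w (covField Γ (fun y ↦ Γ y v z) x u)) := by
    intro u v
    have hD : (fun y ↦ fderiv ℝ (fun y ↦ h y w z) y v) =ᶠ[𝓝 x]
        fun y ↦ h y (Γ y v w) z + h y w (Γ y v z) := by
      filter_upwards [H.mem_nhds hx] with y hy
      simp only [H.fderiv_metric_apply hy (differentiableAt_const w) (differentiableAt_const z),
        covField_const]
    rw [← fderiv_clm_apply_const ((hsmooth.fderiv_right (m := ∞) (by norm_cast)).differentiableAt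
      (by simp)), hD.fderiv_eq, fderiv_fun_add ((dh.clm_apply (d v w)).clm_apply (by fun_prop))
        (by fun_prop), add_apply, H.fderiv_metric_apply hx (d v w) (by fun_prop),
      H.fderiv_metric_apply hx (by fun_prop) (d v z), covField_const, covField_const]
  have hsymm := fderiv_fderiv_symm hsmooth u v
  rw [hD2, hD2] at hsymm
  simp only [← covField_conn_sub dΓ, map_sub, sub_apply]
  linarith

lemma bianchi (hx : x ∈ O) (u v w : E) :
    curv Γ x u v w + curv Γ x v w u + curv Γ x w u v = 0 := by
  have hsymm : ∀ u v w : E, fderiv ℝ Γ x u v w = fderiv ℝ Γ x u w v := by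
    intro u v w
    have dΓ := H.differentiableAt_conn hx
    rw [← fderiv_clm_apply₂_const dΓ, ← fderiv_clm_apply₂_const dΓ,
      (Filter.eventuallyEq_of_mem (H.mem_nhds hx) fun y hy ↦ H.conn_symm y hy v w).fderiv_eq]
  simp only [curv, hsymm _ w u, hsymm _ v w, hsymm _ u v, H.conn_symm x hx w u,
    H.conn_symm x hx v w, H.conn_symm x hx u v]
  abel

lemma curv_left_eq_zero (hx : x ∈ O) {t : E} (ht : ∀ u v, curv Γ x u v t = 0) (u v : E) :
    curv Γ x u t v = 0 := by
  refine H.metric_ext hx fun z ↦ ?_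
  rw [map_zero, zero_apply]
  refine eq_zero_of_symm_of_skew (N := fun u v z ↦ h x (curv Γ x u t v) z) (fun u v z ↦ ?_)
    (fun u v z ↦ by rw [H.curv_skew hx, H.metric_symm x hx]) u v z
  have hB := H.bianchi hx u t v
  rw [ht v u, add_zero, curv_antisymm t v u, ← sub_eq_add_neg, sub_eq_zero] at hB
  rw [hB]

lemma metric_covField_self (hx : x ∈ O) (hT : ContDiffOn ℝ ∞ T O)
    (hunit : ∀ y ∈ O, h y (T y) (T y) = 1) (u : E) : h x (T x) (covField Γ T x u) = 0 := by
  have dT := (hT.contDiffAt (H.mem_nhds hx)).differentiableAt (by simp)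
  have hD := H.fderiv_metric_apply hx dT dT u
  rw [(Filter.eventuallyEq_of_mem (H.mem_nhds hx) hunit).fderiv_eq,
    H.metric_symm x hx (covField Γ T x u)] at hD
  simp only [fderiv_fun_const, Pi.zero_apply, zero_apply] at hD
  linarith

/-- Differentiating `∇_T T = 0`, the Ricci identity gives `∇_T (∇ T) = -(∇ T)²`; the left side is
skew-adjoint, the right side self-adjoint. -/
lemma covField_eq_zero_of_killing (hT : ContDiffOn ℝ ∞ T O)
    (hunit : ∀ y ∈ O, h y (T y) (T y) = 1)
    (hskew : ∀ y ∈ O, ∀ u v, h y (covField Γ T y u) v = -h y u (covField Γ T y v))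
    (hcurv : ∀ y ∈ O, ∀ u, curv Γ y u (T y) (T y) = 0) (hx : x ∈ O) : covField Γ T x = 0 := by
  have hTx := hT.contDiffAt (H.mem_nhds hx)
  have dC := (contDiffAt_covField (H.contDiffAt_conn hx) hTx).differentiableAt (by simp)
  have hCT : ∀ y ∈ O, covField Γ T y (T y) = 0 := fun y hy ↦ H.metric_ext hy fun z ↦ by
    rw [hskew y hy, H.metric_covField_self hy hT hunit, map_zero, zero_apply, neg_zero]
  have hCC : ∀ u, covEnd Γ (covField Γ T) x u (T x) = -covField Γ T x (covField Γ T x u) := by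
    intro u
    have hD : covField Γ (fun y ↦ covField Γ T y (T y)) x u = 0 := by
      rw [covField_congr (Filter.eventuallyEq_of_mem (H.mem_nhds hx) hCT), covField_const, map_zero]
    rw [covField_clm_apply dC (hTx.differentiableAt (by simp))] at hD
    exact eq_neg_of_add_eq_zero_left hD
  ext u
  refine H.eq_zero_of_metric_self hx ?_
  have hricci := ricci_identity (H.contDiffAt_conn hx) (H.conn_symm x hx) hTx u (T x)
  rw [hcurv x hx, hCC, sub_eq_zero] at hricci
  have hadj := H.covEnd_adjoint hx dC (σ := -1) (fun y hy v w ↦ by rw [hskew y hy]; ring) (T x) u u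
  rw [← hricci, H.metric_symm x hx u] at hadj
  simp only [map_neg, neg_apply, hskew x hx _ u] at hadj
  rw [H.metric_symm x hx] at hadj
  linarith

end IsLeviCivitaOn

section StructureEquations

variable {E F : Type*} [NormedAddCommGroup E] [NormedSpace ℝ E] [NormedAddCommGroup F]
  [NormedSpace ℝ F]

/-- Flat form of the centroaffine condition at `x`: `df_x` is injective and `f x` is transversal to
its range. -/
def TransversalAt (f : E → F) (x : E) : Prop :=
  ∀ (v : E) (c : ℝ), fderiv ℝ f x v + c • f x = 0 → v = 0 ∧ c = 0

lemma TransversalAt.eq_and_eq {f : E → F} {x : E} (hf : TransversalAt f x) {v w : E} {c d : ℝ}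
    (heq : fderiv ℝ f x v + c • f x = fderiv ℝ f x w + d • f x) : v = w ∧ c = d := by
  have h0 := hf (v - w) (c - d) (by rw [map_sub]; linear_combination (norm := module) heq)
  exact ⟨sub_eq_zero.1 h0.1, sub_eq_zero.1 h0.2⟩

section Integrability

variable {ε : ℝ} {f : E → F} {G : E → E →L[ℝ] E →L[ℝ] E} {h : E → E →L[ℝ] E →L[ℝ] ℝ} {x : E}

lemma fderiv_fderiv_fderiv_of_gauss (hf : ContDiffAt ℝ ∞ f x) (hG : DifferentiableAt ℝ G x)
    (hh : DifferentiableAt ℝ h x)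
    (hgauss : ∀ᶠ y in 𝓝 x, ∀ u v, fderiv ℝ (fderiv ℝ f) y u v =
      fderiv ℝ f y (G y u v) - (ε * h y u v) • f y) (u v w : E) :
    fderiv ℝ (fderiv ℝ (fderiv ℝ f)) x u v w =
      fderiv ℝ f x (fderiv ℝ G x u v w + G x u (G x v w) - (ε * h x v w) • u) +
        (-ε * (h x u (G x v w) + fderiv ℝ h x u v w)) • f x := by
  have hf1 : ContDiffAt ℝ ∞ (fderiv ℝ f) x := hf.fderiv_right (by norm_cast)
  have hf2 : ContDiffAt ℝ ∞ (fderiv ℝ (fderiv ℝ f)) x := hf1.fderiv_right (by norm_cast)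
  have df : DifferentiableAt ℝ f x := hf.differentiableAt (by simp)
  have df1 : DifferentiableAt ℝ (fderiv ℝ f) x := hf1.differentiableAt (by simp)
  have hgauss_vw : (fun y ↦ fderiv ℝ (fderiv ℝ f) y v w) =ᶠ[𝓝 x] fun y ↦
      fderiv ℝ f y (G y v w) - (ε * h y v w) • f y := hgauss.mono fun y hy ↦ hy v w
  have dG : DifferentiableAt ℝ (fun y ↦ G y v w) x := by fun_prop
  have dh : DifferentiableAt ℝ (fun y ↦ h y v w) x := by fun_prop
  rw [← fderiv_clm_apply₂_const (hf2.differentiableAt (by simp)), hgauss_vw.fderiv_eq,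
    fderiv_fun_sub (df1.clm_apply dG) ((dh.const_mul ε).fun_smul df), sub_apply,
    fderiv_clm_apply_apply df1 dG, fderiv_fun_smul (dh.const_mul ε) df, fderiv_const_mul dh]
  simp only [add_apply, smul_apply, ContinuousLinearMap.smulRight_apply,
    fderiv_clm_apply₂_const hG, fderiv_clm_apply₂_const hh, hgauss.self_of_nhds, map_add, map_sub,
    map_smul, smul_eq_mul]
  module

/-- Symmetry of the third derivative, split into tangential and transversal parts. -/
lemma integrability_of_gauss (hε : ε ≠ 0) (hf : ContDiffAt ℝ ∞ f x) (hG : DifferentiableAt ℝ G x)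
    (hh : DifferentiableAt ℝ h x) (htrans : TransversalAt f x)
    (hgauss : ∀ᶠ y in 𝓝 x, ∀ u v, fderiv ℝ (fderiv ℝ f) y u v =
      fderiv ℝ f y (G y u v) - (ε * h y u v) • f y) (u v w : E) :
    fderiv ℝ G x u v w + G x u (G x v w) - (ε * h x v w) • u =
      fderiv ℝ G x v u w + G x v (G x u w) - (ε * h x u w) • v ∧
    h x u (G x v w) + fderiv ℝ h x u v w = h x v (G x u w) + fderiv ℝ h x v u w := by
  have hsymm : fderiv ℝ (fderiv ℝ (fderiv ℝ f)) x u v w =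
      fderiv ℝ (fderiv ℝ (fderiv ℝ f)) x v u w :=
    DFunLike.congr_fun (fderiv_fderiv_symm (hf.fderiv_right (by norm_cast)) u v) w
  rw [fderiv_fderiv_fderiv_of_gauss hf hG hh hgauss u v w,
    fderiv_fderiv_fderiv_of_gauss hf hG hh hgauss v u w] at hsymm
  exact (htrans.eq_and_eq hsymm).imp_right (mul_left_cancel₀ (neg_ne_zero.2 hε))

end Integrability

/-- The structure equations of a centroaffine immersion `f` of an open set `O`, in terms of the
Levi-Civita connection `Γ` of its metric `h` and of the difference tensor `K`. -/
structure StructureEquations (ε : ℝ) (O : Set E) (f : E → F) (Γ K : E → E →L[ℝ] E →L[ℝ] E)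
    (h : E → E →L[ℝ] E →L[ℝ] ℝ) : Prop extends IsLeviCivitaOn O Γ h where
  ne_zero : ε ≠ 0
  smooth : ContDiffOn ℝ ∞ f O
  smooth_diff : ContDiffOn ℝ ∞ K O
  transversal : ∀ x ∈ O, TransversalAt f x
  gauss_formula : ∀ x ∈ O, ∀ u v, fderiv ℝ (fderiv ℝ f) x u v =
    fderiv ℝ f x (Γ x u v + K x u v) - (ε * h x u v) • f x
  diff_symm : ∀ x ∈ O, ∀ u v, K x u v = K x v u
  diff_adjoint : ∀ x ∈ O, ∀ u v w, h x (K x u v) w = h x v (K x u w)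

namespace StructureEquations

variable {ε : ℝ} {O : Set E} {f : E → F} {Γ K : E → E →L[ℝ] E →L[ℝ] E}
  {h : E → E →L[ℝ] E →L[ℝ] ℝ} {x : E} (H : StructureEquations ε O f Γ K h) (hx : x ∈ O)
include H hx

lemma contDiffAt : ContDiffAt ℝ ∞ f x := H.smooth.contDiffAt (H.mem_nhds hx)

lemma differentiableAt : DifferentiableAt ℝ f x := (H.contDiffAt hx).differentiableAt (by simp)

lemma differentiableAt_fderiv : DifferentiableAt ℝ (fderiv ℝ f) x :=
  ((H.contDiffAt hx).fderiv_right (m := ∞) (by norm_cast)).differentiableAt (by simp)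

lemma differentiableAt_diff : DifferentiableAt ℝ K x :=
  (H.smooth_diff.contDiffAt (H.mem_nhds hx)).differentiableAt (by simp)

lemma covDiff_symm (u v w : E) : covDiff Γ K x u v w = covDiff Γ K x u w v := by
  have dK := H.differentiableAt_diff hx
  have hD : fderiv ℝ K x u v w = fderiv ℝ K x u w v := by
    rw [← fderiv_clm_apply₂_const dK, ← fderiv_clm_apply₂_const dK,
      (Filter.eventuallyEq_of_mem (H.mem_nhds hx) fun y hy ↦ H.diff_symm y hy v w).fderiv_eq]
  simp only [covDiff, hD, H.diff_symm x hx v, H.diff_symm x hx _ w]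
  abel

lemma covDiff_adjoint (u v w z : E) :
    h x (covDiff Γ K x u v w) z = h x w (covDiff Γ K x u v z) := by
  have dK := H.differentiableAt_diff hx
  have hcov : ∀ w, covDiff Γ K x u v w = covEnd Γ (fun y ↦ K y v) x u w - K x (Γ x u v) w := by
    intro w
    rw [covEnd_clm_apply dK (differentiableAt_const v), covField_const, add_sub_cancel_right]
  have hadj := H.covEnd_adjoint hx (A := fun y ↦ K y v) (by fun_prop) (σ := 1)
    (fun y hy w z ↦ by rw [one_mul, H.diff_adjoint y hy]) u w z
  rw [hcov, hcov, map_sub, map_sub, sub_apply, hadj, one_mul, H.diff_adjoint x hx]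

lemma gauss_add_codazzi (u v w : E) :
    (curv Γ x u v w + K x u (K x v w) - K x v (K x u w) - ε • (h x v w • u - h x u w • v)) +
      (covDiff Γ K x u v w - covDiff Γ K x v u w) = 0 := by
  have dΓ := H.differentiableAt_conn hx
  have dK := H.differentiableAt_diff hx
  have hint := (integrability_of_gauss (G := fun y ↦ Γ y + K y) H.ne_zero (H.contDiffAt hx)
    (dΓ.add dK) (H.differentiableAt_metric hx) (H.transversal x hx)
    (Filter.eventually_of_mem (H.mem_nhds hx) H.gauss_formula) u v w).1
  rw [fderiv_fun_add dΓ dK] at hint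
  simp only [curv, covDiff, H.conn_symm x hx v u, add_apply, map_add] at hint ⊢
  linear_combination (norm := module) hint

/-- The Codazzi part of `gauss_add_codazzi` is self-adjoint in `w`, the Gauss part is skew. -/
lemma codazzi (u v w : E) : covDiff Γ K x u v w = covDiff Γ K x v u w := by
  refine H.metric_ext hx fun z ↦ ?_
  have hw := congrArg (fun y ↦ h x y z) (H.gauss_add_codazzi hx u v w)
  have hz := congrArg (fun y ↦ h x w y) (H.gauss_add_codazzi hx u v z)
  simp only [map_add, map_sub, add_apply, sub_apply, map_smul, smul_apply, smul_eq_mul, map_zero,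
    zero_apply, H.curv_skew hx u v w z, H.covDiff_adjoint hx _ _ w z, H.diff_adjoint x hx _ _ z,
    H.diff_adjoint x hx _ w] at hw hz ⊢
  rw [H.metric_symm x hx w u, H.metric_symm x hx w v] at hz
  linarith

lemma gauss (u v w : E) :
    curv Γ x u v w + K x u (K x v w) - K x v (K x u w) = ε • (h x v w • u - h x u w • v) := by
  have hGC := H.gauss_add_codazzi hx u v w
  rwa [H.codazzi hx u v w, sub_self, add_zero, sub_eq_zero] at hGC

end StructureEquations

/-- A unit vector field `T` such that `K_T` has the eigenvalue `a + b` at `T` and the eigenvalues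
`a` and `b` on the orthogonal complement of `T`. -/
structure IsEigenField (ε : ℝ) (O : Set E) (f : E → F) (Γ K : E → E →L[ℝ] E →L[ℝ] E)
    (h : E → E →L[ℝ] E →L[ℝ] ℝ) (a b : ℝ) (T : E → E) : Prop
    extends StructureEquations ε O f Γ K h where
  smooth_field : ContDiffOn ℝ ∞ T O
  unit : ∀ x ∈ O, h x (T x) (T x) = 1
  eigen : ∀ x ∈ O, K x (T x) (T x) = (a + b) • T x
  quadratic : ∀ x ∈ O, ∀ v, K x (T x) (K x (T x) v) =
    (a + b) • K x (T x) v + (ε * h x (T x) v) • T x - ε • v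
  mul_eq : a * b = ε
  ne : a ≠ b

/-- The operator `J = (a + b) - 2 K_T`. On the orthogonal complement of `T`, where the eigenvalues
of `K_T` are `a` and `b`, it is `b - a` times an involution. -/
def signEnd (a b : ℝ) (K : E → E →L[ℝ] E →L[ℝ] E) (T : E → E) (x : E) : E →L[ℝ] E :=
  (a + b) • ContinuousLinearMap.id ℝ E - (2 : ℝ) • K x (T x)

lemma signEnd_apply {a b : ℝ} {K : E → E →L[ℝ] E →L[ℝ] E} {T : E → E} {x : E} (v : E) :
    signEnd a b K T x v = (a + b) • v - (2 : ℝ) • K x (T x) v := rfl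

namespace IsEigenField

variable {ε : ℝ} {O : Set E} {f : E → F} {Γ K : E → E →L[ℝ] E →L[ℝ] E}
  {h : E → E →L[ℝ] E →L[ℝ] ℝ} {a b : ℝ} {T : E → E} {x : E}
  (H : IsEigenField ε O f Γ K h a b T) (hx : x ∈ O)
include H hx

local notation "J" => signEnd a b K T
local notation "C" => covField Γ T

lemma contDiffAt_field : ContDiffAt ℝ ∞ T x := H.smooth_field.contDiffAt (H.mem_nhds hx)

lemma differentiableAt_field : DifferentiableAt ℝ T x :=
  (H.contDiffAt_field hx).differentiableAt (by simp)

lemma signEnd_adjoint (u v : E) : h x (J x u) v = h x u (J x v) := by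
  simp only [signEnd_apply, map_sub, map_smul, sub_apply, smul_apply, H.diff_adjoint x hx]

lemma signEnd_field : J x (T x) = -(a + b) • T x := by
  rw [signEnd_apply, H.eigen x hx]
  module

lemma signEnd_signEnd (v : E) : J x (J x v) = (a - b) ^ 2 • v + (4 * ε * h x (T x) v) • T x := by
  simp only [signEnd_apply, map_sub, map_smul, H.quadratic x hx, ← H.mul_eq]
  module

lemma metric_field_signEnd (v : E) : h x (T x) (J x v) = -(a + b) * h x (T x) v := by
  rw [← H.signEnd_adjoint hx, H.signEnd_field hx, map_smul, smul_apply, smul_eq_mul]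

lemma eq_zero_of_signEnd {w : E} (hw : h x (T x) w = 0) (hJ : J x w = 0) : w = 0 := by
  have hJJ := H.signEnd_signEnd hx w
  rw [hJ, map_zero, hw, mul_zero, zero_smul, add_zero] at hJJ
  exact (smul_eq_zero.1 hJJ.symm).resolve_left (pow_ne_zero 2 (sub_ne_zero.2 H.ne))

lemma exists_eq_smul_add_signEnd (v : E) : ∃ w, v = h x (T x) v • T x + J x w := by
  refine ⟨((a - b) ^ 2)⁻¹ • J x (v - h x (T x) v • T x), ?_⟩
  rw [map_smul, H.signEnd_signEnd hx, map_sub (h x (T x)), map_smul, H.unit x hx, smul_eq_mul,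
    mul_one, sub_self, mul_zero, zero_smul, add_zero,
    inv_smul_smul₀ (pow_ne_zero 2 (sub_ne_zero.2 H.ne)), add_sub_cancel]

lemma metric_field_covField (u : E) : h x (T x) (C x u) = 0 :=
  H.metric_covField_self hx H.smooth_field H.unit u

lemma covEnd_eq_covDiff_add (u v : E) :
    covEnd Γ (fun y ↦ K y (T y)) x u v = covDiff Γ K x u (T x) v + K x (C x u) v :=
  covEnd_clm_apply (H.differentiableAt_diff hx) (H.differentiableAt_field hx) u v

lemma covDiff_field_field (u : E) : covDiff Γ K x u (T x) (T x) = J x (C x u) := by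
  have dT := H.differentiableAt_field hx
  have hD := congrArg (fun A : E →L[ℝ] E ↦ A u) (covField_congr (Γ := Γ)
    (Filter.eventuallyEq_of_mem (H.mem_nhds hx) H.eigen))
  simp only [covField_smul (differentiableAt_const _) dT, fderiv_fun_const, Pi.zero_apply,
    zero_apply, zero_smul, zero_add] at hD
  rw [covField_clm_apply ((H.differentiableAt_diff hx).clm_apply dT) dT,
    H.covEnd_eq_covDiff_add hx, H.diff_symm x hx (C x u)] at hD
  rw [signEnd_apply]
  linear_combination (norm := module) hD

lemma covDiff_field (v : E) : covDiff Γ K x (T x) (T x) v = J x (C x v) := by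
  rw [H.covDiff_symm hx, H.codazzi hx, H.covDiff_field_field hx]

lemma covEnd_comp_add_comp_covEnd (u v : E) :
    covEnd Γ (fun y ↦ K y (T y)) x u (K x (T x) v) +
      K x (T x) (covEnd Γ (fun y ↦ K y (T y)) x u v) =
    (a + b) • covEnd Γ (fun y ↦ K y (T y)) x u v +
      (ε * h x (C x u) v) • T x + (ε * h x (T x) v) • C x u := by
  have dT := H.differentiableAt_field hx
  have dP : DifferentiableAt ℝ (fun y ↦ K y (T y)) x := (H.differentiableAt_diff hx).clm_apply dT
  have dPv : DifferentiableAt ℝ (fun y ↦ K y (T y) v) x :=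
    dP.clm_apply (differentiableAt_const v)
  have hh := H.differentiableAt_metric hx
  have dθ : DifferentiableAt ℝ (fun y ↦ h y (T y) v) x := by fun_prop
  have hD := congrArg (fun A : E →L[ℝ] E ↦ A u) (covField_congr (Γ := Γ)
    ((Filter.eventuallyEq_of_mem (H.mem_nhds hx) fun y hy ↦
      (H.quadratic y hy v).trans (sub_eq_add_neg _ _))))
  rw [covField_clm_apply dP dPv, covField_clm_apply dP (differentiableAt_const v),
    covField_add (((differentiableAt_const _).fun_smul dPv).fun_add ((dθ.const_mul ε).fun_smul dT))
      (differentiableAt_const _),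
    covField_add ((differentiableAt_const _).fun_smul dPv) ((dθ.const_mul ε).fun_smul dT),
    covField_smul (differentiableAt_const _) dPv, covField_smul (dθ.const_mul ε) dT,
    covField_clm_apply dP (differentiableAt_const v), fderiv_const_mul dθ, smul_apply,
    H.fderiv_metric_apply hx dT (differentiableAt_const v)] at hD
  simp only [covField_const, map_add, map_neg, map_smul, H.quadratic x hx, fderiv_fun_const,
    Pi.zero_apply, zero_apply, smul_eq_mul] at hD
  linear_combination (norm := module) hD

lemma covField_field : C x (T x) = 0 := by
  refine H.eq_zero_of_signEnd hx (H.metric_field_covField hx _) (H.metric_ext hx fun u ↦ ?_)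
  rw [← H.covDiff_field_field hx, H.covDiff_adjoint hx, H.covDiff_field hx,
    H.metric_field_signEnd hx, H.metric_field_covField hx, mul_zero, map_zero, zero_apply]

/-- `∇_T K_T = J C` is orthogonal to `T`, so it anticommutes with `J` as `J²` is constant on the
complement of `T`. -/
lemma signEnd_covField (v : E) : J x (C x v) = -C x (J x v) := by
  have hP : ∀ v, covEnd Γ (fun y ↦ K y (T y)) x (T x) v = J x (C x v) := fun v ↦ by
    rw [H.covEnd_eq_covDiff_add hx, H.covField_field hx, map_zero, zero_apply, add_zero,
      H.covDiff_field hx]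
  have hanti := H.covEnd_comp_add_comp_covEnd hx (T x) v
  rw [hP, hP, H.covField_field hx, map_zero, zero_apply, mul_zero, zero_smul, smul_zero, add_zero,
    add_zero] at hanti
  refine eq_neg_of_add_eq_zero_left (H.eq_zero_of_signEnd hx ?_ ?_)
  · rw [map_add, H.metric_field_signEnd hx, H.metric_field_covField hx,
      H.metric_field_covField hx, mul_zero, add_zero]
  · rw [map_add, signEnd_apply (J x (C x v)), signEnd_apply v, map_sub (C x), map_smul, map_smul,
      map_sub (J x), map_smul, map_smul]
    linear_combination (norm := module) (-2 : ℝ) • hanti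

lemma covField_skew (u v : E) : h x (C x u) v = -h x u (C x v) := by
  obtain ⟨w, hw⟩ := H.exists_eq_smul_add_signEnd hx v
  have hadj := H.covDiff_adjoint hx (T x) (T x) u w
  rw [H.covDiff_field hx, H.covDiff_field hx] at hadj
  have hCv := congrArg (C x) hw
  have huv := congrArg (h x (C x u)) hw
  rw [map_add, map_smul, H.covField_field hx, smul_zero, zero_add] at hCv
  rw [map_add, map_smul, H.metric_symm x hx _ (T x), H.metric_field_covField hx, smul_zero,
    zero_add, ← H.signEnd_adjoint hx, hadj, H.signEnd_covField hx, ← hCv, map_neg] at huv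
  exact huv

omit hx in
lemma curv_field_field (x : E) (hx : x ∈ O) (u : E) : curv Γ x u (T x) (T x) = 0 := by
  have hG := H.gauss hx u (T x) (T x)
  rw [H.eigen x hx, map_smul, H.diff_symm x hx u, H.quadratic x hx, H.unit x hx,
    H.metric_symm x hx u] at hG
  linear_combination (norm := module) hG

lemma covField_eq_zero : C x = 0 :=
  H.covField_eq_zero_of_killing H.smooth_field H.unit (fun _ hy ↦ H.covField_skew hy)
    H.curv_field_field hx

lemma curv_field (u v : E) : curv Γ x u v (T x) = 0 := by
  have hcov : ∀ u v, covEnd Γ C x u v = 0 := fun u v ↦ by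
    rw [covEnd_apply, (Filter.eventuallyEq_of_mem (H.mem_nhds hx)
      fun y hy ↦ H.covField_eq_zero hy).fderiv_eq, H.covField_eq_zero hx]
    simp
  rw [← ricci_identity (H.contDiffAt_conn hx) (H.conn_symm x hx) (H.contDiffAt_field hx),
    hcov, hcov, sub_zero]

lemma diff_comm_field (u v : E) :
    K x u (K x (T x) v) - K x (T x) (K x u v) = ε • (h x (T x) v • u - h x u v • T x) := by
  have hG := H.gauss hx u (T x) v
  rwa [H.curv_left_eq_zero hx (H.curv_field hx), zero_add] at hG

lemma covEnd_eq_covDiff (u v : E) :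
    covEnd Γ (fun y ↦ K y (T y)) x u v = covDiff Γ K x u (T x) v := by
  rw [H.covEnd_eq_covDiff_add hx, H.covField_eq_zero hx, zero_apply, map_zero, zero_apply, add_zero]

lemma covEnd_comm (u v : E) :
    covEnd Γ (fun y ↦ K y (T y)) x u v = covEnd Γ (fun y ↦ K y (T y)) x v u := by
  rw [H.covEnd_eq_covDiff hx, H.covEnd_eq_covDiff hx, H.covDiff_symm hx, H.codazzi hx,
    H.covDiff_symm hx]

lemma covEnd_field (v : E) : covEnd Γ (fun y ↦ K y (T y)) x (T x) v = 0 := by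
  rw [H.covEnd_eq_covDiff hx, H.covDiff_field hx, H.covField_eq_zero hx, zero_apply, map_zero]

lemma covEnd_signEnd (u v : E) : covEnd Γ (fun y ↦ K y (T y)) x u (J x v) =
    -J x (covEnd Γ (fun y ↦ K y (T y)) x u v) := by
  have hsum := H.covEnd_comp_add_comp_covEnd hx u v
  rw [H.covField_eq_zero hx, zero_apply, map_zero, zero_apply, mul_zero, zero_smul, smul_zero,
    add_zero, add_zero] at hsum
  rw [signEnd_apply, signEnd_apply, map_sub, map_smul, map_smul]
  linear_combination (norm := module) (-2 : ℝ) • hsum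

/-- With `S = ∇ K_T`, the trilinear form `⟨S v z, J u⟩` is symmetric in `v, z`; it is skew in
`z, u` because `S v` is self-adjoint and anticommutes with `J`. -/
lemma covEnd_eq_zero (u : E) : covEnd Γ (fun y ↦ K y (T y)) x u = 0 := by
  have hadj : ∀ v z u, h x (covEnd Γ (fun y ↦ K y (T y)) x v z) u =
      h x z (covEnd Γ (fun y ↦ K y (T y)) x v u) := fun v z u ↦ by
    rw [H.covEnd_eq_covDiff hx, H.covEnd_eq_covDiff hx, H.covDiff_adjoint hx]
  have hJ : ∀ v z u, h x (covEnd Γ (fun y ↦ K y (T y)) x v z) (J x u) = 0 := by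
    refine eq_zero_of_symm_of_skew (fun v z u ↦ by rw [H.covEnd_comm hx]) fun v z u ↦ ?_
    rw [hadj, H.covEnd_signEnd hx, map_neg, ← H.signEnd_adjoint hx, H.metric_symm x hx]
  ext v
  refine H.metric_ext hx fun z ↦ ?_
  obtain ⟨w, hw⟩ := H.exists_eq_smul_add_signEnd hx z
  rw [hw, map_add, hJ, map_smul, hadj, H.covEnd_comm hx u, H.covEnd_field hx]
  simp

end IsEigenField

end StructureEquations

lemma isInvertible_of_injective {V W : Type*} [NormedAddCommGroup V] [NormedSpace ℝ V]
    [FiniteDimensional ℝ V] [NormedAddCommGroup W] [NormedSpace ℝ W] [FiniteDimensional ℝ W]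
    (hdim : Module.finrank ℝ V = Module.finrank ℝ W) {L : V →L[ℝ] W}
    (hL : Function.Injective L) : L.IsInvertible :=
  ⟨(LinearEquiv.ofInjectiveOfFinrankEq L.toLinearMap hL hdim).toContinuousLinearEquiv, rfl⟩

section Splitting

variable {E F F' : Type*} [NormedAddCommGroup E] [NormedSpace ℝ E] [NormedAddCommGroup F]
  [NormedSpace ℝ F] [NormedAddCommGroup F'] [NormedSpace ℝ F'] {f : E → F} {x : E}

/-- The linear map `(v, c) ↦ df_x v + c f(x)`, invertible exactly if `f` is a transversal immersion
at `x` of codimension one. -/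
def flatSplitting (f : E → F) (x : E) : (E × ℝ) →L[ℝ] F :=
  (fderiv ℝ f x).coprod (ContinuousLinearMap.toSpanSingleton ℝ (f x))

lemma flatSplitting_apply (f : E → F) (x v : E) (c : ℝ) :
    flatSplitting f x (v, c) = fderiv ℝ f x v + c • f x := by
  simp [flatSplitting]

lemma contDiffAt_flatSplitting (hf : ContDiffAt ℝ ∞ f x) : ContDiffAt ℝ ∞ (flatSplitting f) x := by
  have hdf : ContDiffAt ℝ ∞ (fderiv ℝ f) x := hf.fderiv_right (by norm_cast)
  have hspan := (ContinuousLinearMap.toSpanSingletonCLE (𝕜 := ℝ) (E := F)).contDiff.contDiffAt.comp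
    x hf
  have hsplit : flatSplitting f = fun y ↦ fderiv ℝ f y ∘L ContinuousLinearMap.fst ℝ E ℝ +
      ContinuousLinearMap.toSpanSingleton ℝ (f y) ∘L ContinuousLinearMap.snd ℝ E ℝ := by
    ext y p <;> simp [flatSplitting]
  rw [hsplit]
  exact (hdf.clm_comp contDiffAt_const).add (hspan.clm_comp contDiffAt_const)

lemma fderiv_flatSplitting_apply (hf : ContDiffAt ℝ ∞ f x) {G : E →L[ℝ] E →L[ℝ] E}
    {g : E →L[ℝ] E →L[ℝ] ℝ} (hgauss : ∀ u v, fderiv ℝ (fderiv ℝ f) x u v =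
      fderiv ℝ f x (G u v) - g u v • f x) (u v : E) (c : ℝ) :
    fderiv ℝ (flatSplitting f) x u (v, c) = flatSplitting f x (G u v + c • u, -g u v) := by
  have df : DifferentiableAt ℝ f x := hf.differentiableAt (by simp)
  have df1 : DifferentiableAt ℝ (fderiv ℝ f) x :=
    (hf.fderiv_right (m := ∞) (by norm_cast)).differentiableAt (by simp)
  rw [← fderiv_clm_apply_const ((contDiffAt_flatSplitting hf).differentiableAt (by simp))]
  simp only [flatSplitting_apply]
  rw [fderiv_fun_add (by fun_prop) (by fun_prop), fderiv_fun_const_smul df, add_apply, smul_apply,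
    fderiv_clm_apply_const df1, hgauss, map_add, map_smul]
  module

variable [FiniteDimensional ℝ E] [FiniteDimensional ℝ F]
  (hdim : Module.finrank ℝ F = Module.finrank ℝ E + 1)
include hdim

lemma TransversalAt.isInvertible_flatSplitting (hf : TransversalAt f x) :
    (flatSplitting f x).IsInvertible := by
  refine isInvertible_of_injective (by simp [hdim]) ?_
  rw [injective_iff_map_eq_zero]
  rintro ⟨v, c⟩ hvc
  rw [flatSplitting_apply] at hvc
  obtain ⟨rfl, rfl⟩ := hf v c hvc
  rfl

lemma TransversalAt.exists_eq_flatSplitting (hf : TransversalAt f x) (w : F) :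
    ∃ (v : E) (c : ℝ), fderiv ℝ f x v + c • f x = w :=
  ⟨((flatSplitting f x).inverse w).1, ((flatSplitting f x).inverse w).2, by
    rw [← flatSplitting_apply, (hf.isInvertible_flatSplitting hdim).self_apply_inverse]⟩

lemma contDiffAt_flatSplitting_inverse (hf : ContDiffAt ℝ ∞ f x) (hx : TransversalAt f x) :
    ContDiffAt ℝ ∞ (fun y ↦ (flatSplitting f y).inverse) x := by
  have : CompleteSpace E := FiniteDimensional.complete ℝ E
  exact (hx.isInvertible_flatSplitting hdim).contDiffAt_map_inverse.comp x
    (contDiffAt_flatSplitting hf)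

/-- The operators `flatSplitting ξ x ∘ (flatSplitting f x)⁻¹` do not depend on `x`, since both
factors obey the same linear differential equation. -/
lemma exists_clm_eq_of_gauss {O : Set E} (hO : IsOpen O) (hconn : IsPreconnected O) {ξ : E → F'}
    (hf : ContDiffOn ℝ ∞ f O) (hξ : ContDiffOn ℝ ∞ ξ O) (htrans : ∀ x ∈ O, TransversalAt f x)
    {G : E → E →L[ℝ] E →L[ℝ] E} {g : E → E →L[ℝ] E →L[ℝ] ℝ}
    (hfG : ∀ x ∈ O, ∀ u v, fderiv ℝ (fderiv ℝ f) x u v =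
      fderiv ℝ f x (G x u v) - g x u v • f x)
    (hξG : ∀ x ∈ O, ∀ u v, fderiv ℝ (fderiv ℝ ξ) x u v =
      fderiv ℝ ξ x (G x u v) - g x u v • ξ x) :
    ∃ B : F →L[ℝ] F', ∀ x ∈ O, B (f x) = ξ x := by
  set B : E → F →L[ℝ] F' := fun y ↦ flatSplitting ξ y ∘L (flatSplitting f y).inverse with hB
  have hfx : ∀ x ∈ O, ContDiffAt ℝ ∞ f x := fun x hx ↦ hf.contDiffAt (hO.mem_nhds hx)
  have hξx : ∀ x ∈ O, ContDiffAt ℝ ∞ ξ x := fun x hx ↦ hξ.contDiffAt (hO.mem_nhds hx)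
  have hBs : ∀ x ∈ O, ∀ p, B x (flatSplitting f x p) = flatSplitting ξ x p := fun x hx p ↦ by
    simp [hB, ((htrans x hx).isInvertible_flatSplitting hdim).inverse_apply_self]
  have dB : ∀ x ∈ O, DifferentiableAt ℝ B x := fun x hx ↦
    ((contDiffAt_flatSplitting (hξx x hx)).clm_comp
      (contDiffAt_flatSplitting_inverse hdim (hfx x hx) (htrans x hx))).differentiableAt (by simp)
  have hB0 : ∀ x ∈ O, fderiv ℝ B x = 0 := fun x hx ↦ by
    have dsf : DifferentiableAt ℝ (flatSplitting f) x :=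
      (contDiffAt_flatSplitting (hfx x hx)).differentiableAt (by simp)
    have dsξ : DifferentiableAt ℝ (flatSplitting ξ) x :=
      (contDiffAt_flatSplitting (hξx x hx)).differentiableAt (by simp)
    ext u w
    obtain ⟨v, c, rfl⟩ := (htrans x hx).exists_eq_flatSplitting hdim w
    have hev : (fun y ↦ B y (flatSplitting f y (v, c))) =ᶠ[𝓝 x] fun y ↦ flatSplitting ξ y (v, c) :=
      Filter.eventuallyEq_of_mem (hO.mem_nhds hx) fun y hy ↦ hBs y hy (v, c)
    have hD := DFunLike.congr_fun (hev.fderiv_eq (𝕜 := ℝ)) u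
    have ds : DifferentiableAt ℝ (fun y ↦ flatSplitting f y (v, c)) x :=
      dsf.clm_apply (differentiableAt_const _)
    rw [fderiv_clm_apply_apply (dB x hx) ds,
      fderiv_clm_apply_const dsf, fderiv_clm_apply_const dsξ,
      fderiv_flatSplitting_apply (hfx x hx) (hfG x hx),
      fderiv_flatSplitting_apply (hξx x hx) (hξG x hx), hBs x hx, add_eq_right,
      flatSplitting_apply] at hD
    exact hD
  obtain ⟨B₀, hB₀⟩ := hO.exists_is_const_of_fderiv_eq_zero hconn
    (fun x hx ↦ (dB x hx).differentiableWithinAt) hB0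
  refine ⟨B₀, fun x hx ↦ ?_⟩
  rw [← hB₀ x hx]
  simpa [flatSplitting_apply] using hBs x hx (0, 1)

end Splitting

namespace IsEigenField

variable {E F : Type*} [NormedAddCommGroup E] [NormedSpace ℝ E] [NormedAddCommGroup F]
  [NormedSpace ℝ F] {ε : ℝ} {O : Set E} {f : E → F} {Γ K : E → E →L[ℝ] E →L[ℝ] E}
  {h : E → E →L[ℝ] E →L[ℝ] ℝ} {a b : ℝ} {T : E → E} {x : E}
  (H : IsEigenField ε O f Γ K h a b T)
include H

lemma fderiv_metric_field (hx : x ∈ O) (u v : E) :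
    fderiv ℝ (fun y ↦ h y (T y)) x u v = h x (T x) (Γ x u v) := by
  have dT := H.differentiableAt_field hx
  rw [← fderiv_clm_apply_const ((H.differentiableAt_metric hx).clm_apply dT),
    H.fderiv_metric_apply hx dT (differentiableAt_const v), H.covField_eq_zero hx, covField_const]
  simp

lemma fderiv_fderiv_field (hx : x ∈ O) (u : E) :
    fderiv ℝ (fun y ↦ fderiv ℝ f y (T y)) x u =
      fderiv ℝ f x (K x (T x) u) - (ε * h x (T x) u) • f x := by
  have hT := DFunLike.congr_fun (H.covField_eq_zero hx) u
  rw [covField_apply, zero_apply] at hT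
  rw [fderiv_clm_apply_apply (H.differentiableAt_fderiv hx) (H.differentiableAt_field hx),
    H.gauss_formula x hx, eq_neg_of_add_eq_zero_left hT, H.diff_symm x hx u,
    H.metric_symm x hx u, map_add, map_neg]
  abel

lemma smooth_fderiv_field : ContDiffOn ℝ ∞ (fun y ↦ fderiv ℝ f y (T y)) O := fun _ hx ↦
  (((H.contDiffAt hx).fderiv_right (m := ∞) (by norm_cast)).clm_apply
    (H.contDiffAt_field hx)).contDiffWithinAt

lemma gauss_formula_fderiv_field (hx : x ∈ O) (u v : E) :
    fderiv ℝ (fderiv ℝ fun y ↦ fderiv ℝ f y (T y)) x u v =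
      fderiv ℝ (fun y ↦ fderiv ℝ f y (T y)) x (Γ x u v + K x u v) -
        (ε * h x u v) • fderiv ℝ f x (T x) := by
  have hξ := (H.smooth_fderiv_field.contDiffAt (H.mem_nhds hx)).fderiv_right (m := ∞)
    (by norm_cast)
  have df := H.differentiableAt hx
  have df1 := H.differentiableAt_fderiv hx
  have dP : DifferentiableAt ℝ (fun y ↦ K y (T y)) x :=
    (H.differentiableAt_diff hx).clm_apply (H.differentiableAt_field hx)
  have dPv : DifferentiableAt ℝ (fun y ↦ K y (T y) v) x := dP.clm_apply (differentiableAt_const v)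
  have dh : DifferentiableAt ℝ (fun y ↦ h y (T y)) x :=
    (H.differentiableAt_metric hx).clm_apply (H.differentiableAt_field hx)
  have dθ : DifferentiableAt ℝ (fun y ↦ h y (T y) v) x := dh.clm_apply (differentiableAt_const v)
  have hparallel := covField_clm_apply (Γ := Γ) dP (differentiableAt_const v) u
  have hsymm : h x u (K x (T x) v) = h x (T x) (K x u v) := by
    rw [← H.diff_adjoint x hx, H.diff_symm x hx, H.diff_adjoint x hx]
  rw [H.covEnd_eq_zero hx, zero_apply, zero_add, covField_const, covField_apply] at hparallel
  rw [← fderiv_clm_apply_const (hξ.differentiableAt (by simp)),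
    (Filter.eventuallyEq_of_mem (H.mem_nhds hx) fun y hy ↦ H.fderiv_fderiv_field hy v).fderiv_eq,
    fderiv_fun_sub (df1.clm_apply dPv) ((dθ.const_mul ε).fun_smul df), sub_apply,
    fderiv_clm_apply_apply df1 dPv, fderiv_fun_smul (dθ.const_mul ε) df, fderiv_const_mul dθ,
    H.gauss_formula x hx, eq_sub_of_add_eq hparallel, H.fderiv_fderiv_field hx, hsymm]
  have hcomm := congrArg (fderiv ℝ f x) (H.diff_comm_field hx u v)
  simp only [add_apply, smul_apply, ContinuousLinearMap.smulRight_apply, map_add, map_sub,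
    map_smul, smul_eq_mul, fderiv_clm_apply_const dh, H.fderiv_metric_field hx] at hcomm ⊢
  linear_combination (norm := module) hcomm

lemma exists_endomorphism [FiniteDimensional ℝ E] [FiniteDimensional ℝ F]
    (hdim : Module.finrank ℝ F = Module.finrank ℝ E + 1) (hO : IsPreconnected O) :
    ∃ B : F →L[ℝ] F, ∀ x ∈ O, B (f x) = fderiv ℝ f x (T x) :=
  exists_clm_eq_of_gauss hdim H.isOpen hO H.smooth H.smooth_fderiv_field H.transversal
    (G := fun y ↦ Γ y + K y) (g := fun y ↦ ε • h y) H.gauss_formula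
    fun _ hx ↦ H.gauss_formula_fderiv_field hx

end IsEigenField

section LinearAlgebra

lemma exists_clm_ker_eq_span_singleton {C Y : Type*} [NormedAddCommGroup C] [NormedSpace ℝ C]
    [FiniteDimensional ℝ C] [NormedAddCommGroup Y] [NormedSpace ℝ Y] [FiniteDimensional ℝ Y]
    (hdim : Module.finrank ℝ C = Module.finrank ℝ Y + 1) {y : C} (hy : y ≠ 0) :
    ∃ L : C →L[ℝ] Y, ∀ v, L v = 0 ↔ v ∈ Submodule.span ℝ {y} := by
  have hrank : Module.finrank ℝ (C ⧸ Submodule.span ℝ {y}) = Module.finrank ℝ Y := by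
    have hquot := Submodule.finrank_quotient_add_finrank (Submodule.span ℝ {y})
    rw [finrank_span_singleton hy] at hquot
    lia
  let e := LinearEquiv.ofFinrankEq _ _ hrank
  exact ⟨LinearMap.toContinuousLinearMap (e.toLinearMap ∘ₗ (Submodule.span ℝ {y}).mkQ),
    fun v ↦ by simp⟩

lemma exists_diagonalization {V W F F₁ F₂ : Type*} [AddCommGroup V] [Module ℝ V]
    [FiniteDimensional ℝ V] [AddCommGroup W] [Module ℝ W] [FiniteDimensional ℝ W]
    [NormedAddCommGroup F] [NormedSpace ℝ F] [FiniteDimensional ℝ F]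
    [NormedAddCommGroup F₁] [NormedSpace ℝ F₁] [FiniteDimensional ℝ F₁]
    [NormedAddCommGroup F₂] [NormedSpace ℝ F₂] [FiniteDimensional ℝ F₂]
    (hdim : Module.finrank ℝ F = Module.finrank ℝ F₁ + Module.finrank ℝ F₂)
    (hV : Module.finrank ℝ V = Module.finrank ℝ F₁)
    (hW : Module.finrank ℝ W = Module.finrank ℝ F₂) {a b : ℝ} (hab : a ≠ b) {B : F →L[ℝ] F}
    {i : V →ₗ[ℝ] F} {j : W →ₗ[ℝ] F} (hi : Function.Injective i) (hj : Function.Injective j)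
    (hBi : ∀ v, B (i v) = a • i v) (hBj : ∀ w, B (j w) = b • j w) :
    ∃ A : (F₁ × F₂) ≃L[ℝ] F, ∀ y, B (A y) = A (a • y.1, b • y.2) := by
  let e₁ : F₁ ≃ₗ[ℝ] V := LinearEquiv.ofFinrankEq _ _ hV.symm
  let e₂ : F₂ ≃ₗ[ℝ] W := LinearEquiv.ofFinrankEq _ _ hW.symm
  let A₀ : F₁ × F₂ →ₗ[ℝ] F := (i ∘ₗ e₁.toLinearMap).coprod (j ∘ₗ e₂.toLinearMap)
  have hA₀ : ∀ y, A₀ y = i (e₁ y.1) + j (e₂ y.2) := fun y ↦ by simp [A₀]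
  have hinj : Function.Injective A₀ := by
    rw [injective_iff_map_eq_zero]
    intro y hy
    rw [hA₀] at hy
    have hBy := congrArg B hy
    rw [map_add, hBi, hBj, map_zero] at hBy
    have hi0 : i (e₁ y.1) = 0 := by
      refine (smul_eq_zero.1 (?_ : (a - b) • i (e₁ y.1) = 0)).resolve_left (sub_ne_zero.2 hab)
      linear_combination (norm := module) hBy - b • hy
    rw [hi0, zero_add] at hy
    exact Prod.ext (e₁.injective (hi (by simpa using hi0))) (e₂.injective (hj (by simpa using hy)))
  refine ⟨(LinearEquiv.ofInjectiveOfFinrankEq A₀ hinj (by simp [hdim])).toContinuousLinearEquiv,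
    fun y ↦ ?_⟩
  change B (A₀ y) = A₀ (a • y.1, b • y.2)
  simp [hA₀, hBi, hBj]

end LinearAlgebra

section ProductCoordinates

variable {E X Y Z : Type*} [NormedAddCommGroup E] [NormedSpace ℝ E]
  [NormedAddCommGroup X] [NormedSpace ℝ X] [NormedAddCommGroup Y] [NormedAddCommGroup Z]
  {O : Set E} {x₀ : E}

/-- The inverse function theorem, with a ball as target. -/
lemma exists_openPartialHomeomorph_ball [CompleteSpace E] (hO : IsOpen O)
    {Ψ : E → X} (hΨ : ContDiffOn ℝ ∞ Ψ O) (hx₀ : x₀ ∈ O) (hinv : (fderiv ℝ Ψ x₀).IsInvertible) :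
    ∃ (Φ : OpenPartialHomeomorph E X) (r : ℝ), 0 < r ∧ x₀ ∈ Φ.source ∧ Φ.source ⊆ O ∧
      Φ.target = Metric.ball (Ψ x₀) r ∧ ⇑Φ = Ψ ∧ ContDiffOn ℝ ∞ Φ.symm Φ.target ∧
      ∀ x ∈ Φ.source, (fderiv ℝ Ψ x).IsInvertible := by
  have hΨx : ∀ x ∈ O, ContDiffAt ℝ ∞ Ψ x := fun x hx ↦ hΨ.contDiffAt (hO.mem_nhds hx)
  have dΨ : ∀ x ∈ O, HasFDerivAt Ψ (fderiv ℝ Ψ x) x := fun x hx ↦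
    ((hΨx x hx).differentiableAt (by simp)).hasFDerivAt
  obtain ⟨e, he⟩ := id hinv
  have de : HasFDerivAt Ψ (e : E →L[ℝ] X) x₀ := he ▸ dΨ x₀ hx₀
  set W : Set E := O ∩ fderiv ℝ Ψ ⁻¹' {L | L.IsInvertible}
  have hWo : IsOpen W := (hΨ.continuousOn_fderiv_of_isOpen hO (by simp)).isOpen_inter_preimage hO
    ContinuousLinearEquiv.isOpen
  set Φ₁ := ((hΨx x₀ hx₀).toOpenPartialHomeomorph Ψ de (by simp)).restrOpen W hWo
  have hx₁ : x₀ ∈ Φ₁.source :=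
    ⟨(hΨx x₀ hx₀).mem_toOpenPartialHomeomorph_source de (by simp), hx₀, hinv⟩
  obtain ⟨r, hr, hball⟩ := Metric.isOpen_iff.1 Φ₁.open_target (Ψ x₀) (Φ₁.map_source hx₁)
  set Φ := (Φ₁.symm.restrOpen (Metric.ball (Ψ x₀) r) Metric.isOpen_ball).symm
  have hsrc : ∀ x ∈ Φ.source, x ∈ W := fun x hx ↦ hx.1.2
  refine ⟨Φ, r, hr, ⟨hx₁, Metric.mem_ball_self hr⟩, fun x hx ↦ (hsrc x hx).1,
    Set.inter_eq_right.2 hball, rfl, fun y hy ↦ ?_, fun x hx ↦ (hsrc x hx).2⟩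
  obtain ⟨hxO, e', he'⟩ := hsrc _ (Φ.map_target hy)
  exact (Φ.contDiffAt_symm hy (he' ▸ dΨ _ hxO) (hΨx _ hxO)).contDiffWithinAt

variable [InnerProductSpace ℝ Y] [InnerProductSpace ℝ Z]

lemma exists_ball_reparametrization (p₀ : X × Y × Z) {r : ℝ} (hr : 0 < r) :
    ∃ (κ : OpenPartialHomeomorph (X × Y × Z) (X × Y × Z)) (κ₁ : Y → Y) (κ₂ : Z → Z),
      κ.source = Metric.ball p₀ r ∧ κ.target = Metric.ball p₀.1 r ×ˢ Set.univ ∧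
      ContDiffOn ℝ ∞ κ κ.source ∧ ContDiffOn ℝ ∞ κ.symm κ.target ∧
      ∀ p ∈ κ.source, p = ((κ p).1, κ₁ (κ p).2.1, κ₂ (κ p).2.2) := by
  set κ₁ := OpenPartialHomeomorph.univBall p₀.2.1 r
  set κ₂ := OpenPartialHomeomorph.univBall p₀.2.2 r
  have hκ₁ : κ₁.target = Metric.ball p₀.2.1 r := OpenPartialHomeomorph.univBall_target _ hr
  have hκ₂ : κ₂.target = Metric.ball p₀.2.2 r := OpenPartialHomeomorph.univBall_target _ hr
  have dκ₁ : ContDiffOn ℝ ∞ κ₁.symm κ₁.target :=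
    hκ₁ ▸ OpenPartialHomeomorph.contDiffOn_univBall_symm
  have dκ₂ : ContDiffOn ℝ ∞ κ₂.symm κ₂.target :=
    hκ₂ ▸ OpenPartialHomeomorph.contDiffOn_univBall_symm
  refine ⟨(OpenPartialHomeomorph.ofSet (Metric.ball p₀.1 r) Metric.isOpen_ball).prod
    (κ₁.symm.prod κ₂.symm), κ₁, κ₂, ?_, ?_, ?_, ?_, fun p hp ↦ ?_⟩
  · change Metric.ball p₀.1 r ×ˢ κ₁.target ×ˢ κ₂.target = _
    rw [hκ₁, hκ₂, ball_prod_same, ball_prod_same]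
  · change Metric.ball p₀.1 r ×ˢ κ₁.source ×ˢ κ₂.source = _
    rw [OpenPartialHomeomorph.univBall_source, OpenPartialHomeomorph.univBall_source,
      Set.univ_prod_univ]
  · exact contDiff_fst.contDiffOn.prodMk ((dκ₁.comp (by fun_prop) fun p hp ↦ hp.2.1).prodMk
      (dκ₂.comp (by fun_prop) fun p hp ↦ hp.2.2))
  · exact (contDiff_fst.prodMk ((OpenPartialHomeomorph.contDiff_univBall.comp
      (by fun_prop)).prodMk (OpenPartialHomeomorph.contDiff_univBall.comp
        (by fun_prop)))).contDiffOn
  · exact Prod.ext rfl (Prod.ext (κ₁.right_inv hp.2.1).symm (κ₂.right_inv hp.2.2).symm)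

/-- A local diffeomorphism into a product, reparametrized so that the last two coordinates range
over the whole space. -/
lemma exists_adapted_coordinates [CompleteSpace E] (hO : IsOpen O)
    {Ψ : E → X × Y × Z} (hΨ : ContDiffOn ℝ ∞ Ψ O) (hx₀ : x₀ ∈ O)
    (hinv : (fderiv ℝ Ψ x₀).IsInvertible) :
    ∃ (Φ : OpenPartialHomeomorph E (X × Y × Z)) (I : Set X) (κ₁ : Y → Y) (κ₂ : Z → Z),
      Convex ℝ I ∧ x₀ ∈ Φ.source ∧ Φ.source ⊆ O ∧ Φ.target = I ×ˢ Set.univ ∧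
      ContDiffOn ℝ ∞ Φ Φ.source ∧ ContDiffOn ℝ ∞ Φ.symm Φ.target ∧
      (∀ x ∈ Φ.source, Ψ x = ((Φ x).1, κ₁ (Φ x).2.1, κ₂ (Φ x).2.2)) ∧
      ∀ x ∈ Φ.source, (fderiv ℝ Ψ x).IsInvertible := by
  obtain ⟨Φ, r, hr, hxs, hsO, htgt, rfl, hsymm, hinv'⟩ :=
    exists_openPartialHomeomorph_ball hO hΨ hx₀ hinv
  obtain ⟨κ, κ₁, κ₂, hsource, htarget, dκ, dκsymm, hκ⟩ := exists_ball_reparametrization (Φ x₀) hr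
  have hΦκ : Φ.target = κ.source := htgt.trans hsource.symm
  refine ⟨Φ.trans' κ hΦκ, Metric.ball (Φ x₀).1 r, κ₁, κ₂, convex_ball _ _, hxs, hsO, htarget,
    dκ.comp (hΨ.mono hsO) fun x hx ↦ hΦκ ▸ Φ.map_source hx,
    hsymm.comp dκsymm fun p hp ↦ hΦκ ▸ κ.map_target hp,
    fun x hx ↦ hκ _ (hΦκ ▸ Φ.map_source hx), hinv'⟩

end ProductCoordinates

section Slices

lemma comp_eq_of_clm_comp_eq {W E C Y : Type*} [NormedAddCommGroup W] [NormedSpace ℝ W]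
    [NormedAddCommGroup E] [NormedSpace ℝ E] [NormedAddCommGroup C] [NormedSpace ℝ C]
    [NormedAddCommGroup Y] [NormedSpace ℝ Y] {s : Set W} (hs : IsOpen s) (hconn : IsPreconnected s)
    {j : W → E} {g : E → C} (hj : ∀ p ∈ s, DifferentiableAt ℝ j p)
    (hg : ∀ p ∈ s, DifferentiableAt ℝ g (j p)) {L : C →L[ℝ] Y}
    (hL : ∀ p ∈ s, ∀ w, L (fderiv ℝ g (j p) w) = 0 → fderiv ℝ g (j p) w = 0) {y : Y}
    (hconst : ∀ p ∈ s, L (g (j p)) = y) {p q : W} (hp : p ∈ s) (hq : q ∈ s) :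
    g (j p) = g (j q) := by
  have dgj : ∀ p ∈ s, HasFDerivAt (fun z ↦ g (j z)) (fderiv ℝ g (j p) ∘L fderiv ℝ j p) p :=
    fun p hp ↦ (hg p hp).hasFDerivAt.comp p (hj p hp).hasFDerivAt
  refine hs.is_const_of_fderiv_eq_zero (𝕜 := ℝ) hconn
    (fun p hp ↦ (dgj p hp).differentiableAt.differentiableWithinAt) (fun p hp ↦ ?_) hp hq
  have hLgj : (fun z ↦ L (g (j z))) =ᶠ[𝓝 p] fun _ ↦ y :=
    Filter.eventuallyEq_of_mem (hs.mem_nhds hp) hconst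
  have hD := (L.hasFDerivAt.comp p (dgj p hp)).unique
    ((hasFDerivAt_const y p).congr_of_eventuallyEq hLgj)
  rw [(dgj p hp).fderiv]
  ext w
  exact hL p hp _ (DFunLike.congr_fun hD w)

/-- If `L ∘ g` factors through the coordinates `π ∘ Φ` and `L` is injective on the range of `dg`,
then `g` itself factors through `π ∘ Φ`. -/
lemma exists_eq_comp_of_clm_comp_eq {E X C Y Y' : Type*} [NormedAddCommGroup E] [NormedSpace ℝ E]
    [NormedAddCommGroup X] [NormedSpace ℝ X] [NormedAddCommGroup C] [NormedSpace ℝ C]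
    [NormedAddCommGroup Y] [NormedSpace ℝ Y] [NormedAddCommGroup Y'] [NormedSpace ℝ Y']
    {Φ : OpenPartialHomeomorph E X} (hconv : Convex ℝ Φ.target)
    (hsymm : ContDiffOn ℝ ∞ Φ.symm Φ.target) {g : E → C} (hg : ContDiffOn ℝ ∞ g Φ.source)
    {L : C →L[ℝ] Y'} (hL : ∀ x ∈ Φ.source, ∀ w, L (fderiv ℝ g x w) = 0 → fderiv ℝ g x w = 0)
    {π : X →L[ℝ] Y} {κ : Y → Y'} (hκ : ∀ x ∈ Φ.source, L (g x) = κ (π (Φ x))) {σ : Y → X}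
    (hσ : ContDiff ℝ ∞ σ) (hσΦ : ∀ y, σ y ∈ Φ.target) (hπσ : ∀ y, π (σ y) = y) :
    ∃ ψ : Y → C, ContDiff ℝ ∞ ψ ∧ ∀ x ∈ Φ.source, g x = ψ (π (Φ x)) := by
  refine ⟨fun y ↦ g (Φ.symm (σ y)), contDiffOn_univ.1 ((hg.comp hsymm Φ.mapsTo_symm).comp
    hσ.contDiffOn fun y _ ↦ hσΦ y), fun x hx ↦ ?_⟩
  set c : ℝ →ᵃ[ℝ] X := AffineMap.lineMap (Φ x) (σ (π (Φ x)))
  have hc : Differentiable ℝ c := (AffineMap.lineMap _ _ : ℝ →ᵃ[ℝ] X).differentiable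
  have hπc : ∀ s, π (c s) = π (Φ x) := fun s ↦ by
    simp [c, AffineMap.lineMap_apply_module', hπσ]
  have hcomp := comp_eq_of_clm_comp_eq (s := c ⁻¹' Φ.target) (j := Φ.symm ∘ c) (g := g)
    (Φ.open_target.preimage hc.continuous) (hconv.affine_preimage c).isPreconnected
    (fun s hs ↦ ((hsymm.differentiableOn (by simp)).differentiableAt
      (Φ.open_target.mem_nhds hs)).comp s (hc s))
    (fun s hs ↦ (hg.differentiableOn (by simp)).differentiableAt
      (Φ.open_source.mem_nhds (Φ.map_target hs)))
    (fun s hs ↦ hL _ (Φ.map_target hs)) (y := κ (π (Φ x)))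
    (fun s hs ↦ by rw [Function.comp_apply, hκ _ (Φ.map_target hs), Φ.right_inv hs, hπc])
    (p := 0) (q := 1) (by simpa [c] using Φ.map_source hx) (by simpa [c] using hσΦ _)
  simpa [c, Φ.left_inv hx] using hcomp

variable {E C₁ C₂ Y Z : Type*} [NormedAddCommGroup E] [NormedSpace ℝ E] [CompleteSpace E]
  [NormedAddCommGroup C₁] [NormedSpace ℝ C₁] [NormedAddCommGroup C₂] [NormedSpace ℝ C₂]
  [NormedAddCommGroup Y] [InnerProductSpace ℝ Y] [NormedAddCommGroup Z] [InnerProductSpace ℝ Z]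

/-- If the kernels of `dt`, `dg₁`, `dg₂` split the tangent spaces and `(t, L₁ g₁, L₂ g₂)` is a local
diffeomorphism, then `L₁ g₁` determines `g₁` and `L₂ g₂` determines `g₂`. -/
lemma exists_product_coordinates {O : Set E} (hO : IsOpen O) {x₀ : E} (hx₀ : x₀ ∈ O) {t : E → ℝ}
    {g₁ : E → C₁} {g₂ : E → C₂} (ht : ContDiffOn ℝ ∞ t O) (hg₁ : ContDiffOn ℝ ∞ g₁ O)
    (hg₂ : ContDiffOn ℝ ∞ g₂ O) {L₁ : C₁ →L[ℝ] Y} {L₂ : C₂ →L[ℝ] Z}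
    (hinv : (fderiv ℝ (fun x ↦ (t x, L₁ (g₁ x), L₂ (g₂ x))) x₀).IsInvertible)
    (hcomp₁ : ∀ x ∈ O, ∀ w, ∃ w', fderiv ℝ t x w' = 0 ∧
      fderiv ℝ g₁ x w' = fderiv ℝ g₁ x w ∧ fderiv ℝ g₂ x w' = 0)
    (hcomp₂ : ∀ x ∈ O, ∀ w, ∃ w', fderiv ℝ t x w' = 0 ∧
      fderiv ℝ g₂ x w' = fderiv ℝ g₂ x w ∧ fderiv ℝ g₁ x w' = 0) :
    ∃ (Φ : OpenPartialHomeomorph E (ℝ × Y × Z)) (ψ₁ : Y → C₁) (ψ₂ : Z → C₂),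
      x₀ ∈ Φ.source ∧ Φ.source ⊆ O ∧ ContDiffOn ℝ ∞ Φ Φ.source ∧ ContDiffOn ℝ ∞ Φ.symm Φ.target ∧
      ContDiff ℝ ∞ ψ₁ ∧ ContDiff ℝ ∞ ψ₂ ∧ (∀ y z, ∃ u, (u, y, z) ∈ Φ.target) ∧
      ∀ x ∈ Φ.source, (Φ x).1 = t x ∧ g₁ x = ψ₁ (Φ x).2.1 ∧ g₂ x = ψ₂ (Φ x).2.2 := by
  obtain ⟨Φ, I, κ₁, κ₂, hI, hxs, hsO, htgt, hΦ, hsymm, hΨΦ, hΨinv⟩ :=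
    exists_adapted_coordinates hO (ht.prodMk ((L₁.contDiff.comp_contDiffOn hg₁).prodMk
      (L₂.contDiff.comp_contDiffOn hg₂))) hx₀ hinv
  have hzero : ∀ x ∈ Φ.source, ∀ w, fderiv ℝ t x w = 0 → L₁ (fderiv ℝ g₁ x w) = 0 →
      L₂ (fderiv ℝ g₂ x w) = 0 → w = 0 := fun x hx w h0 h1 h2 ↦ by
    have hx' := hO.mem_nhds (hsO hx)
    have dΨ := (((ht.differentiableOn (by simp)).differentiableAt hx').hasFDerivAt.prodMk
      ((L₁.hasFDerivAt.comp x ((hg₁.differentiableOn (by simp)).differentiableAt hx').hasFDerivAt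
      ).prodMk (L₂.hasFDerivAt.comp x
      ((hg₂.differentiableOn (by simp)).differentiableAt hx').hasFDerivAt))).fderiv
    refine (injective_iff_map_eq_zero _).1 (hΨinv x hx).injective w ?_
    exact (DFunLike.congr_fun dΨ w).trans (Prod.ext h0 (Prod.ext h1 h2))
  have hker₁ : ∀ x ∈ Φ.source, ∀ w, L₁ (fderiv ℝ g₁ x w) = 0 → fderiv ℝ g₁ x w = 0 :=
    fun x hx w hw ↦ by
      obtain ⟨w', h0, h1, h2⟩ := hcomp₁ x (hsO hx) w
      rw [← h1, hzero x hx w' h0 (by rw [h1, hw]) (by rw [h2, map_zero]), map_zero]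
  have hker₂ : ∀ x ∈ Φ.source, ∀ w, L₂ (fderiv ℝ g₂ x w) = 0 → fderiv ℝ g₂ x w = 0 :=
    fun x hx w hw ↦ by
      obtain ⟨w', h0, h2, h1⟩ := hcomp₂ x (hsO hx) w
      rw [← h2, hzero x hx w' h0 (by rw [h1, map_zero]) (by rw [h2, hw]), map_zero]
  have hconv : Convex ℝ Φ.target := htgt ▸ hI.prod convex_univ
  have hmem : ∀ y z, ((Φ x₀).1, y, z) ∈ Φ.target := fun y z ↦
    htgt ▸ ⟨(htgt ▸ Φ.map_source hxs : Φ x₀ ∈ I ×ˢ Set.univ).1, trivial⟩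
  obtain ⟨ψ₁, hψ₁, hgψ₁⟩ := exists_eq_comp_of_clm_comp_eq hconv hsymm (hg₁.mono hsO) hker₁
    (π := .fst ℝ Y Z ∘L .snd ℝ ℝ (Y × Z)) (κ := κ₁) (σ := fun y ↦ ((Φ x₀).1, y, 0))
    (fun x hx ↦ congrArg (·.2.1) (hΨΦ x hx)) (by fun_prop) (fun y ↦ hmem y 0) fun _ ↦ rfl
  obtain ⟨ψ₂, hψ₂, hgψ₂⟩ := exists_eq_comp_of_clm_comp_eq hconv hsymm (hg₂.mono hsO) hker₂
    (π := .snd ℝ Y Z ∘L .snd ℝ ℝ (Y × Z)) (κ := κ₂) (σ := fun z ↦ ((Φ x₀).1, 0, z))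
    (fun x hx ↦ congrArg (·.2.2) (hΨΦ x hx)) (by fun_prop) (fun z ↦ hmem 0 z) fun _ ↦ rfl
  exact ⟨Φ, ψ₁, ψ₂, hxs, hsO, hΦ, hsymm, hψ₁, hψ₂, fun y z ↦ ⟨_, hmem y z⟩,
    fun x hx ↦ ⟨(congrArg Prod.fst (hΨΦ x hx)).symm, hgψ₁ x hx, hgψ₂ x hx⟩⟩

end Slices

/-- A function `t` and a pair `(f₂, f₃)` forming a transversal immersion for which `T` is a
direction with `dt(T) = 1`, `df₂(T) = a f₂`, `df₃(T) = b f₃`, and whose tangent spaces are spanned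
by `T` and the common kernels of `dt, df₃` and of `dt, df₂`. -/
structure SplitImmersion {E F₂ F₃ : Type*} [NormedAddCommGroup E] [NormedSpace ℝ E]
    [NormedAddCommGroup F₂] [NormedSpace ℝ F₂] [NormedAddCommGroup F₃] [NormedSpace ℝ F₃]
    (O : Set E) (a b : ℝ) (t : E → ℝ) (f₂ : E → F₂) (f₃ : E → F₃) (T : E → E) : Prop where
  isOpen : IsOpen O
  smooth : ContDiffOn ℝ ∞ t O
  smooth₂ : ContDiffOn ℝ ∞ f₂ O
  smooth₃ : ContDiffOn ℝ ∞ f₃ O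
  unit : ∀ x ∈ O, fderiv ℝ t x (T x) = 1
  field₂ : ∀ x ∈ O, fderiv ℝ f₂ x (T x) = a • f₂ x
  field₃ : ∀ x ∈ O, fderiv ℝ f₃ x (T x) = b • f₃ x
  component₂ : ∀ x ∈ O, ∀ w, ∃ w', fderiv ℝ t x w' = 0 ∧
    fderiv ℝ f₂ x w' = fderiv ℝ f₂ x w - (a * fderiv ℝ t x w) • f₂ x ∧ fderiv ℝ f₃ x w' = 0
  component₃ : ∀ x ∈ O, ∀ w, ∃ w', fderiv ℝ t x w' = 0 ∧
    fderiv ℝ f₃ x w' = fderiv ℝ f₃ x w - (b * fderiv ℝ t x w) • f₃ x ∧ fderiv ℝ f₂ x w' = 0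
  transversal : ∀ x ∈ O, ∀ v, ∀ c : ℝ, fderiv ℝ f₂ x v + c • f₂ x = 0 →
    fderiv ℝ f₃ x v + c • f₃ x = 0 → v = 0 ∧ c = 0
  ne : a ≠ b
  ne_zero₂ : a ≠ 0
  ne_zero₃ : b ≠ 0

namespace SplitImmersion

section

variable {E F₂ F₃ : Type*} [NormedAddCommGroup E] [NormedSpace ℝ E] [NormedAddCommGroup F₂]
  [NormedSpace ℝ F₂] [NormedAddCommGroup F₃] [NormedSpace ℝ F₃] {O : Set E} {a b : ℝ} {t : E → ℝ}
  {f₂ : E → F₂} {f₃ : E → F₃} {T : E → E} {x : E} (H : SplitImmersion O a b t f₂ f₃ T)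
include H

lemma symm : SplitImmersion O b a t f₃ f₂ T where
  isOpen := H.isOpen
  smooth := H.smooth
  smooth₂ := H.smooth₃
  smooth₃ := H.smooth₂
  unit := H.unit
  field₂ := H.field₃
  field₃ := H.field₂
  component₂ := H.component₃
  component₃ := H.component₂
  transversal x hx v c h2 h3 := H.transversal x hx v c h3 h2
  ne := H.ne.symm
  ne_zero₂ := H.ne_zero₃
  ne_zero₃ := H.ne_zero₂

lemma smooth_reduced : ContDiffOn ℝ ∞ (fun y ↦ Real.exp (-a * t y) • f₂ y) O :=
  (contDiffOn_const.mul H.smooth).exp.smul H.smooth₂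

lemma fderiv_reduced (hx : x ∈ O) (w : E) : fderiv ℝ (fun y ↦ Real.exp (-a * t y) • f₂ y) x w =
    Real.exp (-a * t x) • (fderiv ℝ f₂ x w - (a * fderiv ℝ t x w) • f₂ x) := by
  have dt := ((H.smooth.differentiableOn (by simp)).differentiableAt
    (H.isOpen.mem_nhds hx)).hasFDerivAt
  have df := ((H.smooth₂.differentiableOn (by simp)).differentiableAt
    (H.isOpen.mem_nhds hx)).hasFDerivAt
  rw [((dt.const_mul (-a)).exp.fun_smul df).fderiv]
  simp only [add_apply, smul_apply, ContinuousLinearMap.smulRight_apply, smul_eq_mul]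
  module

lemma component_reduced (hx : x ∈ O) (w : E) : ∃ w', fderiv ℝ t x w' = 0 ∧
    fderiv ℝ (fun y ↦ Real.exp (-a * t y) • f₂ y) x w' =
      fderiv ℝ (fun y ↦ Real.exp (-a * t y) • f₂ y) x w ∧
    fderiv ℝ (fun y ↦ Real.exp (-b * t y) • f₃ y) x w' = 0 := by
  obtain ⟨w', h0, h2, h3⟩ := H.component₂ x hx w
  refine ⟨w', h0, ?_, ?_⟩
  · rw [H.fderiv_reduced hx, H.fderiv_reduced hx, h0, h2, mul_zero, zero_smul, sub_zero]
  · rw [H.symm.fderiv_reduced hx, h0, h3, mul_zero, zero_smul, sub_zero, smul_zero]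

lemma ne_zero (hx : x ∈ O) : f₂ x ≠ 0 := fun h0 ↦
  H.ne_zero₃ (neg_eq_zero.1 (H.transversal x hx (T x) (-b) (by simp [H.field₂ x hx, h0])
    (by simp [H.field₃ x hx])).2)

lemma eq_zero_of_radial (hx : x ∈ O) {w : E} (hw : fderiv ℝ t x w = 0) {c d : ℝ}
    (h2 : fderiv ℝ f₂ x w = c • f₂ x) (h3 : fderiv ℝ f₃ x w = d • f₃ x) : w = 0 := by
  obtain ⟨r, hr⟩ : ∃ r, r * (a - b) = d - c :=
    ⟨(d - c) / (a - b), div_mul_cancel₀ _ (sub_ne_zero.2 H.ne)⟩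
  have hw' : w + r • T x = 0 := (H.transversal x hx _ (-c - r * a)
    (by rw [map_add, map_smul, h2, H.field₂ x hx]; module)
    (by
      rw [map_add, map_smul, h3, H.field₃ x hx, eq_add_of_sub_eq hr.symm]
      module)).1
  have hr0 := congrArg (fderiv ℝ t x) hw'
  rw [map_add, map_smul, hw, H.unit x hx, map_zero, zero_add, smul_eq_mul, mul_one] at hr0
  simpa [hr0] using hw'

end

variable {E : Type*} [NormedAddCommGroup E] [NormedSpace ℝ E] [FiniteDimensional ℝ E]
  {n₁ n₂ : ℕ} {O : Set E} {a b : ℝ} {t : E → ℝ} {f₂ : E → Euc (n₁ + 1)} {f₃ : E → Euc (n₂ + 1)}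
  {T : E → E} {x₀ : E}

lemma exists_isInvertible (H : SplitImmersion O a b t f₂ f₃ T)
    (hdim : Module.finrank ℝ E = 1 + n₁ + n₂) (hx₀ : x₀ ∈ O) :
    ∃ (L₁ : Euc (n₁ + 1) →L[ℝ] Euc n₁) (L₂ : Euc (n₂ + 1) →L[ℝ] Euc n₂),
      (fderiv ℝ (fun x ↦ (a * t x, L₁ (Real.exp (-a * t x) • f₂ x),
        L₂ (Real.exp (-b * t x) • f₃ x))) x₀).IsInvertible := by
  obtain ⟨L₁, hL₁⟩ := exists_clm_ker_eq_span_singleton (Y := Euc n₁) (by simp) (H.ne_zero hx₀)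
  obtain ⟨L₂, hL₂⟩ := exists_clm_ker_eq_span_singleton (Y := Euc n₂) (by simp) (H.symm.ne_zero hx₀)
  have hO := H.isOpen.mem_nhds hx₀
  have dt := ((H.smooth.differentiableOn (by simp)).differentiableAt hO).hasFDerivAt
  have dg₁ := ((H.smooth_reduced.differentiableOn (by simp)).differentiableAt hO).hasFDerivAt
  have dg₂ := ((H.symm.smooth_reduced.differentiableOn (by simp)).differentiableAt hO).hasFDerivAt
  have dΨ := ((dt.const_mul a).prodMk ((L₁.hasFDerivAt.comp x₀ dg₁).prodMk
    (L₂.hasFDerivAt.comp x₀ dg₂))).fderiv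
  refine ⟨L₁, L₂, isInvertible_of_injective (by simp [hdim, add_assoc]) ?_⟩
  refine (injective_iff_map_eq_zero _).2 fun w hw ↦ ?_
  have hw' := (DFunLike.congr_fun dΨ w).symm.trans hw
  simp only [ContinuousLinearMap.prod_apply, Prod.mk_eq_zero, smul_apply, smul_eq_mul,
    ContinuousLinearMap.comp_apply, H.fderiv_reduced hx₀, H.symm.fderiv_reduced hx₀, map_smul,
    mul_eq_zero, H.ne_zero₂, false_or, smul_eq_zero, Real.exp_ne_zero] at hw'
  obtain ⟨h0, h1, h2⟩ := hw'
  simp only [h0, mul_zero, zero_smul, sub_zero, hL₁, hL₂, Submodule.mem_span_singleton] at h1 h2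
  obtain ⟨⟨c, hc⟩, ⟨d, hd⟩⟩ := And.intro h1 h2
  exact H.eq_zero_of_radial hx₀ h0 hc.symm hd.symm

lemma exists_calabi (H : SplitImmersion O a b t f₂ f₃ T)
    (hdim : Module.finrank ℝ E = 1 + n₁ + n₂) (hx₀ : x₀ ∈ O) :
    ∃ (Φ : OpenPartialHomeomorph E (ℝ × Euc n₁ × Euc n₂)) (ψ₁ : Euc n₁ → Euc (n₁ + 1))
      (ψ₂ : Euc n₂ → Euc (n₂ + 1)), x₀ ∈ Φ.source ∧ Φ.source ⊆ O ∧ ContDiffOn ℝ ∞ Φ Φ.source ∧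
      ContDiffOn ℝ ∞ Φ.symm Φ.target ∧ ContDiff ℝ ∞ ψ₁ ∧ ContDiff ℝ ∞ ψ₂ ∧
      (∀ y z, ∃ u, (u, y, z) ∈ Φ.target) ∧
      ∀ x ∈ Φ.source, (f₂ x, f₃ x) = calabiProduct (-b / a) ψ₁ ψ₂ (Φ x) := by
  obtain ⟨L₁, L₂, hinv⟩ := H.exists_isInvertible hdim hx₀
  have dat : ∀ x ∈ O, ∀ w, fderiv ℝ t x w = 0 → fderiv ℝ (fun y ↦ a * t y) x w = 0 :=
    fun x hx w hw ↦ by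
      rw [fderiv_const_mul ((H.smooth.differentiableOn (by simp)).differentiableAt
        (H.isOpen.mem_nhds hx)), smul_apply, hw, smul_zero]
  have : CompleteSpace E := FiniteDimensional.complete ℝ E
  obtain ⟨Φ, ψ₁, ψ₂, hxs, hsO, hΦ, hsymm, hψ₁, hψ₂, hmem, heq⟩ := exists_product_coordinates
    H.isOpen hx₀ (contDiffOn_const.mul H.smooth) H.smooth_reduced H.symm.smooth_reduced hinv
    (fun x hx w ↦ (H.component_reduced hx w).imp fun w' hw' ↦ ⟨dat x hx w' hw'.1, hw'.2⟩)
    (fun x hx w ↦ (H.symm.component_reduced hx w).imp fun w' hw' ↦ ⟨dat x hx w' hw'.1, hw'.2⟩)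
  refine ⟨Φ, ψ₁, ψ₂, hxs, hsO, hΦ, hsymm, hψ₁, hψ₂, hmem, fun x hx ↦ ?_⟩
  obtain ⟨h0, h1, h2⟩ := heq x hx
  have hl : -(-b / a) * (a * t x) = b * t x := by field_simp [H.ne_zero₂]
  simp [calabiProduct, h0, hl, ← h1, ← h2, smul_smul, ← Real.exp_add]

end SplitImmersion

namespace IsEigenField

variable {E F : Type*} [NormedAddCommGroup E] [NormedSpace ℝ E] [NormedAddCommGroup F]
  [NormedSpace ℝ F] {ε : ℝ} {O : Set E} {f : E → F} {Γ K : E → E →L[ℝ] E →L[ℝ] E}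
  {h : E → E →L[ℝ] E →L[ℝ] ℝ} {a b : ℝ} {T : E → E} {x : E}
  (H : IsEigenField ε O f Γ K h a b T)
include H

lemma symm : IsEigenField ε O f Γ K h b a T where
  __ := H
  eigen x hx := by rw [add_comm, H.eigen x hx]
  quadratic x hx v := by rw [add_comm b, H.quadratic x hx]
  mul_eq := by rw [mul_comm, H.mul_eq]
  ne := H.ne.symm

lemma ne_zero_left : a ≠ 0 := left_ne_zero_of_mul (H.mul_eq.trans_ne H.ne_zero)

lemma metric_field_diff (hx : x ∈ O) (v : E) : h x (T x) (K x (T x) v) = (a + b) * h x (T x) v := by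
  rw [← H.diff_adjoint x hx, H.eigen x hx, map_smul, smul_apply, smul_eq_mul]

lemma exists_primitive (hO : Convex ℝ O) :
    ∃ t : E → ℝ, ContDiffOn ℝ ∞ t O ∧ ∀ x ∈ O, fderiv ℝ t x = h x (T x) := by
  have hθ : ContDiffOn ℝ ∞ (fun y ↦ h y (T y)) O := H.smooth_metric.clm_apply H.smooth_field
  obtain ⟨t, ht⟩ := hO.exists_forall_hasFDerivAt_of_fderiv_symmetric H.isOpen
    (hθ.differentiableOn (by simp)) fun x hx u v ↦ by
      rw [H.fderiv_metric_field hx, H.fderiv_metric_field hx, H.conn_symm x hx]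
  exact ⟨t, (contDiffOn_infty_iff_fderiv_of_isOpen H.isOpen).2
    ⟨fun x hx ↦ (ht x hx).differentiableAt.differentiableWithinAt,
      hθ.congr fun x hx ↦ (ht x hx).fderiv⟩, fun x hx ↦ (ht x hx).fderiv⟩

variable {B : F →L[ℝ] F} (hB : ∀ x ∈ O, B (f x) = fderiv ℝ f x (T x))
include hB

lemma endomorphism_fderiv (hx : x ∈ O) (v : E) :
    B (fderiv ℝ f x v) = fderiv ℝ f x (K x (T x) v) - (ε * h x (T x) v) • f x := by
  have hcomp : B ∘L fderiv ℝ f x = fderiv ℝ (fun y ↦ fderiv ℝ f y (T y)) x := by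
    rw [← (Filter.eventuallyEq_of_mem (H.mem_nhds hx) hB).fderiv_eq]
    exact (B.hasFDerivAt.comp x (H.differentiableAt hx).hasFDerivAt).fderiv.symm
  rw [← H.fderiv_fderiv_field hx, ← hcomp, ContinuousLinearMap.comp_apply]

/-- The eigenspace of `B` to the eigenvalue `a` contains, besides the image of that of `K_T`, the
vector `df(T) - b f`. -/
lemma exists_eigenvector_embedding (hx : x ∈ O) {D : Submodule ℝ E}
    (hD : ∀ v ∈ D, K x (T x) v = a • v) :
    ∃ i : (D × ℝ) →ₗ[ℝ] F, Function.Injective i ∧ ∀ p, B (i p) = a • i p := by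
  refine ⟨((fderiv ℝ f x).toLinearMap ∘ₗ D.subtype).coprod
    (LinearMap.toSpanSingleton ℝ F (fderiv ℝ f x (T x) - b • f x)), ?_, ?_⟩
  · refine (injective_iff_map_eq_zero _).2 ?_
    rintro ⟨v, c⟩ hvc
    obtain ⟨hv, hc⟩ := H.transversal x hx (v + c • T x) (-c * b) (by
      simp only [LinearMap.coprod_apply, LinearMap.comp_apply, LinearMap.toSpanSingleton_apply,
        Submodule.coe_subtype, ContinuousLinearMap.coe_coe] at hvc
      rw [map_add, map_smul]
      linear_combination (norm := module) hvc)
    have hc0 : c = 0 := by simpa [H.symm.ne_zero_left] using hc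
    simpa [hc0] using hv
  · rintro ⟨⟨v, hv⟩, c⟩
    have hθ : h x (T x) v = 0 := by
      have hadj := H.metric_field_diff hx v
      rw [hD v hv, map_smul, smul_eq_mul, add_mul, left_eq_add] at hadj
      exact (mul_eq_zero.1 hadj).resolve_left H.symm.ne_zero_left
    simp only [LinearMap.coprod_apply, LinearMap.comp_apply, ContinuousLinearMap.coe_coe,
      Submodule.coe_subtype, LinearMap.toSpanSingleton_apply, map_add, map_sub, map_smul,
      H.endomorphism_fderiv hB hx, hD v hv, hB x hx, H.eigen x hx, H.unit x hx, hθ, ← H.mul_eq]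
    module

/-- `w'` is the component of `w` in the kernel of `K_T - a`. -/
lemma exists_component (hx : x ∈ O) (w : E) : ∃ w', h x (T x) w' = 0 ∧
    (a - b) • fderiv ℝ f x w' = B (fderiv ℝ f x w - (a * h x (T x) w) • f x) -
      b • (fderiv ℝ f x w - (a * h x (T x) w) • f x) := by
  refine ⟨(a - b)⁻¹ • (K x (T x) w - b • w - (a * h x (T x) w) • T x), ?_, ?_⟩
  · simp only [map_smul, map_sub, H.metric_field_diff hx, H.unit x hx, smul_eq_mul]
    ring
  · rw [map_smul, smul_inv_smul₀ (sub_ne_zero.2 H.ne), map_sub B, map_smul B, hB x hx,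
      H.endomorphism_fderiv hB hx, ← H.mul_eq, map_sub, map_sub, map_smul, map_smul]
    module

lemma exists_component_map {F₂ F₃ : Type*} [NormedAddCommGroup F₂] [NormedSpace ℝ F₂]
    [NormedAddCommGroup F₃] [NormedSpace ℝ F₃] (hx : x ∈ O) {L₂ : F →L[ℝ] F₂} {L₃ : F →L[ℝ] F₃}
    (hL₂ : ∀ y, L₂ (B y) = a • L₂ y) (hL₃ : ∀ y, L₃ (B y) = b • L₃ y) (w : E) :
    ∃ w', h x (T x) w' = 0 ∧
      L₂ (fderiv ℝ f x w') = L₂ (fderiv ℝ f x w) - (a * h x (T x) w) • L₂ (f x) ∧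
      L₃ (fderiv ℝ f x w') = 0 := by
  obtain ⟨w', h0, hw'⟩ := H.exists_component hB hx w
  have hab := sub_ne_zero.2 H.ne
  have h₂ := congrArg L₂ hw'
  have h₃ := congrArg L₃ hw'
  rw [map_smul, map_sub, map_smul, hL₂, ← sub_smul, smul_right_inj hab, map_sub, map_smul] at h₂
  rw [map_smul, map_sub, map_smul, hL₃, sub_self, smul_eq_zero_iff_right hab] at h₃
  exact ⟨w', h0, h₂, h₃⟩

lemma splitImmersion {F₂ F₃ : Type*} [NormedAddCommGroup F₂] [NormedSpace ℝ F₂]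
    [NormedAddCommGroup F₃] [NormedSpace ℝ F₃] {A : (F₂ × F₃) ≃L[ℝ] F}
    (hA : ∀ y, B (A y) = A (a • y.1, b • y.2)) {t : E → ℝ} (ht : ContDiffOn ℝ ∞ t O)
    (hdt : ∀ x ∈ O, fderiv ℝ t x = h x (T x)) :
    SplitImmersion O a b t (fun x ↦ (A.symm (f x)).1) (fun x ↦ (A.symm (f x)).2) T := by
  have hAB : ∀ y, A.symm (B y) = (a • (A.symm y).1, b • (A.symm y).2) := fun y ↦ by
    rw [A.symm_apply_eq, ← hA, A.apply_symm_apply]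
  let L₂ : F →L[ℝ] F₂ := ContinuousLinearMap.fst ℝ F₂ F₃ ∘L A.symm
  let L₃ : F →L[ℝ] F₃ := ContinuousLinearMap.snd ℝ F₂ F₃ ∘L A.symm
  have hL₂ : ∀ y, L₂ (B y) = a • L₂ y := fun y ↦ congrArg Prod.fst (hAB y)
  have hL₃ : ∀ y, L₃ (B y) = b • L₃ y := fun y ↦ congrArg Prod.snd (hAB y)
  have hd : ∀ x ∈ O, HasFDerivAt (fun x ↦ A.symm (f x)) (A.symm ∘L fderiv ℝ f x) x := fun x hx ↦
    A.symm.hasFDerivAt.comp x (H.differentiableAt hx).hasFDerivAt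
  have hd₂ : ∀ x ∈ O, ∀ w, fderiv ℝ (fun x ↦ (A.symm (f x)).1) x w =
      (A.symm (fderiv ℝ f x w)).1 := fun x hx w ↦ DFunLike.congr_fun (hd x hx).fst.fderiv w
  have hd₃ : ∀ x ∈ O, ∀ w, fderiv ℝ (fun x ↦ (A.symm (f x)).2) x w =
      (A.symm (fderiv ℝ f x w)).2 := fun x hx w ↦ DFunLike.congr_fun (hd x hx).snd.fderiv w
  refine ⟨H.isOpen, ht, A.symm.contDiff.fst.comp_contDiffOn H.smooth,
    A.symm.contDiff.snd.comp_contDiffOn H.smooth, fun x hx ↦ by rw [hdt x hx, H.unit x hx],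
    fun x hx ↦ by rw [hd₂ x hx, ← hB x hx, hAB], fun x hx ↦ by rw [hd₃ x hx, ← hB x hx, hAB],
    fun x hx w ↦ ?_, fun x hx w ↦ ?_, fun x hx v c h₂ h₃ ↦ ?_, H.ne, H.ne_zero_left,
    H.symm.ne_zero_left⟩
  · rw [hd₂ x hx w, hdt x hx]
    obtain ⟨w', h0, h₂, h₃⟩ := H.exists_component_map hB hx hL₂ hL₃ w
    exact ⟨w', h0, (hd₂ x hx w').trans h₂, (hd₃ x hx w').trans h₃⟩
  · rw [hd₃ x hx w, hdt x hx]
    obtain ⟨w', h0, h₃, h₂⟩ := H.symm.exists_component_map hB hx hL₃ hL₂ w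
    exact ⟨w', h0, (hd₃ x hx w').trans h₃, (hd₂ x hx w').trans h₂⟩
  · refine H.transversal x hx v c (A.symm.injective ?_)
    rw [hd₂ x hx] at h₂
    rw [hd₃ x hx] at h₃
    rw [map_zero, map_add, map_smul]
    exact Prod.ext h₂ h₃

omit hB in
/-- `D₂` and `D₃` are the two eigenspaces of `K_T` in the orthogonal complement of `T`. -/
lemma exists_calabi {n₁ n₂ : ℕ} [FiniteDimensional ℝ E] [FiniteDimensional ℝ F]
    (hE : Module.finrank ℝ E = 1 + n₁ + n₂)
    (hF : Module.finrank ℝ F = Module.finrank ℝ E + 1) (hO : Convex ℝ O) (hx : x ∈ O)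
    {D₂ D₃ : Submodule ℝ E} (hn₁ : Module.finrank ℝ D₂ = n₁) (hn₂ : Module.finrank ℝ D₃ = n₂)
    (hD₂ : ∀ v ∈ D₂, K x (T x) v = a • v) (hD₃ : ∀ v ∈ D₃, K x (T x) v = b • v) :
    ∃ (Φ : OpenPartialHomeomorph E (ℝ × Euc n₁ × Euc n₂)) (ψ₁ : Euc n₁ → Euc (n₁ + 1))
      (ψ₂ : Euc n₂ → Euc (n₂ + 1)) (A : (Euc (n₁ + 1) × Euc (n₂ + 1)) ≃L[ℝ] F), x ∈ Φ.source ∧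
      Φ.source ⊆ O ∧ ContDiffOn ℝ ∞ Φ Φ.source ∧ ContDiffOn ℝ ∞ Φ.symm Φ.target ∧
      ContDiff ℝ ∞ ψ₁ ∧ ContDiff ℝ ∞ ψ₂ ∧ (∀ y z, ∃ u, (u, y, z) ∈ Φ.target) ∧
      ∀ y ∈ Φ.source, f y = A (calabiProduct (-b / a) ψ₁ ψ₂ (Φ y)) := by
  obtain ⟨B, hB⟩ := H.exists_endomorphism hF hO.isPreconnected
  obtain ⟨i, hi, hBi⟩ := H.exists_eigenvector_embedding hB hx hD₂
  obtain ⟨j, hj, hBj⟩ := H.symm.exists_eigenvector_embedding hB hx hD₃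
  obtain ⟨A, hA⟩ := exists_diagonalization (F₁ := Euc (n₁ + 1)) (F₂ := Euc (n₂ + 1))
    (by simp only [hF, hE, finrank_euclideanSpace_fin]; ring) (by simp [hn₁]) (by simp [hn₂])
    H.ne hi hj hBi hBj
  obtain ⟨t, ht, hdt⟩ := H.exists_primitive hO
  obtain ⟨Φ, ψ₁, ψ₂, hxs, hsO, hΦ, hsymm, hψ₁, hψ₂, hmem, heq⟩ :=
    (H.splitImmersion hB hA ht hdt).exists_calabi hE hx
  exact ⟨Φ, ψ₁, ψ₂, A, hxs, hsO, hΦ, hsymm, hψ₁, hψ₂, hmem, fun y hy ↦ by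
    rw [← heq y hy, Prod.mk.eta, A.apply_symm_apply]⟩

end IsEigenField

section Convex

variable {E E' F F' : Type*} [NormedAddCommGroup E] [NormedSpace ℝ E] [NormedAddCommGroup E']
  [NormedSpace ℝ E'] [NormedAddCommGroup F] [NormedSpace ℝ F] [NormedAddCommGroup F']
  [NormedSpace ℝ F'] {ε : ℝ} {f : E → F} {x : E}

lemma fderiv_fderiv_comp_apply {k : E' → E} {y : E'} (hf : ContDiffAt ℝ ∞ f (k y))
    (hk : ContDiffAt ℝ ∞ k y) (u v : E') :
    fderiv ℝ (fderiv ℝ (f ∘ k)) y u v =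
      fderiv ℝ (fderiv ℝ f) (k y) (fderiv ℝ k y u) (fderiv ℝ k y v) +
        fderiv ℝ f (k y) (fderiv ℝ (fderiv ℝ k) y u v) := by
  have dk : DifferentiableAt ℝ k y := hk.differentiableAt (by simp)
  have ddk : DifferentiableAt ℝ (fderiv ℝ k) y :=
    (hk.fderiv_right (m := ∞) (by norm_cast)).differentiableAt (by simp)
  have ddf : DifferentiableAt ℝ (fderiv ℝ f) (k y) :=
    (hf.fderiv_right (m := ∞) (by norm_cast)).differentiableAt (by simp)
  have ddfk : DifferentiableAt ℝ (fderiv ℝ (f ∘ k)) y :=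
    ((hf.comp y hk).fderiv_right (m := ∞) (by norm_cast)).differentiableAt (by simp)
  have hev : (fun z ↦ fderiv ℝ (f ∘ k) z v) =ᶠ[𝓝 y] fun z ↦ fderiv ℝ f (k z) (fderiv ℝ k z v) := by
    filter_upwards [dk.continuousAt.eventually
      ((hf.of_le (m := 1) (by norm_cast)).eventually (by simp)),
      (hk.of_le (m := 1) (by norm_cast)).eventually (by simp)] with z hfz hkz
    rw [fderiv_comp z (hfz.differentiableAt (by simp)) (hkz.differentiableAt (by simp))]
    rfl
  rw [← fderiv_clm_apply_const ddfk, hev.fderiv_eq,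
    fderiv_clm_apply_apply (c := fun z ↦ fderiv ℝ f (k z)) (ddf.comp y dk) (by fun_prop),
    fderiv_clm_apply_const ddk, fderiv_fun_comp y ddf dk]
  rfl

/-- Flat form of strong convexity at `x`: the centroaffine metric of the transversal immersion `f`,
that is the coefficient of `-ε f` in `D²f`, is positive definite at `x`. -/
structure StronglyConvexAt (ε : ℝ) (f : E → F) (x : E) : Prop where
  contDiffAt : ContDiffAt ℝ ∞ f x
  transversal : TransversalAt f x
  pos : ∀ v, v ≠ 0 → ∃ w, ∃ c : ℝ, 0 < c ∧
    fderiv ℝ (fderiv ℝ f) x v v = fderiv ℝ f x w - (ε * c) • f x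

namespace StronglyConvexAt

lemma congr_of_eventuallyEq {g : E → F} (hf : StronglyConvexAt ε f x) (hgf : g =ᶠ[𝓝 x] f) :
    StronglyConvexAt ε g x where
  contDiffAt := hf.contDiffAt.congr_of_eventuallyEq hgf
  transversal := by
    simpa only [TransversalAt, hgf.fderiv_eq, hgf.eq_of_nhds] using hf.transversal
  pos := by simpa only [hgf.fderiv.fderiv_eq, hgf.fderiv_eq, hgf.eq_of_nhds] using hf.pos

lemma of_mul {r : ℝ} (hr : 0 < r) (hf : StronglyConvexAt (ε * r) f x) :
    StronglyConvexAt ε f x where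
  contDiffAt := hf.contDiffAt
  transversal := hf.transversal
  pos v hv := by
    obtain ⟨w, c, hc, hw⟩ := hf.pos v hv
    exact ⟨w, r * c, mul_pos hr hc, by rw [hw, mul_assoc]⟩

lemma comp {k : E' → E} {y : E'} (hf : StronglyConvexAt ε f (k y)) (hk : ContDiffAt ℝ ∞ k y)
    (hinv : (fderiv ℝ k y).IsInvertible) : StronglyConvexAt ε (f ∘ k) y := by
  obtain ⟨e, he⟩ := hinv
  have hfk := fderiv_comp y (hf.contDiffAt.differentiableAt (by simp))
    (hk.differentiableAt (by simp))
  refine ⟨hf.contDiffAt.comp y hk, fun v c hvc ↦ ?_, fun v hv ↦ ?_⟩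
  · rw [hfk, ← he] at hvc
    exact (hf.transversal (e v) c hvc).imp_left fun h0 ↦ by simpa using h0
  · obtain ⟨w, c, hc, hw⟩ := hf.pos (e v) (by simpa using hv)
    refine ⟨e.symm (w + fderiv ℝ (fderiv ℝ k) y v v), c, hc, ?_⟩
    rw [fderiv_fderiv_comp_apply hf.contDiffAt hk, hfk, ← he]
    simp only [ContinuousLinearMap.comp_apply, ContinuousLinearEquiv.coe_coe,
      e.apply_symm_apply, map_add, hw, Function.comp_apply]
    abel

lemma clm_comp (hf : StronglyConvexAt ε f x) (A : F ≃L[ℝ] F') : StronglyConvexAt ε (A ∘ f) x := by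
  have hAf : fderiv ℝ (A ∘ f) x = (A : F →L[ℝ] F') ∘L fderiv ℝ f x := A.comp_fderiv
  have hA : fderiv ℝ A = fun _ ↦ (A : F →L[ℝ] F') := funext fun _ ↦ A.fderiv
  refine ⟨A.contDiff.contDiffAt.comp x hf.contDiffAt, fun v c hvc ↦ ?_, fun v hv ↦ ?_⟩
  · rw [hAf] at hvc
    exact hf.transversal v c (A.injective (by simpa using hvc))
  · obtain ⟨w, c, hc, hw⟩ := hf.pos v hv
    refine ⟨w, c, hc, ?_⟩
    rw [fderiv_fderiv_comp_apply A.contDiff.contDiffAt hf.contDiffAt, hAf, hA, hw]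
    simp

end StronglyConvexAt

end Convex

section Factors

variable {n₁ n₂ : ℕ} {l ε : ℝ} {ψ₁ : Euc n₁ → Euc (n₁ + 1)} {ψ₂ : Euc n₂ → Euc (n₂ + 1)}
  {u : ℝ} {y : Euc n₁} {z : Euc n₂}

lemma fderiv_calabiProduct (h₁ : DifferentiableAt ℝ ψ₁ y) (h₂ : DifferentiableAt ℝ ψ₂ z)
    (α : ℝ) (β : Euc n₁) (γ : Euc n₂) :
    fderiv ℝ (calabiProduct l ψ₁ ψ₂) (u, y, z) (α, β, γ) =
      (Real.exp u • (α • ψ₁ y + fderiv ℝ ψ₁ y β),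
        Real.exp (-l * u) • ((-l * α) • ψ₂ z + fderiv ℝ ψ₂ z γ)) := by
  have hu : HasFDerivAt Prod.fst (ContinuousLinearMap.fst ℝ ℝ (Euc n₁ × Euc n₂)) (u, y, z) :=
    hasFDerivAt_fst
  have hyz : HasFDerivAt Prod.snd (ContinuousLinearMap.snd ℝ ℝ (Euc n₁ × Euc n₂)) (u, y, z) :=
    hasFDerivAt_snd
  have d₁ : HasFDerivAt (fun q : ℝ × Euc n₁ × Euc n₂ ↦ ψ₁ q.2.1) _ (u, y, z) :=
    HasFDerivAt.comp (u, y, z) h₁.hasFDerivAt hyz.fst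
  have d₂ : HasFDerivAt (fun q : ℝ × Euc n₁ × Euc n₂ ↦ ψ₂ q.2.2) _ (u, y, z) :=
    HasFDerivAt.comp (u, y, z) h₂.hasFDerivAt hyz.snd
  have d : HasFDerivAt (calabiProduct l ψ₁ ψ₂) _ (u, y, z) :=
    (hu.exp.smul d₁).prodMk ((hu.const_mul (-l)).exp.smul d₂)
  rw [d.fderiv]
  simp only [neg_mul, neg_smul, smul_neg, ContinuousLinearMap.prod_apply, add_apply, smul_apply,
    ContinuousLinearMap.comp_apply, ContinuousLinearMap.coe_snd', ContinuousLinearMap.coe_fst',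
    ContinuousLinearMap.smulRight_apply, smul_eq_mul, neg_apply, smul_add, Prod.mk.injEq]
  constructor <;> module

variable (h₁ : ContDiff ℝ ∞ ψ₁) (h₂ : ContDiff ℝ ∞ ψ₂)
include h₁ h₂

lemma contDiff_calabiProduct : ContDiff ℝ ∞ (calabiProduct l ψ₁ ψ₂) :=
  (contDiff_fst.exp.smul (h₁.comp (contDiff_fst.comp contDiff_snd))).prodMk
    ((contDiff_const.mul contDiff_fst).exp.smul (h₂.comp (contDiff_snd.comp contDiff_snd)))

lemma fderiv_fderiv_calabiProduct (β : Euc n₁) (γ : Euc n₂) :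
    fderiv ℝ (fderiv ℝ (calabiProduct l ψ₁ ψ₂)) (u, y, z) (0, β, γ) (0, β, γ) =
      (Real.exp u • fderiv ℝ (fderiv ℝ ψ₁) y β β,
        Real.exp (-l * u) • fderiv ℝ (fderiv ℝ ψ₂) z γ γ) := by
  have dd₁ : Differentiable ℝ (fderiv ℝ ψ₁) :=
    (h₁.fderiv_right (m := ∞) (by norm_cast)).differentiable (by simp)
  have dd₂ : Differentiable ℝ (fderiv ℝ ψ₂) :=
    (h₂.fderiv_right (m := ∞) (by norm_cast)).differentiable (by simp)
  have dd : Differentiable ℝ (fderiv ℝ (calabiProduct l ψ₁ ψ₂)) :=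
    ((contDiff_calabiProduct h₁ h₂).fderiv_right (m := ∞) (by norm_cast)).differentiable (by simp)
  have hβγ : (fun q ↦ fderiv ℝ (calabiProduct l ψ₁ ψ₂) q (0, β, γ)) =
      calabiProduct l (fun y ↦ fderiv ℝ ψ₁ y β) (fun z ↦ fderiv ℝ ψ₂ z γ) := by
    funext ⟨u, y, z⟩
    rw [fderiv_calabiProduct (h₁.differentiable (by simp) _) (h₂.differentiable (by simp) _)]
    simp [calabiProduct]
  rw [← fderiv_clm_apply_const (dd _), hβγ, fderiv_calabiProduct (by fun_prop) (by fun_prop),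
    fderiv_clm_apply_const (dd₁ _), fderiv_clm_apply_const (dd₂ _)]
  simp

lemma TransversalAt.fst_factor (hl : l ≠ -1)
    (hp : TransversalAt (calabiProduct l ψ₁ ψ₂) (u, y, z)) : TransversalAt ψ₁ y := by
  intro v c hvc
  have hl' : 1 + l ≠ 0 := fun h0 ↦ hl (by linarith)
  obtain ⟨hv, -⟩ := hp (c, (1 + l) • v, 0) (l * c) (by
    rw [fderiv_calabiProduct (h₁.differentiable (by simp) _) (h₂.differentiable (by simp) _)]
    refine Prod.ext ?_ ?_
    · calc _ = (Real.exp u * (1 + l)) • (fderiv ℝ ψ₁ y v + c • ψ₁ y) := by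
            simp only [calabiProduct, Prod.smul_mk, Prod.mk_add_mk, map_smul]
            module
        _ = 0 := by rw [hvc, smul_zero]
    · simp only [calabiProduct, Prod.smul_mk, Prod.mk_add_mk, map_zero, Prod.snd_zero]
      module)
  simp only [Prod.mk_eq_zero, smul_eq_zero, hl', false_or] at hv
  exact ⟨hv.2.1, hv.1⟩

omit h₁ h₂ in
/-- `(u, z, y) ↦ (-u / l, y, z)` interchanges the two factors of a Calabi product. -/
lemma StronglyConvexAt.calabiProduct_swap (hl : l ≠ 0)
    (hp : StronglyConvexAt ε (calabiProduct l ψ₁ ψ₂) (u, y, z)) :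
    StronglyConvexAt ε (calabiProduct l⁻¹ ψ₂ ψ₁) (-l * u, z, y) := by
  let e : (ℝ × Euc n₂ × Euc n₁) ≃L[ℝ] ℝ × Euc n₁ × Euc n₂ :=
    (ContinuousLinearEquiv.unitsEquivAut ℝ
      (Units.mk0 (-l⁻¹) (neg_ne_zero.2 (inv_ne_zero hl)))).prodCongr
        (ContinuousLinearEquiv.prodComm ℝ (Euc n₂) (Euc n₁))
  have he : ∀ q, e q = (-l⁻¹ * q.1, q.2.2, q.2.1) := fun q ↦ by simp [e, mul_comm, Prod.swap]
  have hpe : StronglyConvexAt ε (calabiProduct l ψ₁ ψ₂) (e (-l * u, z, y)) := by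
    rw [he]
    convert hp using 2
    field_simp
  have hswap := (hpe.comp e.contDiff.contDiffAt ⟨e, e.fderiv.symm⟩).clm_comp
    (ContinuousLinearEquiv.prodComm ℝ (Euc (n₁ + 1)) (Euc (n₂ + 1)))
  refine hswap.congr_of_eventuallyEq (.of_forall fun q ↦ ?_)
  simp [calabiProduct, he, mul_inv_cancel_left₀ hl]

lemma StronglyConvexAt.fst_factor (hl0 : l ≠ 0) (hl : l ≠ -1)
    (hp : StronglyConvexAt ε (calabiProduct l ψ₁ ψ₂) (u, y, z)) :
    StronglyConvexAt (ε * (1 + l⁻¹)) ψ₁ y := by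
  have hinv : l⁻¹ ≠ -1 := by rwa [ne_eq, inv_eq_iff_eq_inv, inv_neg_one]
  have ht₂ : TransversalAt ψ₂ z :=
    (hp.calabiProduct_swap hl0).transversal.fst_factor h₂ h₁ hinv
  refine ⟨h₁.contDiffAt, hp.transversal.fst_factor h₁ h₂ hl, fun v hv ↦ ?_⟩
  obtain ⟨⟨α, β, γ⟩, c, hc, hw⟩ := hp.pos (0, v, 0) (by simpa using hv)
  rw [fderiv_fderiv_calabiProduct h₁ h₂, fderiv_calabiProduct (h₁.differentiable (by simp) _)
    (h₂.differentiable (by simp) _)] at hw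
  simp only [calabiProduct, Prod.smul_mk, Prod.mk_sub_mk, Prod.mk.injEq, map_zero, smul_zero,
    smul_comm (ε * c) (Real.exp _), ← smul_sub] at hw
  have hψ₁ := smul_right_injective _ (Real.exp_pos u).ne' hw.1
  have hψ₂ := (smul_eq_zero.1 hw.2.symm).resolve_left (Real.exp_pos _).ne'
  have hα := (ht₂ γ (-l * α - ε * c) (by rw [← hψ₂]; module)).2
  have hα' : α = -(ε * c * l⁻¹) := by field_simp; linarith
  exact ⟨β, c, hc, by rw [hψ₁, hα']; module⟩

lemma StronglyConvexAt.snd_factor (hl0 : l ≠ 0) (hl : l ≠ -1)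
    (hp : StronglyConvexAt ε (calabiProduct l ψ₁ ψ₂) (u, y, z)) :
    StronglyConvexAt (ε * (1 + l)) ψ₂ z := by
  have hinv : l⁻¹ ≠ -1 := by rwa [ne_eq, inv_eq_iff_eq_inv, inv_neg_one]
  simpa only [inv_inv] using
    (hp.calabiProduct_swap hl0).fst_factor h₂ h₁ (inv_ne_zero hl0) hinv

end Factors

section FlatManifold

variable {n : ℕ}

lemma mvfderiv_eq_fderiv {F : Type*} [NormedAddCommGroup F] [NormedSpace ℝ F] (f : Euc n → F)
    (x : Euc n) : mvfderiv (𝓡 n) f x = fderiv ℝ f x := by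
  ext v
  simp only [mvfderiv, mfderiv_eq_fderiv]
  rfl

lemma diffAt_const (v x : Euc n) : VField.DiffAt (M := Euc n) (fun _ ↦ v) x :=
  ((contMDiffAt_vectorSpace_iff_contDiffAt (𝕜 := ℝ) (n := 1) (x := x)
    (V := fun _ : Euc n ↦ v)).2 contDiffAt_const).mdifferentiableAt one_ne_zero

variable {ψ : Euc n → Euc (n + 1)} {ε : ℝ}

lemma isCentroaffine_of_transversalAt (hψ : ContDiff ℝ ∞ ψ) (ht : ∀ x, TransversalAt ψ x) :
    IsCentroaffine ψ where
  smooth := hψ.contMDiff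
  immersion x := (injective_iff_map_eq_zero _).2 fun v hv ↦
    (ht x v 0 (by rwa [← mvfderiv_eq_fderiv, zero_smul, add_zero])).1
  transversal x := by
    rintro ⟨v, hv⟩
    refine neg_ne_zero.2 one_ne_zero (ht x v (-1 : ℝ) ?_).2
    rw [← mvfderiv_eq_fderiv]
    exact (congrArg (· + (-1 : ℝ) • ψ x) hv).trans (by module)

lemma metric_eq_of_fderiv_fderiv (hψ : ContDiff ℝ ∞ ψ) (ht : ∀ x, TransversalAt ψ x)
    (hε : ε = 1 ∨ ε = -1) {x v w : Euc n} {c : ℝ}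
    (hw : fderiv ℝ (fderiv ℝ ψ) x v v = fderiv ℝ ψ x w - (ε * c) • ψ x) :
    metric ε ψ x v v = c := by
  have hca := isCentroaffine_of_transversalAt hψ ht
  have hgauss := gauss_formula hca hε (diffAt_const v x) v
  have hflat : flatDeriv ψ (fun _ ↦ v) x v = fderiv ℝ (fderiv ℝ ψ) x v v := by
    simp only [flatDeriv, mvfderiv_eq_fderiv]
    exact fderiv_clm_apply_const ((hψ.fderiv_right (m := ∞) (by norm_cast)).differentiable
      (by simp) x) v v
  rw [hflat, hw, mvfderiv_eq_fderiv, sub_eq_add_neg, ← neg_smul, smul_smul] at hgauss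
  have hεc : -(ε * c) = metric ε ψ x v v * -ε := ((ht x).eq_and_eq hgauss).2
  have hε0 : ε ≠ 0 := by rintro rfl; simp at hε
  exact mul_left_cancel₀ hε0 (by linarith)

lemma isLocallyStronglyConvex_of_flat (hε : ε ≠ 0) (hψ : ∀ x, StronglyConvexAt ε ψ x) :
    IsLocallyStronglyConvex ψ := by
  have hsmooth : ContDiff ℝ ∞ ψ := contDiff_iff_contDiffAt.2 fun x ↦ (hψ x).contDiffAt
  have ht : ∀ x, TransversalAt ψ x := fun x ↦ (hψ x).transversal
  obtain ⟨σ, hσ, hψσ⟩ : ∃ σ : ℝ, (σ = 1 ∨ σ = -1) ∧ ∀ x, StronglyConvexAt σ ψ x := by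
    rcases hε.lt_or_gt with h0 | h0
    · exact ⟨-1, .inr rfl, fun x ↦ .of_mul (neg_pos.2 h0) (by simpa using hψ x)⟩
    · exact ⟨1, .inl rfl, fun x ↦ .of_mul h0 (by simpa using hψ x)⟩
  refine ⟨isCentroaffine_of_transversalAt hsmooth ht, σ, hσ, fun x v hv ↦ ?_⟩
  obtain ⟨w, c, hc, hw⟩ := (hψσ x).pos v hv
  rwa [metric_eq_of_fderiv_fderiv hsmooth ht hσ hw]

end FlatManifold

lemma isInvertible_fderiv_symm {E F : Type*} [NormedAddCommGroup E] [NormedSpace ℝ E]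
    [NormedAddCommGroup F] [NormedSpace ℝ F] {Φ : OpenPartialHomeomorph E F}
    (hΦ : ContDiffOn ℝ ∞ Φ Φ.source) (hsymm : ContDiffOn ℝ ∞ Φ.symm Φ.target) {y : F}
    (hy : y ∈ Φ.target) : (fderiv ℝ Φ.symm y).IsInvertible := by
  have hx := Φ.map_target hy
  have d : HasFDerivAt Φ (fderiv ℝ Φ (Φ.symm y)) (Φ.symm y) :=
    ((hΦ.contDiffAt (Φ.open_source.mem_nhds hx)).differentiableAt (by simp)).hasFDerivAt
  have dsymm : HasFDerivAt Φ.symm (fderiv ℝ Φ.symm y) y :=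
    ((hsymm.contDiffAt (Φ.open_target.mem_nhds hy)).differentiableAt (by simp)).hasFDerivAt
  refine ContinuousLinearMap.IsInvertible.of_inverse (g := fderiv ℝ Φ (Φ.symm y)) ?_ ?_
  · refine HasFDerivAt.unique (.comp _ (by rwa [Φ.right_inv hy]) d)
      ((hasFDerivAt_id _).congr_of_eventuallyEq ?_)
    filter_upwards [Φ.open_source.mem_nhds hx] with z hz using Φ.left_inv hz
  · refine HasFDerivAt.unique (d.comp y dsymm) ((hasFDerivAt_id y).congr_of_eventuallyEq ?_)
    filter_upwards [Φ.open_target.mem_nhds hy] with z hz using Φ.right_inv hz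

namespace IsEigenField

variable {E F : Type*} [NormedAddCommGroup E] [NormedSpace ℝ E] [NormedAddCommGroup F]
  [NormedSpace ℝ F] {ε : ℝ} {O : Set E} {f : E → F} {Γ K : E → E →L[ℝ] E →L[ℝ] E}
  {h : E → E →L[ℝ] E →L[ℝ] ℝ} {a b : ℝ} {T : E → E} (H : IsEigenField ε O f Γ K h a b T) {x : E}
include H

lemma stronglyConvexAt (hx : x ∈ O) : StronglyConvexAt ε f x :=
  ⟨H.contDiffAt hx, H.transversal x hx, fun v hv ↦
    ⟨Γ x v v + K x v v, h x v v, H.metric_pos x hx v hv, H.gauss_formula x hx v v⟩⟩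

lemma stronglyConvexAt_calabiProduct {n₁ n₂ : ℕ} {l : ℝ}
    {Φ : OpenPartialHomeomorph E (ℝ × Euc n₁ × Euc n₂)} {ψ₁ : Euc n₁ → Euc (n₁ + 1)}
    {ψ₂ : Euc n₂ → Euc (n₂ + 1)} {A : (Euc (n₁ + 1) × Euc (n₂ + 1)) ≃L[ℝ] F}
    (hsrc : Φ.source ⊆ O) (hΦ : ContDiffOn ℝ ∞ Φ Φ.source) (hsymm : ContDiffOn ℝ ∞ Φ.symm Φ.target)
    (heq : ∀ y ∈ Φ.source, f y = A (calabiProduct l ψ₁ ψ₂ (Φ y))) {q : ℝ × Euc n₁ × Euc n₂}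
    (hq : q ∈ Φ.target) : StronglyConvexAt ε (calabiProduct l ψ₁ ψ₂) q := by
  have hf := H.stronglyConvexAt (hsrc (Φ.map_target hq))
  refine ((hf.comp (hsymm.contDiffAt (Φ.open_target.mem_nhds hq))
    (isInvertible_fderiv_symm hΦ hsymm hq)).clm_comp A.symm).congr_of_eventuallyEq ?_
  filter_upwards [Φ.open_target.mem_nhds hq] with p hp
  simp only [Function.comp_apply, heq _ (Φ.map_target hp), Φ.right_inv hp, A.symm_apply_apply]

lemma exists_stronglyConvex_calabi [FiniteDimensional ℝ E] [FiniteDimensional ℝ F] {n₁ n₂ : ℕ}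
    (hE : Module.finrank ℝ E = 1 + n₁ + n₂)
    (hF : Module.finrank ℝ F = Module.finrank ℝ E + 1) (hO : Convex ℝ O) (hx : x ∈ O)
    {D₂ D₃ : Submodule ℝ E} (hn₁ : Module.finrank ℝ D₂ = n₁) (hn₂ : Module.finrank ℝ D₃ = n₂)
    (hD₂ : ∀ v ∈ D₂, K x (T x) v = a • v) (hD₃ : ∀ v ∈ D₃, K x (T x) v = b • v) :
    ∃ (l : ℝ) (Φ : OpenPartialHomeomorph E (ℝ × Euc n₁ × Euc n₂)) (ψ₁ : Euc n₁ → Euc (n₁ + 1))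
      (ψ₂ : Euc n₂ → Euc (n₂ + 1)) (A : (Euc (n₁ + 1) × Euc (n₂ + 1)) ≃L[ℝ] F),
      l ≠ 0 ∧ l ≠ -1 ∧ IsLocallyStronglyConvex ψ₁ ∧ IsLocallyStronglyConvex ψ₂ ∧
      x ∈ Φ.source ∧ Φ.source ⊆ O ∧ ContDiffOn ℝ ∞ Φ Φ.source ∧
      ContDiffOn ℝ ∞ Φ.symm Φ.target ∧
      ∀ y ∈ Φ.source, f y = A (calabiProduct l ψ₁ ψ₂ (Φ y)) := by
  obtain ⟨Φ, ψ₁, ψ₂, A, hxs, hsO, hΦ, hsymm, hψ₁, hψ₂, hmem, heq⟩ :=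
    H.exists_calabi hE hF hO hx hn₁ hn₂ hD₂ hD₃
  have ha := H.ne_zero_left
  have hl0 : -b / a ≠ 0 := div_ne_zero (neg_ne_zero.2 H.symm.ne_zero_left) ha
  have hl : -b / a ≠ -1 := fun h0 ↦ H.ne (by field_simp at h0; linarith)
  have hl' : 1 + -b / a ≠ 0 := fun h0 ↦ hl (by linarith)
  have hinv : 1 + (-b / a)⁻¹ ≠ 0 := fun h0 ↦ hl (by
    rw [← inv_inv (-b / a), eq_neg_of_add_eq_zero_right h0, inv_neg_one])
  have hconv : ∀ y z, ∃ u, StronglyConvexAt ε (calabiProduct (-b / a) ψ₁ ψ₂) (u, y, z) :=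
    fun y z ↦ (hmem y z).imp fun u hu ↦ H.stronglyConvexAt_calabiProduct hsO hΦ hsymm heq hu
  refine ⟨-b / a, Φ, ψ₁, ψ₂, A, hl0, hl,
    isLocallyStronglyConvex_of_flat (mul_ne_zero H.ne_zero hinv) fun y ↦ ?_,
    isLocallyStronglyConvex_of_flat (mul_ne_zero H.ne_zero hl') fun z ↦ ?_,
    hxs, hsO, hΦ, hsymm, heq⟩
  · exact (hconv y 0).elim fun _ hu ↦ hu.fst_factor hψ₁ hψ₂ hl0 hl
  · exact (hconv 0 z).elim fun _ hu ↦ hu.snd_factor hψ₁ hψ₂ hl0 hl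

end IsEigenField

section Koszul

variable {E : Type*} [NormedAddCommGroup E] [NormedSpace ℝ E] {O : Set E}
  {h : E → E →L[ℝ] E →L[ℝ] ℝ} {Γ : E → E →L[ℝ] E →L[ℝ] E}

lemma koszul_formula {x : E} (hΓ : ∀ u v, Γ x u v = Γ x v u) (hsymm : ∀ u v, h x u v = h x v u)
    (hcomp : ∀ u v w, fderiv ℝ h x u v w = h x (Γ x u v) w + h x v (Γ x u w)) (u v w : E) :
    h x (Γ x u v) w =
      2⁻¹ * (fderiv ℝ h x u v w + fderiv ℝ h x v u w - fderiv ℝ h x w u v) := by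
  rw [hcomp, hcomp, hcomp, hΓ v u, hΓ w u, hΓ w v, hsymm v (Γ x u w)]
  ring

variable [FiniteDimensional ℝ E]

lemma isInvertible_of_pos {g : E →L[ℝ] E →L[ℝ] ℝ} (hg : ∀ v, v ≠ 0 → 0 < g v v) :
    g.IsInvertible := by
  have hdim : Module.finrank ℝ E = Module.finrank ℝ (E →L[ℝ] ℝ) := by
    rw [← (LinearMap.toContinuousLinearMap (𝕜 := ℝ) (E := E) (F' := ℝ)).finrank_eq]
    exact Subspace.dual_finrank_eq.symm
  refine isInvertible_of_injective hdim ((injective_iff_map_eq_zero g).2 fun v hv ↦ ?_)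
  by_contra hne
  simpa [hv] using hg v hne

lemma contDiffOn_of_metric_apply (hh : ContDiffOn ℝ ∞ h O)
    (hpos : ∀ x ∈ O, ∀ v, v ≠ 0 → 0 < h x v v)
    (hΓ : ∀ u v w, ContDiffOn ℝ ∞ (fun x ↦ h x (Γ x u v) w) O) : ContDiffOn ℝ ∞ Γ O := by
  have : CompleteSpace E := FiniteDimensional.complete ℝ E
  have hinv : ContDiffOn ℝ ∞ (fun x ↦ (h x).inverse) O := fun x hx ↦
    (isInvertible_of_pos (hpos x hx)).contDiffAt_map_inverse.comp_contDiffWithinAt x (hh x hx)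
  refine contDiffOn_clm_apply.2 fun u ↦ contDiffOn_clm_apply.2 fun v ↦ ?_
  refine (hinv.clm_apply (contDiffOn_clm_apply.2 (hΓ u v))).congr fun x hx ↦ ?_
  exact ((isInvertible_of_pos (hpos x hx)).inverse_apply_self _).symm

lemma isLeviCivitaOn_of_compatible (hO : IsOpen O) (hh : ContDiffOn ℝ ∞ h O)
    (hsymm : ∀ x ∈ O, ∀ u v, h x u v = h x v u) (hpos : ∀ x ∈ O, ∀ v, v ≠ 0 → 0 < h x v v)
    (hΓ : ∀ x ∈ O, ∀ u v, Γ x u v = Γ x v u)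
    (hcomp : ∀ x ∈ O, ∀ u v w, fderiv ℝ h x u v w = h x (Γ x u v) w + h x v (Γ x u w)) :
    IsLeviCivitaOn O Γ h where
  isOpen := hO
  smooth_conn := by
    have hdh (u v w : E) : ContDiffOn ℝ ∞ (fun x ↦ fderiv ℝ h x u v w) O :=
      (((hh.fderiv_of_isOpen hO (by norm_cast)).clm_apply contDiffOn_const).clm_apply
        contDiffOn_const).clm_apply contDiffOn_const
    refine contDiffOn_of_metric_apply hh hpos fun u v w ↦ ContDiffOn.congr ?_ fun x hx ↦
      koszul_formula (hΓ x hx) (hsymm x hx) (hcomp x hx) u v w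
    exact contDiffOn_const.mul (((hdh u v w).add (hdh v u w)).sub (hdh w u v))
  smooth_metric := hh
  conn_symm := hΓ
  metric_symm := hsymm
  metric_pos := hpos
  compatible := hcomp

end Koszul

section FlatConnection

variable {E F : Type*} [NormedAddCommGroup E] [NormedSpace ℝ E] [NormedAddCommGroup F]
  [NormedSpace ℝ F]

/-- The induced connection of the centroaffine immersion `f`: the tangential part of `D²f`. -/
def flatConn (f : E → F) (x : E) : E →L[ℝ] E →L[ℝ] E :=
  ContinuousLinearMap.compL ℝ E F E
    (ContinuousLinearMap.fst ℝ E ℝ ∘L (flatSplitting f x).inverse) ∘L fderiv ℝ (fderiv ℝ f) x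

/-- The centroaffine metric of `f`: the coefficient of `-ε f` in `D²f`, for `ε = ±1`. -/
def flatMetric (ε : ℝ) (f : E → F) (x : E) : E →L[ℝ] E →L[ℝ] ℝ :=
  ContinuousLinearMap.compL ℝ E F ℝ
    (-ε • (ContinuousLinearMap.snd ℝ E ℝ ∘L (flatSplitting f x).inverse)) ∘L
      fderiv ℝ (fderiv ℝ f) x

variable {f : E → F} {x : E} {ε : ℝ} {O : Set E} {K : E → E →L[ℝ] E →L[ℝ] E}

lemma flatConn_symm (hf : ContDiffAt ℝ ∞ f x) (u v : E) : flatConn f x u v = flatConn f x v u := by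
  simp only [flatConn, ContinuousLinearMap.comp_apply, ContinuousLinearMap.compL_apply,
    fderiv_fderiv_symm hf u v]

lemma flatMetric_symm (hf : ContDiffAt ℝ ∞ f x) (u v : E) :
    flatMetric ε f x u v = flatMetric ε f x v u := by
  simp only [flatMetric, ContinuousLinearMap.comp_apply, ContinuousLinearMap.compL_apply,
    fderiv_fderiv_symm hf u v]

variable [FiniteDimensional ℝ E] [FiniteDimensional ℝ F]
  (hdim : Module.finrank ℝ F = Module.finrank ℝ E + 1)
include hdim

lemma flat_gauss_formula (hε : ε * ε = 1) (ht : TransversalAt f x) (u v : E) :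
    fderiv ℝ (fderiv ℝ f) x u v =
      fderiv ℝ f x (flatConn f x u v) - (ε * flatMetric ε f x u v) • f x := by
  have hself := (ht.isInvertible_flatSplitting hdim).self_apply_inverse
    (fderiv ℝ (fderiv ℝ f) x u v)
  rw [← Prod.mk.eta (p := (flatSplitting f x).inverse _), flatSplitting_apply] at hself
  refine hself.symm.trans ?_
  simp only [flatConn, flatMetric, ContinuousLinearMap.comp_apply, ContinuousLinearMap.compL_apply,
    smul_apply, ContinuousLinearMap.coe_fst', ContinuousLinearMap.coe_snd', smul_eq_mul]
  rw [sub_eq_add_neg, ← neg_smul]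
  congr 2
  linear_combination -((flatSplitting f x).inverse (fderiv ℝ (fderiv ℝ f) x u v)).2 * hε

lemma contDiffAt_flatConn (hf : ContDiffAt ℝ ∞ f x) (ht : TransversalAt f x) :
    ContDiffAt ℝ ∞ (flatConn f) x :=
  ((ContinuousLinearMap.compL ℝ E F E).contDiff.contDiffAt.comp x
    (contDiffAt_const.clm_comp (contDiffAt_flatSplitting_inverse hdim hf ht))).clm_comp
      ((hf.fderiv_right (m := ∞) (by norm_cast)).fderiv_right (by norm_cast))

lemma contDiffAt_flatMetric (hf : ContDiffAt ℝ ∞ f x) (ht : TransversalAt f x) :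
    ContDiffAt ℝ ∞ (flatMetric ε f) x :=
  ((ContinuousLinearMap.compL ℝ E F ℝ).contDiff.contDiffAt.comp x
    ((contDiffAt_const (c := ContinuousLinearMap.snd ℝ E ℝ)).clm_comp
      (contDiffAt_flatSplitting_inverse hdim hf ht) |>.const_smul (-ε))).clm_comp
        ((hf.fderiv_right (m := ∞) (by norm_cast)).fderiv_right (by norm_cast))

lemma flatMetric_codazzi (hε : ε * ε = 1) (hO : IsOpen O) (hf : ContDiffOn ℝ ∞ f O)
    (ht : ∀ y ∈ O, TransversalAt f y) (hx : x ∈ O) (u v w : E) :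
    flatMetric ε f x u (flatConn f x v w) + fderiv ℝ (flatMetric ε f) x u v w =
      flatMetric ε f x v (flatConn f x u w) + fderiv ℝ (flatMetric ε f) x v u w := by
  have hfx := hf.contDiffAt (hO.mem_nhds hx)
  have hε0 : ε ≠ 0 := by rintro rfl; simp at hε
  refine (integrability_of_gauss hε0 hfx
    ((contDiffAt_flatConn hdim hfx (ht x hx)).differentiableAt (by simp))
    ((contDiffAt_flatMetric hdim hfx (ht x hx)).differentiableAt (by simp)) (ht x hx) ?_ u v w).2
  filter_upwards [hO.mem_nhds hx] with y hy using flat_gauss_formula hdim hε (ht y hy)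

lemma structureEquations_of_compatible (hε : ε * ε = 1) (hO : IsOpen O) (hf : ContDiffOn ℝ ∞ f O)
    (ht : ∀ x ∈ O, TransversalAt f x) (hpos : ∀ x ∈ O, ∀ v, v ≠ 0 → 0 < flatMetric ε f x v v)
    (hK : ∀ x ∈ O, ∀ u v, K x u v = K x v u)
    (hcomp : ∀ x ∈ O, ∀ u v w, fderiv ℝ (flatMetric ε f) x u v w =
      flatMetric ε f x (flatConn f x u v - K x u v) w +
        flatMetric ε f x v (flatConn f x u w - K x u w)) :
    StructureEquations ε O f (fun x ↦ flatConn f x - K x) K (flatMetric ε f) := by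
  have hfx : ∀ x ∈ O, ContDiffAt ℝ ∞ f x := fun x hx ↦ hf.contDiffAt (hO.mem_nhds hx)
  have hconn : ContDiffOn ℝ ∞ (flatConn f) O := fun x hx ↦
    (contDiffAt_flatConn hdim (hfx x hx) (ht x hx)).contDiffWithinAt
  have hLC : IsLeviCivitaOn O (fun x ↦ flatConn f x - K x) (flatMetric ε f) :=
    isLeviCivitaOn_of_compatible hO
      (fun x hx ↦ (contDiffAt_flatMetric hdim (hfx x hx) (ht x hx)).contDiffWithinAt)
      (fun x hx ↦ flatMetric_symm (hfx x hx)) hpos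
      (fun x hx u v ↦ by simp only [sub_apply, flatConn_symm (hfx x hx) u v, hK x hx u v]) hcomp
  have hK_left : ∀ x ∈ O, ∀ u v w, flatMetric ε f x u (K x v w) = flatMetric ε f x v (K x u w) := by
    intro x hx u v w
    have hcod := flatMetric_codazzi hdim hε hO hf ht hx u v w
    rw [hcomp x hx, hcomp x hx, flatConn_symm (hfx x hx) u v, hK x hx u v] at hcod
    simp only [map_sub] at hcod
    linarith
  exact
    { toIsLeviCivitaOn := hLC
      ne_zero := by rintro rfl; simp at hε
      smooth := hf
      smooth_diff := (hconn.sub hLC.smooth_conn).congr fun x _ ↦ (sub_sub_cancel _ _).symm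
      transversal := ht
      gauss_formula := fun x hx u v ↦ by
        simpa using flat_gauss_formula hdim hε (ht x hx) u v
      diff_symm := hK
      diff_adjoint := fun x hx u v w ↦ by
        rw [flatMetric_symm (hfx x hx), hK x hx u v, hK_left x hx w v u, hK x hx w u] }

end FlatConnection

section EigenField

variable {E F : Type*} [NormedAddCommGroup E] [NormedSpace ℝ E] [FiniteDimensional ℝ E]
  [NormedAddCommGroup F] [NormedSpace ℝ F]

/-- An endomorphism with the eigenvalues `a + b`, `a` and `b` that is self-adjoint for an inner
product with `θ = ⟨t, ·⟩`. -/
lemma quadratic_of_eigenspaces {P : E →L[ℝ] E} {θ : E →L[ℝ] ℝ} {a b : ℝ} {t : E}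
    {V W : Submodule ℝ E}
    (hdim : Module.finrank ℝ E = 1 + Module.finrank ℝ V + Module.finrank ℝ W) (ha : a ≠ 0)
    (hb : b ≠ 0) (hab : a ≠ b) (hθt : θ t = 1) (hθ : ∀ v, θ (P v) = (a + b) * θ v)
    (ht : P t = (a + b) • t) (hV : ∀ v ∈ V, P v = a • v) (hW : ∀ w ∈ W, P w = b • w) (v : E) :
    P (P v) = (a + b) • P v + (a * b * θ v) • t - (a * b) • v := by
  have hθV : ∀ v ∈ V, θ v = 0 := fun v hv ↦ by
    have hPv := hθ v
    rw [hV v hv, map_smul, smul_eq_mul] at hPv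
    exact (mul_eq_zero.1 (by linarith : b * θ v = 0)).resolve_left hb
  have hθW : ∀ w ∈ W, θ w = 0 := fun w hw ↦ by
    have hPw := hθ w
    rw [hW w hw, map_smul, smul_eq_mul] at hPw
    exact (mul_eq_zero.1 (by linarith : a * θ w = 0)).resolve_left ha
  let L : (ℝ × V × W) →ₗ[ℝ] E :=
    (LinearMap.toSpanSingleton ℝ E t).coprod (V.subtype.coprod W.subtype)
  have hL : ∀ q, L q = q.1 • t + ((q.2.1 : E) + q.2.2) := fun q ↦ by simp [L]
  have hinj : Function.Injective L := by
    refine (injective_iff_map_eq_zero L).2 fun ⟨c, v, w⟩ hcvw ↦ ?_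
    rw [hL] at hcvw
    obtain rfl : c = 0 := by simpa [hθt, hθV, hθW] using congrArg θ hcvw
    have hvw : (v : E) + w = 0 := by simpa using hcvw
    have hPvw : a • (v : E) + b • (w : E) = 0 := by
      simpa only [map_add, hV v v.2, hW w w.2, map_zero] using congrArg P hvw
    have hv0 : (a - b) • (v : E) = 0 := by linear_combination (norm := module) hPvw - b • hvw
    obtain rfl : v = 0 := by simpa [sub_ne_zero.2 hab] using hv0
    obtain rfl : w = 0 := by simpa using hvw
    rfl
  obtain ⟨⟨c, v, w⟩, rfl⟩ := (LinearMap.injective_iff_surjective_of_finrank_eq_finrank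
    (by simp [hdim, add_assoc])).1 hinj v
  simp only [hL, map_add, map_smul, ht, hV v v.2, hW w w.2, hθt, hθV v v.2, hθW w w.2, smul_eq_mul]
  module

lemma StructureEquations.isEigenField {ε : ℝ} {O : Set E} {f : E → F}
    {Γ K : E → E →L[ℝ] E →L[ℝ] E} {h : E → E →L[ℝ] E →L[ℝ] ℝ} {a b : ℝ} {T : E → E}
    {D₂ D₃ : E → Submodule ℝ E} (H : StructureEquations ε O f Γ K h) (hT : ContDiffOn ℝ ∞ T O)
    (hunit : ∀ x ∈ O, h x (T x) (T x) = 1) (hab : a * b = ε) (hne : a ≠ b)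
    (hdim : ∀ x ∈ O, Module.finrank ℝ E = 1 + Module.finrank ℝ (D₂ x) + Module.finrank ℝ (D₃ x))
    (hKT : ∀ x ∈ O, K x (T x) (T x) = (a + b) • T x)
    (hD₂ : ∀ x ∈ O, ∀ v ∈ D₂ x, K x (T x) v = a • v)
    (hD₃ : ∀ x ∈ O, ∀ v ∈ D₃ x, K x (T x) v = b • v) : IsEigenField ε O f Γ K h a b T where
  toStructureEquations := H
  smooth_field := hT
  unit := hunit
  eigen := hKT
  quadratic x hx := by
    rw [← hab]
    have hε : a * b ≠ 0 := hab ▸ H.ne_zero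
    refine quadratic_of_eigenspaces (hdim x hx) (left_ne_zero_of_mul hε)
      (right_ne_zero_of_mul hε) hne (hunit x hx) (fun v ↦ ?_) (hKT x hx) (hD₂ x hx) (hD₃ x hx)
    rw [← H.diff_adjoint x hx, hKT x hx, map_smul, smul_apply, smul_eq_mul]
  mul_eq := hab
  ne := hne

end EigenField

section Chart

variable {n : ℕ} {M : Type*} [TopologicalSpace M] [ChartedSpace (Euc n) M]

/-- The derivative of a chart, which identifies the tangent space of `M` with `ℝⁿ`. -/
def chartDeriv (φ : OpenPartialHomeomorph M (Euc n)) (q : M) :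
    TangentSpace (𝓡 n) q →L[ℝ] Euc n := mvfderiv (𝓡 n) φ q

/-- The coordinate vector field of the chart `φ` in the direction `a`. -/
def coordField (φ : OpenPartialHomeomorph M (Euc n)) (a : Euc n) : VField n M :=
  VectorField.mpullback (𝓡 n) (𝓡 n) φ (fun _ ↦ a)

/-- The vector field `X` read in the chart `φ`. -/
def chartField (φ : OpenPartialHomeomorph M (Euc n)) (X : VField n M) (x : Euc n) : Euc n :=
  chartDeriv φ (φ.symm x) (X (φ.symm x))

/-- The family of tangent subspaces `D` read in the chart `φ`. -/
def chartDistribution (φ : OpenPartialHomeomorph M (Euc n))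
    (D : Π p : M, Submodule ℝ (TangentSpace (𝓡 n) p)) (x : Euc n) : Submodule ℝ (Euc n) :=
  (D (φ.symm x)).map (chartDeriv φ (φ.symm x)).toLinearMap

variable {φ : OpenPartialHomeomorph M (Euc n)}
  (hφ : φ ∈ IsManifold.maximalAtlas (𝓡 n) ∞ M) {q : M} (hq : q ∈ φ.source)
include hφ

section
include hq

lemma isInvertible_mfderiv_chart : (mfderiv (𝓡 n) (𝓡 n) φ q).IsInvertible := by
  have h : φ.MDifferentiable (𝓡 n) (𝓡 n) :=
    ⟨(contMDiffOn_of_mem_maximalAtlas hφ).mdifferentiableOn (by simp),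
      (contMDiffOn_symm_of_mem_maximalAtlas hφ).mdifferentiableOn (by simp)⟩
  exact ⟨h.mfderiv hq, rfl⟩

lemma chartDeriv_coordField (a : Euc n) : chartDeriv φ q (coordField φ a q) = a :=
  (isInvertible_mfderiv_chart hφ hq).self_apply_inverse a

lemma coordField_chartDeriv (v : TangentSpace (𝓡 n) q) :
    coordField φ (chartDeriv φ q v) q = v :=
  (isInvertible_mfderiv_chart hφ hq).inverse_apply_self v

lemma chartDeriv_injective : Function.Injective (chartDeriv φ q) :=
  Function.LeftInverse.injective (g := fun a ↦ coordField φ a q) (coordField_chartDeriv hφ hq)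

lemma mvfderiv_eq_fderiv_chart {G : Type*} [NormedAddCommGroup G] [NormedSpace ℝ G] {g : M → G}
    {k : Euc n → G} (hgk : ∀ y ∈ φ.source, g y = k (φ y)) (hk : DifferentiableAt ℝ k (φ q))
    (v : TangentSpace (𝓡 n) q) :
    mvfderiv (𝓡 n) g q v = fderiv ℝ k (φ q) (chartDeriv φ q v) := by
  have hderiv := (hk.hasFDerivAt.hasMFDerivAt.comp q
    ((contMDiffAt_of_mem_maximalAtlas hφ hq).mdifferentiableAt (by simp)).hasMFDerivAt)
      |>.congr_of_eventuallyEq (f₁ := g) (by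
        filter_upwards [φ.open_source.mem_nhds hq] with y hy using hgk y hy)
  exact congrArg (fun L : TangentSpace (𝓡 n) q →L[ℝ] G ↦ L v) hderiv.mfderiv

variable [IsManifold (𝓡 n) ∞ M]

lemma diffAt_coordField (a : Euc n) : (coordField φ a).DiffAt q :=
  MDifferentiableAt.mpullback_vectorField (V := fun _ ↦ a) (n := ∞) (diffAt_const a (φ q))
    (contMDiffAt_of_mem_maximalAtlas hφ hq) (isInvertible_mfderiv_chart hφ hq)
    (WithTop.coe_le_coe.2 le_top)

lemma mlieBracket_coordField (a b : Euc n) :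
    VectorField.mlieBracket (𝓡 n) (coordField φ a) (coordField φ b) q = 0 := by
  have htwo : minSmoothness ℝ 2 ≤ ∞ := by
    simpa using WithTop.coe_le_coe.2 (le_top : (2 : ℕ∞) ≤ ⊤)
  have : IsManifold (𝓡 n) (minSmoothness ℝ 2) M := IsManifold.of_le (n := ∞) htwo
  let A : VField n (Euc n) := fun _ ↦ a
  let B : VField n (Euc n) := fun _ ↦ b
  have hconst : VectorField.mlieBracket (𝓡 n) A B (φ q) = 0 := by
    rw [← VectorField.mlieBracketWithin_univ, VectorField.mlieBracketWithin_eq_lieBracketWithin]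
    simp only [VectorField.lieBracketWithin, A, B, fderivWithin_fun_const]
    exact sub_self _
  have hpull := VectorField.mpullback_mlieBracket (I := 𝓡 n) (I' := 𝓡 n) (f := φ) (x₀ := q)
    (V := A) (W := B) (n := ∞) (diffAt_const a (φ q)) (diffAt_const b (φ q))
    (contMDiffAt_of_mem_maximalAtlas hφ hq) htwo
  rwa [VectorField.mpullback_apply, hconst, map_zero, eq_comm] at hpull

end

lemma finrank_chartDistribution (D : Π p : M, Submodule ℝ (TangentSpace (𝓡 n) p)) {x : Euc n}
    (hx : x ∈ φ.target) :
    Module.finrank ℝ (chartDistribution φ D x) = Module.finrank ℝ (D (φ.symm x)) :=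
  (Submodule.equivMapOfInjective _ (chartDeriv_injective hφ (φ.map_target hx))
    (D (φ.symm x))).finrank_eq.symm

variable [IsManifold (𝓡 n) ∞ M]

lemma contDiffOn_chartField {X : VField n M} (hX : X.SmoothOn Set.univ) :
    ContDiffOn ℝ ∞ (chartField φ X) φ.target := by
  have hφs := contMDiffOn_of_mem_maximalAtlas hφ
  have htangent := hφs.contMDiffOn_tangentMapWithin (m := ∞) (by simp)
    φ.open_source.uniqueMDiffOn
  have hpush : ContMDiffOn (𝓡 n) (𝓡 n) ∞
      (fun q ↦ (tangentMapWithin (𝓡 n) (𝓡 n) φ φ.source (X.toBundle q)).2) φ.source :=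
    (contMDiff_snd_tangentBundle_modelSpace (n := ∞) (Euc n) (𝓡 n)).comp_contMDiffOn
      (htangent.comp (hX.mono (Set.subset_univ _)) fun q hq ↦ hq)
  refine (hpush.comp (contMDiffOn_symm_of_mem_maximalAtlas hφ) fun x hx ↦ φ.map_target hx)
    |>.contDiffOn.congr fun x hx ↦ ?_
  have hq := φ.map_target hx
  exact congrArg (fun p : TangentBundle (𝓡 n) (Euc n) ↦ (p.2 : Euc n))
    (tangentMapWithin_eq_tangentMap (p := X.toBundle (φ.symm x))
      (φ.open_source.uniqueMDiffOn _ hq)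
      ((contMDiffAt_of_mem_maximalAtlas hφ hq).mdifferentiableAt (by simp))).symm

end Chart

section CentroaffineChart

variable {n : ℕ} {M : Type*} [TopologicalSpace M] [ChartedSpace (Euc n) M]
  {φ : OpenPartialHomeomorph M (Euc n)} (hφ : φ ∈ IsManifold.maximalAtlas (𝓡 n) ∞ M)
  {ψ : M → Euc (n + 1)} (hψ : IsCentroaffine ψ)
  {q : M} (hq : q ∈ φ.source) {x : Euc n} (hx : x ∈ φ.target)
include hφ hψ

lemma contDiffOn_comp_chart_symm : ContDiffOn ℝ ∞ (ψ ∘ φ.symm) φ.target :=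
  (hψ.smooth.comp_contMDiffOn (contMDiffOn_symm_of_mem_maximalAtlas hφ)).contDiffOn

section
include hx

lemma contDiffAt_comp_chart_symm : ContDiffAt ℝ ∞ (ψ ∘ φ.symm) x :=
  (contDiffOn_comp_chart_symm hφ hψ).contDiffAt (φ.open_target.mem_nhds hx)

end

section
include hq

lemma mvfderiv_immersion (v : TangentSpace (𝓡 n) q) :
    mvfderiv (𝓡 n) ψ q v = fderiv ℝ (ψ ∘ φ.symm) (φ q) (chartDeriv φ q v) :=
  mvfderiv_eq_fderiv_chart hφ hq (fun y hy ↦ by rw [Function.comp_apply, φ.left_inv hy])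
    ((contDiffAt_comp_chart_symm hφ hψ (φ.map_source hq)).differentiableAt (by simp)) v

lemma flatDeriv_coordField (b : Euc n) (v : TangentSpace (𝓡 n) q) :
    flatDeriv ψ (coordField φ b) q v =
      fderiv ℝ (fderiv ℝ (ψ ∘ φ.symm)) (φ q) (chartDeriv φ q v) b := by
  have hd : DifferentiableAt ℝ (fderiv ℝ (ψ ∘ φ.symm)) (φ q) :=
    ((contDiffAt_comp_chart_symm hφ hψ (φ.map_source hq)).fderiv_right (m := ∞)
      (by norm_cast)).differentiableAt (by simp)
  rw [flatDeriv, mvfderiv_eq_fderiv_chart hφ hq (k := fun x ↦ fderiv ℝ (ψ ∘ φ.symm) x b) ?_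
    (hd.clm_apply (differentiableAt_const b)), fderiv_clm_apply_const hd]
  intro y hy
  rw [mvfderiv_immersion hφ hψ hy, chartDeriv_coordField hφ hy]

end

section
include hx

lemma transversalAt_comp_chart_symm : TransversalAt (ψ ∘ φ.symm) x := by
  intro v c hvc
  have hq := φ.map_target hx
  have hpush := mvfderiv_immersion hφ hψ hq (coordField φ v (φ.symm x))
  rw [chartDeriv_coordField hφ hq, φ.right_inv hx] at hpush
  have hsplit : splitting ψ (φ.symm x) (coordField φ v (φ.symm x), c) = 0 := by
    rw [splitting, ContinuousLinearMap.coprod_apply, ContinuousLinearMap.toSpanSingleton_apply,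
      hpush]
    exact hvc
  obtain ⟨hv, hc⟩ := Prod.mk_eq_zero.1 <|
    (hψ.splitting_isInvertible (φ.symm x)).injective (hsplit.trans (map_zero _).symm)
  exact ⟨by rw [← chartDeriv_coordField hφ hq v, hv, map_zero], hc⟩

end

variable [IsManifold (𝓡 n) ∞ M] {ε : ℝ} (hε : ε = 1 ∨ ε = -1)
include hε

section
include hq

lemma inducedConnection_and_metric_coordField (v : TangentSpace (𝓡 n) q) (b : Euc n) :
    chartDeriv φ q (inducedConnection hψ (coordField φ b) q v) =
      flatConn (ψ ∘ φ.symm) (φ q) (chartDeriv φ q v) b ∧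
    metric ε ψ q v (coordField φ b q) =
      flatMetric ε (ψ ∘ φ.symm) (φ q) (chartDeriv φ q v) b := by
  have hεε : ε * ε = 1 := by rcases hε with rfl | rfl <;> norm_num
  have ht := transversalAt_comp_chart_symm hφ hψ (φ.map_source hq)
  have hgauss := gauss_formula hψ hε (diffAt_coordField hφ hq b) v
  rw [flatDeriv_coordField hφ hψ hq, mvfderiv_immersion hφ hψ hq,
    flat_gauss_formula (by simp) hεε ht, sub_eq_add_neg, ← neg_smul, smul_smul,
    ← φ.left_inv hq, ← Function.comp_apply (f := ψ), φ.left_inv hq] at hgauss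
  obtain ⟨hconn, hmetric⟩ := ht.eq_and_eq hgauss
  have hε0 : ε ≠ 0 := by rintro rfl; simp at hεε
  exact ⟨hconn.symm, mul_left_cancel₀ hε0 (by linear_combination hmetric)⟩

lemma metric_eq_flatMetric (v w : TangentSpace (𝓡 n) q) : metric ε ψ q v w =
    flatMetric ε (ψ ∘ φ.symm) (φ q) (chartDeriv φ q v) (chartDeriv φ q w) := by
  rw [← (inducedConnection_and_metric_coordField hφ hψ hq hε v (chartDeriv φ q w)).2,
    coordField_chartDeriv hφ hq]

end

end CentroaffineChart

section ChartData

variable {n : ℕ} {M : Type*} [TopologicalSpace M] [ChartedSpace (Euc n) M]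
  [IsManifold (𝓡 n) ∞ M] {φ : OpenPartialHomeomorph M (Euc n)}
  (hφ : φ ∈ IsManifold.maximalAtlas (𝓡 n) ∞ M) {ψ : M → Euc (n + 1)} (hψ : IsCentroaffine ψ)
  {cov : CovariantDerivative (𝓡 n) (Euc n) (TangentSpace (𝓡 n) : M → Type _)}

/-- The difference tensor `K` of the induced connection and `cov`, read in the chart `φ`. It is
composed from bundled operations so that it is bilinear and continuous by construction; its values
are given by `chartDiff_apply`. -/
def chartDiff
    (cov : CovariantDerivative (𝓡 n) (Euc n) (TangentSpace (𝓡 n) : M → Type _))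
    (φ : OpenPartialHomeomorph M (Euc n)) (x : Euc n) : Euc n →L[ℝ] Euc n →L[ℝ] Euc n :=
  let e : Euc n →L[ℝ] Euc n := chartDeriv φ (φ.symm x)
  let D : Euc n →L[ℝ] Euc n →L[ℝ] Euc n := (inducedConnection hψ).difference cov (φ.symm x)
  (ContinuousLinearMap.compL ℝ (Euc n) (Euc n) (Euc n) e) ∘L
    (ContinuousLinearMap.compL ℝ (Euc n) (Euc n) (Euc n)).flip e.inverse ∘L D.flip ∘L e.inverse

lemma chartDiff_apply (φ : OpenPartialHomeomorph M (Euc n)) (x u v : Euc n) :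
    chartDiff hψ cov φ x u v = chartDeriv φ (φ.symm x)
      (differenceTensor hψ cov (φ.symm x) (coordField φ u (φ.symm x))
        (coordField φ v (φ.symm x))) := rfl

variable {x : Euc n} (hx : x ∈ φ.target)
include hφ

lemma chartDiff_chartDeriv {q : M} (hq : q ∈ φ.source) (v w : TangentSpace (𝓡 n) q) :
    chartDiff hψ cov φ (φ q) (chartDeriv φ q v) (chartDeriv φ q w) =
      chartDeriv φ q (differenceTensor hψ cov q v w) := by
  rw [chartDiff_apply, φ.left_inv hq, coordField_chartDeriv hφ hq, coordField_chartDeriv hφ hq]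

lemma chartDiff_chartField (hx : x ∈ φ.target) {X : VField n M} {c : ℝ}
    {v : TangentSpace (𝓡 n) (φ.symm x)}
    (hv : differenceTensor hψ cov (φ.symm x) (X (φ.symm x)) v = c • v) :
    chartDiff hψ cov φ x (chartField φ X x) (chartDeriv φ (φ.symm x) v) =
      c • chartDeriv φ (φ.symm x) v := by
  have h := chartDiff_chartDeriv (cov := cov) hφ hψ (φ.map_target hx) (X (φ.symm x)) v
  rwa [φ.right_inv hx, hv, map_smul] at h

lemma chartDiff_chartDistribution (hx : x ∈ φ.target) {X : VField n M} {c : ℝ}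
    {D : Π p : M, Submodule ℝ (TangentSpace (𝓡 n) p)}
    (hD : ∀ v ∈ D (φ.symm x), differenceTensor hψ cov (φ.symm x) (X (φ.symm x)) v = c • v) :
    ∀ v ∈ chartDistribution φ D x, chartDiff hψ cov φ x (chartField φ X x) v = c • v := by
  rintro _ ⟨v, hv, rfl⟩
  exact chartDiff_chartField hφ hψ hx (hD v hv)

include hx

lemma chartDeriv_cov_coordField (u v : Euc n) :
    chartDeriv φ (φ.symm x) (cov (coordField φ v) (φ.symm x) (coordField φ u (φ.symm x))) =
      flatConn (ψ ∘ φ.symm) x u v - chartDiff hψ cov φ x u v := by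
  have hq := φ.map_target hx
  have hconn := (inducedConnection_and_metric_coordField hφ hψ hq (Or.inl rfl : (1 : ℝ) = 1 ∨ _)
    (coordField φ u _) v).1
  rw [chartDeriv_coordField hφ hq, φ.right_inv hx] at hconn
  rw [chartDiff_apply, differenceTensor_apply hψ cov _ _ (diffAt_coordField hφ hq v), map_sub,
    hconn, sub_sub_cancel]

variable {ε : ℝ}

section LeviCivita

variable (hLC : IsLeviCivita (metric ε ψ) cov)
include hLC

lemma chartDiff_symm (u v : Euc n) :
    chartDiff hψ cov φ x u v = chartDiff hψ cov φ x v u := by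
  have hq := φ.map_target hx
  have htorsion := congrArg (chartDeriv φ (φ.symm x)) <|
    hLC.torsion_free _ _ _ (diffAt_coordField hφ hq u) (diffAt_coordField hφ hq v)
  rw [mlieBracket_coordField hφ hq, map_sub, map_zero, chartDeriv_cov_coordField hφ hψ hx,
    chartDeriv_cov_coordField hφ hψ hx, flatConn_symm (contDiffAt_comp_chart_symm hφ hψ hx) u v,
    sub_sub_sub_cancel_left, sub_eq_zero] at htorsion
  exact htorsion.symm

variable (hε : ε = 1 ∨ ε = -1)
include hε

lemma fderiv_flatMetric_chart (u v w : Euc n) :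
    fderiv ℝ (flatMetric ε (ψ ∘ φ.symm)) x u v w =
      flatMetric ε (ψ ∘ φ.symm) x
        (flatConn (ψ ∘ φ.symm) x u v - chartDiff hψ cov φ x u v) w +
      flatMetric ε (ψ ∘ φ.symm) x v
        (flatConn (ψ ∘ φ.symm) x u w - chartDiff hψ cov φ x u w) := by
  have hq := φ.map_target hx
  have hmetric (y : M) (hy : y ∈ φ.source) : metric ε ψ y (coordField φ v y) (coordField φ w y) =
      flatMetric ε (ψ ∘ φ.symm) (φ y) v w := by
    rw [metric_eq_flatMetric hφ hψ hy hε, chartDeriv_coordField hφ hy, chartDeriv_coordField hφ hy]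
  have hdiff : DifferentiableAt ℝ (flatMetric ε (ψ ∘ φ.symm)) (φ (φ.symm x)) := by
    rw [φ.right_inv hx]
    exact (contDiffAt_flatMetric (by simp) (contDiffAt_comp_chart_symm hφ hψ hx)
      (transversalAt_comp_chart_symm hφ hψ hx)).differentiableAt (by simp)
  have hcompatible := hLC.compatible _ _ _ (diffAt_coordField hφ hq v) (diffAt_coordField hφ hq w)
    (coordField φ u (φ.symm x))
  rw [mvfderiv_eq_fderiv_chart hφ hq (k := fun y ↦ flatMetric ε (ψ ∘ φ.symm) y v w) hmetric
    (by fun_prop), fderiv_clm_apply₂_const hdiff] at hcompatible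
  simpa only [metric_eq_flatMetric hφ hψ hq hε, chartDeriv_coordField hφ hq,
    chartDeriv_cov_coordField hφ hψ hx, φ.right_inv hx] using hcompatible

end LeviCivita

variable (hε : ε = 1 ∨ ε = -1)
include hψ hε

lemma flatMetric_chart_apply (v w : TangentSpace (𝓡 n) (φ.symm x)) :
    flatMetric ε (ψ ∘ φ.symm) x (chartDeriv φ (φ.symm x) v) (chartDeriv φ (φ.symm x) w) =
      metric ε ψ (φ.symm x) v w := by
  rw [metric_eq_flatMetric hφ hψ (φ.map_target hx) hε, φ.right_inv hx]

lemma flatMetric_chart_pos (hpos : MetricPosDef ε ψ) {v : Euc n} (hv : v ≠ 0) :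
    0 < flatMetric ε (ψ ∘ φ.symm) x v v := by
  have hq := φ.map_target hx
  rw [← chartDeriv_coordField hφ hq v, flatMetric_chart_apply hφ hψ hx hε]
  refine hpos _ _ fun h0 ↦ hv ?_
  rw [← chartDeriv_coordField hφ hq v, h0, map_zero]

end ChartData

section Localization

variable {n n₁ n₂ : ℕ} {M : Type*} [TopologicalSpace M] [ChartedSpace (Euc n) M]
  [IsManifold (𝓡 n) ∞ M] {φ : OpenPartialHomeomorph M (Euc n)}
  (hφ : φ ∈ IsManifold.maximalAtlas (𝓡 n) ∞ M) {ψ : M → Euc (n + 1)} (hψ : IsCentroaffine ψ)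
  {cov : CovariantDerivative (𝓡 n) (Euc n) (TangentSpace (𝓡 n) : M → Type _)}
  {ε : ℝ} (hε : ε = 1 ∨ ε = -1) (hpos : MetricPosDef ε ψ)
  (hLC : IsLeviCivita (metric ε ψ) cov) {O : Set (Euc n)} (hO : IsOpen O) (hOφ : O ⊆ φ.target)
include hφ hε hpos hLC hO hOφ

lemma structureEquations_chart : StructureEquations ε O (ψ ∘ φ.symm)
    (fun x ↦ flatConn (ψ ∘ φ.symm) x - chartDiff hψ cov φ x) (chartDiff hψ cov φ)
    (flatMetric ε (ψ ∘ φ.symm)) :=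
  structureEquations_of_compatible (by simp) (by rcases hε with rfl | rfl <;> norm_num) hO
    ((contDiffOn_comp_chart_symm hφ hψ).mono hOφ)
    (fun _ hx ↦ transversalAt_comp_chart_symm hφ hψ (hOφ hx))
    (fun _ hx _ hv ↦ flatMetric_chart_pos hφ hψ (hOφ hx) hε hpos hv)
    (fun _ hx ↦ chartDiff_symm hφ hψ (hOφ hx) hLC)
    (fun _ hx ↦ fderiv_flatMetric_chart hφ hψ (hOφ hx) hLC hε)

lemma isEigenField_chart (hn : 1 + n₁ + n₂ = n) {T : VField n M} (hT : T.SmoothOn Set.univ)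
    (hunit : ∀ p, metric ε ψ p (T p) (T p) = 1)
    {D₂ D₃ : Π p : M, Submodule ℝ (TangentSpace (𝓡 n) p)}
    (hn₁ : ∀ p, Module.finrank ℝ (D₂ p) = n₁) (hn₂ : ∀ p, Module.finrank ℝ (D₃ p) = n₂) {a b : ℝ}
    (hKTT : ∀ p, differenceTensor hψ cov p (T p) (T p) = (a + b) • T p)
    (hKTV : ∀ p, ∀ v ∈ D₂ p, differenceTensor hψ cov p (T p) v = a • v)
    (hKTW : ∀ p, ∀ w ∈ D₃ p, differenceTensor hψ cov p (T p) w = b • w)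
    (hab : a * b = ε) (hne : a ≠ b) : IsEigenField ε O (ψ ∘ φ.symm)
      (fun x ↦ flatConn (ψ ∘ φ.symm) x - chartDiff hψ cov φ x) (chartDiff hψ cov φ)
      (flatMetric ε (ψ ∘ φ.symm)) a b (chartField φ T) := by
  refine (structureEquations_chart hφ hψ hε hpos hLC hO hOφ).isEigenField
    (D₂ := chartDistribution φ D₂) (D₃ := chartDistribution φ D₃)
    ((contDiffOn_chartField hφ hT).mono hOφ)
    (fun x hx ↦ (flatMetric_chart_apply hφ hψ (hOφ hx) hε _ _).trans (hunit _)) hab hne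
    (fun x hx ↦ ?_) (fun x hx ↦ chartDiff_chartField hφ hψ (hOφ hx) (hKTT _))
    (fun x hx ↦ chartDiff_chartDistribution hφ hψ (hOφ hx) (hKTV _))
    (fun x hx ↦ chartDiff_chartDistribution hφ hψ (hOφ hx) (hKTW _))
  rw [finrank_chartDistribution hφ D₂ (hOφ hx), finrank_chartDistribution hφ D₃ (hOφ hx), hn₁,
    hn₂, hn, finrank_euclideanSpace_fin]

end Localization

section PartialDiffeomorph

variable {n n₁ n₂ : ℕ} {M : Type*} [TopologicalSpace M] [ChartedSpace (Euc n) M]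

/-- A chart of `M` followed by a smooth local equivalence with `ℝ × ℝ^n₁ × ℝ^n₂`. -/
def chartTransPartialDiffeomorph {φ : OpenPartialHomeomorph M (Euc n)}
    (hφ : φ ∈ IsManifold.maximalAtlas (𝓡 n) ∞ M)
    {Φ : OpenPartialHomeomorph (Euc n) (ℝ × Euc n₁ × Euc n₂)}
    (hΦ : ContDiffOn ℝ ∞ Φ Φ.source) (hsymm : ContDiffOn ℝ ∞ Φ.symm Φ.target) :
    PartialDiffeomorph (𝓡 n) (𝓘(ℝ, ℝ).prod ((𝓡 n₁).prod (𝓡 n₂))) M (ℝ × Euc n₁ × Euc n₂) ∞ where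
  toPartialEquiv := (φ.trans Φ).toPartialEquiv
  open_source := (φ.trans Φ).open_source
  open_target := (φ.trans Φ).open_target
  contMDiffOn_toFun := by
    have h : ContMDiffOn (𝓡 n) 𝓘(ℝ, ℝ × Euc n₁ × Euc n₂) ∞ (φ.trans Φ) (φ.trans Φ).source :=
      hΦ.contMDiffOn.comp ((contMDiffOn_of_mem_maximalAtlas hφ).mono fun _ hx ↦ hx.1)
        fun _ hx ↦ hx.2
    rwa [modelWithCornersSelf_prod, modelWithCornersSelf_prod, ← chartedSpaceSelf_prod,
      ← chartedSpaceSelf_prod] at h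
  contMDiffOn_invFun := by
    have h : ContMDiffOn 𝓘(ℝ, ℝ × Euc n₁ × Euc n₂) (𝓡 n) ∞ (φ.trans Φ).symm (φ.trans Φ).target :=
      (contMDiffOn_symm_of_mem_maximalAtlas hφ).comp
        (hsymm.contMDiffOn.mono fun _ hx ↦ hx.1) fun _ hx ↦ hx.2
    rwa [modelWithCornersSelf_prod, modelWithCornersSelf_prod, ← chartedSpaceSelf_prod,
      ← chartedSpaceSelf_prod] at h

lemma IsEigenField.exists_partialDiffeomorph {φ : OpenPartialHomeomorph M (Euc n)}
    (hφ : φ ∈ IsManifold.maximalAtlas (𝓡 n) ∞ M) {ψ : M → Euc (n + 1)} {ε a b : ℝ}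
    {O : Set (Euc n)} {Γ K : Euc n → Euc n →L[ℝ] Euc n →L[ℝ] Euc n}
    {h : Euc n → Euc n →L[ℝ] Euc n →L[ℝ] ℝ} {T : Euc n → Euc n}
    (H : IsEigenField ε O (ψ ∘ φ.symm) Γ K h a b T) (hO : Convex ℝ O) (hn : 1 + n₁ + n₂ = n) {p : M}
    (hp : p ∈ φ.source) (hpO : φ p ∈ O) {D₂ D₃ : Submodule ℝ (Euc n)}
    (hn₁ : Module.finrank ℝ D₂ = n₁) (hn₂ : Module.finrank ℝ D₃ = n₂)
    (hD₂ : ∀ v ∈ D₂, K (φ p) (T (φ p)) v = a • v) (hD₃ : ∀ v ∈ D₃, K (φ p) (T (φ p)) v = b • v) :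
    ∃ (l : ℝ) (ψ₁ : Euc n₁ → Euc (n₁ + 1)) (ψ₂ : Euc n₂ → Euc (n₂ + 1))
      (Φ : PartialDiffeomorph (𝓡 n) (𝓘(ℝ, ℝ).prod ((𝓡 n₁).prod (𝓡 n₂))) M
        (ℝ × Euc n₁ × Euc n₂) ∞)
      (A : (Euc (n₁ + 1) × Euc (n₂ + 1)) ≃L[ℝ] Euc (n + 1)),
      l ≠ 0 ∧ l ≠ -1 ∧ IsLocallyStronglyConvex ψ₁ ∧ IsLocallyStronglyConvex ψ₂ ∧ p ∈ Φ.source ∧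
      ∀ x ∈ Φ.source, ψ x = A (calabiProduct l ψ₁ ψ₂ (Φ x)) := by
  obtain ⟨l, Φ, ψ₁, ψ₂, A, hl0, hl, hψ₁, hψ₂, hpΦ, -, hΦ, hsymm, heq⟩ :=
    H.exists_stronglyConvex_calabi (by simp [hn]) (by simp) hO hpO hn₁ hn₂ hD₂ hD₃
  refine ⟨l, ψ₁, ψ₂, chartTransPartialDiffeomorph hφ hΦ hsymm, A, hl0, hl, hψ₁, hψ₂, ⟨hp, hpΦ⟩,
    fun y hy ↦ ?_⟩
  have hy' := heq (φ y) hy.2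
  rwa [Function.comp_apply, φ.left_inv hy.1] at hy'

end PartialDiffeomorph

end Centroaffine

end

open Centroaffine in
theorem theorem3p1_general {n n₁ n₂ : ℕ} (hn : 1 + n₁ + n₂ = n)
    {M : Type*} [TopologicalSpace M] [ChartedSpace (Euc n) M] [IsManifold (𝓡 n) ∞ M]
    {ψ : M → Euc (n + 1)} (hψ : IsCentroaffine ψ)
    {ε : ℝ} (hε : ε = 1 ∨ ε = -1) (hpos : MetricPosDef ε ψ)
    {nablaHat : CovariantDerivative (𝓡 n) (Euc n) (TangentSpace (𝓡 n) : M → Type _)}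
    (hLC : IsLeviCivita (metric ε ψ) nablaHat)
    {T : VField n M} (hT : T.SmoothOn Set.univ) (hunit : ∀ p, metric ε ψ p (T p) (T p) = 1)
    {D₂ D₃ : Π p : M, Submodule ℝ (TangentSpace (𝓡 n) p)}
    (hn₁ : ∀ p, Module.finrank ℝ (D₂ p) = n₁) (hn₂ : ∀ p, Module.finrank ℝ (D₃ p) = n₂)
    {l₂ l₃ : ℝ}
    (hKTT : ∀ p, differenceTensor hψ nablaHat p (T p) (T p) = (l₂ + l₃) • T p)
    (hKTV : ∀ p, ∀ v ∈ D₂ p, differenceTensor hψ nablaHat p (T p) v = l₂ • v)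
    (hKTW : ∀ p, ∀ w ∈ D₃ p, differenceTensor hψ nablaHat p (T p) w = l₃ • w)
    (hl₂₃ : l₂ * l₃ = ε) (hne : l₂ ≠ l₃) :
    IsLocallyCalabiProduct n₁ n₂ ψ := by
  intro p
  have hφ := IsManifold.chart_mem_maximalAtlas (I := 𝓡 n) (n := ∞) p
  set φ := chartAt (Euc n) p
  have hp : p ∈ φ.source := mem_chart_source (Euc n) p
  obtain ⟨r, hr, hball⟩ := Metric.isOpen_iff.1 φ.open_target (φ p) (φ.map_source hp)
  have hx := Metric.mem_ball_self (x := φ p) hr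
  have H := isEigenField_chart hφ hψ hε hpos hLC Metric.isOpen_ball hball hn hT hunit hn₁ hn₂
    hKTT hKTV hKTW hl₂₃ hne
  obtain ⟨l, ψ₁, ψ₂, Φ, A, hl0, hl, hcalabi⟩ := H.exists_partialDiffeomorph hφ
    (convex_ball _ _) hn hp hx
    ((finrank_chartDistribution hφ D₂ (hball hx)).trans (hn₁ _))
    ((finrank_chartDistribution hφ D₃ (hball hx)).trans (hn₂ _))
    (chartDiff_chartDistribution hφ hψ (hball hx) (hKTV _))
    (chartDiff_chartDistribution hφ hψ (hball hx) (hKTW _))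
  exact ⟨l, hl0, hl, Euc n₁, inferInstance, inferInstance, inferInstance, inferInstance,
    inferInstance, Euc n₂, inferInstance, inferInstance, inferInstance, inferInstance,
    inferInstance, ψ₁, ψ₂, Φ, A, hcalabi⟩

open Centroaffine in
theorem theorem3p1 {n n₁ n₂ : ℕ} (hn : 1 + n₁ + n₂ = n)
    {M : Type*} [TopologicalSpace M] [ChartedSpace (Euc n) M] [IsManifold (𝓡 n) ∞ M]
    (ψ : M → Euc (n + 1)) (hψ : IsCentroaffine ψ)
    (ε : ℝ) (hε : ε = 1 ∨ ε = -1) (hpos : MetricPosDef ε ψ)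
    (nablaHat : CovariantDerivative (𝓡 n) (Euc n) (TangentSpace (𝓡 n) : M → Type _))
    (hLC : IsLeviCivita (metric ε ψ) nablaHat)
    (T : VField n M) (hT : T.SmoothOn Set.univ) (hunit : ∀ p, metric ε ψ p (T p) (T p) = 1)
    (D₂ D₃ : Π p : M, Submodule ℝ (TangentSpace (𝓡 n) p))
    (hD₂ : IsDistribution n₁ D₂) (hD₃ : IsDistribution n₂ D₃)
    (horth₁₂ : ∀ p, ∀ v ∈ D₂ p, metric ε ψ p (T p) v = 0)
    (horth₁₃ : ∀ p, ∀ w ∈ D₃ p, metric ε ψ p (T p) w = 0)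
    (horth₂₃ : ∀ p, ∀ v ∈ D₂ p, ∀ w ∈ D₃ p, metric ε ψ p v w = 0)
    (l₁ l₂ l₃ : ℝ)
    (hKTT : ∀ p, differenceTensor hψ nablaHat p (T p) (T p) = l₁ • T p)
    (hKTV : ∀ p, ∀ v ∈ D₂ p, differenceTensor hψ nablaHat p (T p) v = l₂ • v)
    (hKTW : ∀ p, ∀ w ∈ D₃ p, differenceTensor hψ nablaHat p (T p) w = l₃ • w)
    (hKVW : ∀ p, ∀ v ∈ D₂ p, ∀ w ∈ D₃ p, differenceTensor hψ nablaHat p v w = 0)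
    (hl₁ : l₁ = l₂ + l₃) (hl₂₃ : l₂ * l₃ = ε) (hne : l₂ ≠ l₃) :
    IsLocallyCalabiProduct n₁ n₂ ψ :=
  theorem3p1_general hn hψ hε hpos hLC hT hunit hD₂.finrank_eq hD₃.finrank_eq
    (fun p ↦ hl₁ ▸ hKTT p) hKTV hKTW hl₂₃ hne
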